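/- Let $\mathbb A$ be a nonempty finite set and let $(\sigma,\tau)$ be a weighted substitution on $\mathbb A$: each $a\in\mathbb A$ is assigned a word $\sigma(a)=\sigma(a)_0\cdots\sigma(a)_{\ell_a-1}$ over $\mathbb A$ and weights $\tau(a)_0,\dots,\tau(a)_{\ell_a-1}\in(0,1)$ of sum $1$. Let $\sigma^n(a)$ be the iterated words, and $\tau^n(a)_i$ the weight of the $i$-th letter of $\sigma^n(a)$, i.e. the product of the weights along its line of descent from $a$ (so $\sigma^0(a)=a$, $\tau^0(a)_0=1$). Assume that $\sigma$ is primitive: for some $n\ge 1$ every letter occurs in every $\sigma^n(a)$. Let $G=B(\sigma,\tau)$ be the closed multiplicative subgroup of $\mathbb R_+=(0,\infty)$ generated by all $\tau^n(a)_i$ with $a\in\mathbb A$, $n\ge 0$ and $\sigma^n(a)_i=a$, and let $g:\mathbb A\to\mathbb R_+$ satisfy $g(\sigma(a)_i)G=g(a)\tau(a)_iG$ for all $a$, $i$. A colored tiling is a set $\omega$ of pairs $(R,a)$, where $R=(x_1,x_2)\times(y_1,y_2)$ is an open rectangle in the upper half plane $\mathbb H$ with $x_2-x_1=y_1$ and $a\in\mathbb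 A$, such that different pairs have disjoint rectangles and the closures of the rectangles cover $\mathbb H$. Tilings $\omega_n$ converge to $\omega$ if for every $(R,a)\in\omega$ there are $(R_n,a_n)\in\omega_n$ with $a_n=a$ eventually and $R_n\to R$ in the Hausdorff metric. For $\lambda>0$ put $\lambda\omega=\{(\lambda R,a):(R,a)\in\omega\}$. Let $\Omega=\Omega(\sigma,\tau,g)$ be the closure of the set of those colored tilings $\omega$ such that no vertical line misses all rectangles of $\omega$, and such that for every $((x_1,x_2)\times(y_1,y_2),a)\in\omega$ we have $y_1\in g(a)G$ and, for all $0\le i<\ell_a$, $(R^i,\sigma(a)_i)\in\omega$, where $$R^i=\Big(x_1+(x_2-x_1)\sum_{j<i}\tau(a)_j,\ x_1+(x_2-x_1)\sum_{j\le i}\tau(a)_j\Big)\times(\tau(a)_iy_1,\,y_1).$$ Let $\Theta$ be the set of closed orbits, that is, of the orbits $\xi=G\omega$ with $\omega\in\Omega$ such that $\lambda\omega=\omega$ for some $\lambda\in G$, $\lambda>1$; let $c(\xi)$ be the least such $\lambda$. Let $$\zeta_\Omega(\alpha)=\prod_{\xi\in\Theta}\bigl(1-c(\xi)^{-\alpha}\bigr)^{-1}\qquad(\operatorname{Re}\alpha>1),$$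 extended to a meromorphic function on $\mathbb C$ (the product converges and the extension exists, which is part of the claim). **Theorem 4.3.** (i) If $B(\sigma,\tau)=\{\lambda^n;\,n\in\mathbb Z\}$ with $\lambda>1$, then there exist polynomials $p,q\in\mathbb Z[z]$, $q\ne0$, such that $\zeta_\Omega(\alpha)=p(\lambda^\alpha)/q(\lambda^\alpha)$ as meromorphic functions of $\alpha\in\mathbb C$. (ii) Conversely, if $\zeta_\Omega(\alpha)=p(\lambda^\alpha)/q(\lambda^\alpha)$ as meromorphic functions on $\mathbb C$ for some polynomials $p,q\in\mathbb Z[z]$, $q\neq 0$, and some $\lambda>1$, then $B(\sigma,\tau)=\{\lambda^{kn};\,n\in\mathbb Z\}$ for some positive integer $k$. -/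

import Mathlib

open scoped Pointwise

noncomputable section

namespace NumerationSystem

/-- The multiplicative group of positive real numbers, with the topology induced from the reals. -/
abbrev PosReal : Type := {x : ℝ // 0 < x}

/-! ### Weighted substitutions -/

/-- A weighted substitution on `A`: every letter `a` is sent to the nonempty word
`σ a 0, σ a 1, …, σ a (len a - 1)`, whose letters carry weights `τ a i ∈ (0,1)` of sum `1`. -/
structure WeightedSubst (A : Type*) where
  len : A → ℕ
  σ : (a : A) → Fin (len a) → A
  τ : (a : A) → Fin (len a) → PosReal
  τ_lt_one : ∀ a i, (τ a i : ℝ) < 1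
  sum_τ : ∀ a, ∑ i, (τ a i : ℝ) = 1

namespace WeightedSubst

variable {A : Type*} (W : WeightedSubst A)

/-- The word `σⁿ(a)` together with its weights `τⁿ(a)`, read from left to right: the word of
`n + 1` is the concatenation, over the letters `σ(a)ᵢ` of `σ(a)`, of the words of `n` of these
letters, with all weights multiplied by `τ(a)ᵢ`. -/
def iter : ℕ → A → List (A × PosReal)
  | 0, a => [(a, 1)]
  | n + 1, a =>
      (List.ofFn fun i => (iter n (W.σ a i)).map fun p => (p.1, W.τ a i * p.2)).flatten

/-- Some power `σⁿ` with `n > 0` has every letter occurring in the image of every letter. -/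
def IsPrimitive : Prop :=
  ∃ n : ℕ, 0 < n ∧ ∀ a a' : A, ∃ t : PosReal, (a', t) ∈ W.iter n a

/-- The base set `B(σ, τ)`: the smallest closed subgroup of the positive reals that contains
all weights `τⁿ(a)ᵢ` of occurrences of `a` in `σⁿ(a)`. -/
def baseSet : Subgroup PosReal :=
  sInf {H : Subgroup PosReal | IsClosed (H : Set PosReal) ∧
    {t : PosReal | ∃ (a : A) (n : ℕ), (a, t) ∈ W.iter n a} ⊆ H}

/-- The coset condition `g(σ(a)ᵢ) G = g(a) τ(a)ᵢ G` for `G = B(σ, τ)`. -/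
def IsCompatible (g : A → PosReal) : Prop :=
  ∀ (a : A) (i : Fin (W.len a)),
    g (W.σ a i) • (W.baseSet : Set PosReal) = (g a * W.τ a i) • (W.baseSet : Set PosReal)

end WeightedSubst

/-! ### Colored tilings of the upper half plane -/

/-- The data of an admissible tile `(x₁, x₂) × (y₁, y₂)`, that is, one with `x₂ - x₁ = y₁`,
in the upper half plane. -/
@[ext]
structure Tile where
  x₁ : ℝ
  x₂ : ℝ
  y₁ : ℝ
  y₂ : ℝ
  y₁_pos : 0 < y₁
  y₁_lt_y₂ : y₁ < y₂
  width : x₂ - x₁ = y₁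

namespace Tile

/-- The open rectangle, as a subset of the complex plane. -/
def toSet (R : Tile) : Set ℂ := {z | R.x₁ < z.re ∧ z.re < R.x₂ ∧ R.y₁ < z.im ∧ z.im < R.y₂}

/-- The tile `l R`. -/
def scale (l : PosReal) (R : Tile) : Tile where
  x₁ := l * R.x₁
  x₂ := l * R.x₂
  y₁ := l * R.y₁
  y₂ := l * R.y₂
  y₁_pos := mul_pos l.2 R.y₁_pos
  y₁_lt_y₂ := mul_lt_mul_of_pos_left R.y₁_lt_y₂ l.2
  width := by rw [← mul_sub, R.width]

theorem toSet_scale (l : PosReal) (R : Tile) :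
    (scale l R).toSet = (Homeomorph.mulLeft₀ (l : ℂ) (by exact_mod_cast l.2.ne')) '' R.toSet := by
  have hl := l.2
  ext z
  rw [Homeomorph.image_eq_preimage_symm]
  have hz : z = (l : ℂ) * ((l : ℂ)⁻¹ * z) := by
    rw [mul_inv_cancel_left₀]; exact_mod_cast hl.ne'
  have h : (Homeomorph.mulLeft₀ (l : ℂ) (by exact_mod_cast hl.ne')).symm z = (l : ℂ)⁻¹ * z := by
    simp
  rw [Set.mem_preimage, h]
  generalize (l : ℂ)⁻¹ * z = w at hz
  subst hz
  simp [toSet, scale, hl]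

/-- The `i`-th child of a tile `R` of color `a`. -/
def child {A : Type*} (W : WeightedSubst A) (R : Tile) (a : A) (i : Fin (W.len a)) : Tile where
  x₁ := R.x₁ + (R.x₂ - R.x₁) * ∑ j ∈ Finset.Iio i, (W.τ a j : ℝ)
  x₂ := R.x₁ + (R.x₂ - R.x₁) * ∑ j ∈ Finset.Iic i, (W.τ a j : ℝ)
  y₁ := W.τ a i * R.y₁
  y₂ := R.y₁
  y₁_pos := mul_pos (W.τ a i).2 R.y₁_pos
  y₁_lt_y₂ := mul_lt_of_lt_one_left R.y₁_pos (W.τ_lt_one a i)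
  width := by
    rw [← Finset.Iio_insert, Finset.sum_insert (by simp), R.width]
    ring

end Tile

/-- A colored tiling of the upper half plane with colors in `A`: a set of pairwise disjoint
colored admissible tiles whose closures cover the upper half plane. -/
@[ext]
structure ColoredTiling (A : Type*) where
  tiles : Set (Tile × A)
  disjoint : ∀ p ∈ tiles, ∀ q ∈ tiles, p ≠ q → Disjoint p.1.toSet q.1.toSet
  cover : ⋃ p ∈ tiles, closure p.1.toSet = {z : ℂ | 0 < z.im}

namespace ColoredTiling

variable {A : Type*}

/-- The topology on the space of colored tilings in which a net `ω_n` converges to `ω` exactly if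
every `(R, a) ∈ ω` is a limit, for the Hausdorff distance and with the color `a` eventually fixed,
of colored tiles of `ω_n`. It is generated by the sets of the tilings that have a tile of
color `a` at distance less than `ε` from `R`. -/
instance : TopologicalSpace (ColoredTiling A) :=
  TopologicalSpace.generateFrom
    {U | ∃ (R : Tile) (a : A) (ε : ℝ), 0 < ε ∧
      U = {ω | ∃ R' : Tile, (R', a) ∈ ω.tiles ∧ Metric.hausdorffDist R.toSet R'.toSet < ε}}

/-- The multiplicative action `l ω = {(l R, a) ; (R, a) ∈ ω}`. -/
def scale (l : PosReal) (ω : ColoredTiling A) : ColoredTiling A where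
  tiles := (fun p : Tile × A => (p.1.scale l, p.2)) '' ω.tiles
  disjoint := by
    rintro _ ⟨p, hp, rfl⟩ _ ⟨q, hq, rfl⟩ hpq
    have hne : p ≠ q := by rintro rfl; exact hpq rfl
    simp only [Tile.toSet_scale]
    exact (Set.disjoint_image_iff (Homeomorph.injective _)).2 (ω.disjoint p hp q hq hne)
  cover := by
    have hl := l.2
    simp only [Set.biUnion_image, Tile.toSet_scale, ← Homeomorph.image_closure]
    rw [← Set.image_iUnion₂, ω.cover, Homeomorph.image_eq_preimage_symm]
    ext z
    have h : (Homeomorph.mulLeft₀ (l : ℂ) (by exact_mod_cast hl.ne')).symm z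
        = (((l : ℝ)⁻¹ : ℝ) : ℂ) * z := by simp
    rw [Set.mem_preimage, h]
    simp [hl]

/-- The vertical line through `x` meets no tile of the tiling. -/
def IsSeparatingLine (ω : ColoredTiling A) (x : ℝ) : Prop :=
  ∀ p ∈ ω.tiles, p.1.toSet ∩ {z : ℂ | z.re = x} = ∅

end ColoredTiling

/-! ### The tiling space of a weighted substitution and its zeta function -/

namespace WeightedSubst

variable {A : Type*} (W : WeightedSubst A) (g : A → PosReal)

/-- The tilings `ω` such that every tile `(x₁, x₂) × (y₁, y₂)` of color `a` in `ω` has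
`y₁ ∈ g(a) G`, and has all its children, with their colors, in `ω`. -/
def preSpace : Set (ColoredTiling A) :=
  {ω | ∀ (R : Tile) (a : A), (R, a) ∈ ω.tiles →
    (∃ y ∈ g a • (W.baseSet : Set PosReal), (y : ℝ) = R.y₁) ∧
    ∀ i : Fin (W.len a), (R.child W a i, W.σ a i) ∈ ω.tiles}

/-- The space `Ω(σ, τ, g)`: the closure of the set of the tilings in `preSpace` that have no
separating line. -/
def space : Set (ColoredTiling A) :=
  closure {ω | ω ∈ W.preSpace g ∧ ¬ ∃ x : ℝ, ω.IsSeparatingLine x}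

/-- The closed orbits of the action of `G = B(σ, τ)` on `Ω(σ, τ, g)`: the orbits `G ω` of those
`ω` for which `l ω = ω` for some `l ∈ G` with `l > 1`. -/
def closedOrbits : Set (Set (ColoredTiling A)) :=
  {ξ | ∃ ω ∈ W.space g, (∃ l ∈ W.baseSet, 1 < l ∧ ω.scale l = ω) ∧
    ξ = {ω' | ∃ l ∈ W.baseSet, ω' = ω.scale l}}

/-- The minimum multiplicative cycle `c(ξ)`: the least `l ∈ G` with `l > 1` such that `l ω = ω`
for the points `ω` of `ξ`. -/
def cycle (ξ : Set (ColoredTiling A)) : ℝ :=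
  sInf {x : ℝ | ∃ l ∈ W.baseSet, (l : ℝ) = x ∧ 1 < l ∧ ∀ ω ∈ ξ, ω.scale l = ω}

/-- `Z` is the meromorphic continuation to the whole plane of the Euler product
`∏ (1 - c(ξ)^{-α})⁻¹` over the closed orbits `ξ`, which converges for `Re α > 1`. The normal form
condition only fixes the values of `Z` at its singularities (it removes the removable ones, and
gives the value `0` to the poles), so that there is at most one such `Z`. -/
def IsZeta (Z : ℂ → ℂ) : Prop :=
  MeromorphicNFOn Z Set.univ ∧
    ∀ α : ℂ, 1 < α.re →
      HasProd (fun ξ : W.closedOrbits g => (1 - (W.cycle (ξ : Set (ColoredTiling A)) : ℂ) ^ (-α))⁻¹)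
        (Z α)

open Classical in
/-- The zeta function `ζ_Ω` of `Ω = Ω(σ, τ, g)`. -/
def zeta : ℂ → ℂ := if h : ∃ Z, W.IsZeta g Z then h.choose else 0

end WeightedSubst

end NumerationSystem

end

noncomputable section

namespace NumerationSystem

/-! ### Traces of powers and determinants -/

section Matrices

variable {n : Type*} [Fintype n] [DecidableEq n]

/-! The closed orbits are, up to finitely many, the primitive cycles of a finite graph. Its vertices
are the edges `(a, i)` of the substitution, each followed by the edges at the letter `σ(a)ᵢ`. If `l
ω = ω` with `l > 1` and some tile has `0` strictly inside its column, then each such tile has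
exactly one child of the same kind. The positions of these children form a periodic path, and
scaling by `l⁻¹` moves along it by a period. Conversely a periodic path fixes the relative position
`pos x` of `0` in its tiles by a series, and if `0 < pos x < 1` the descendants of ever larger tiles
form an invariant tiling. The choice of height within its coset is absorbed by the orbit, and the
multiplicative cycle is the inverse of the weight of the primitive cycle (`exists_eq_tiling`,
`orbitOf_stdTiling_eq_iff`, `cycle_orbitOf_stdTiling`).

Two finite sets of exceptions remain. Paths with `pos x` equal to `0` or `1` always take the first
or always the last child. Closed orbits with no tile over `0` are determined by the colors and the
height ratio of one tile on each side of the line; such ratios are limits of ratios occurring below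
a common ancestor, and modulo a return weight `θ` these are finite in number
(`finite_separating_closedOrbits`).

For `Re α > 1` the product over primitive cycles is `1 / det (1 - M(α))`, where `M(α)` has the
`α`-th powers of the weights as entries; this is the expansion of `log det` in traces of powers. So
the zeta function is `eulerProd U / (eulerProd V * edgeDet)` with entire numerator and denominator
(`exists_hasProd_cycle`, `zeta_spec`).

If `G` consists of the powers of `λ`, conjugating `M(α)` by the diagonal matrix of the `g ^ α` turns
its entries into integral powers of `λ ^ α`, which gives the rational function.

For the converse, the weights of a word sum to `1`, so `edgeDet` vanishes at `1`. The finite Euler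
products have no zeros in `Re α > 0`, so the zeta function has a pole there. A function of `λ ^ α`
repeats this pole at `1 + 2πi / log λ`, so `edgeDet` vanishes there too. A null vector on the line
`Re α = 1` must be constant in modulus and equal to each term of the average defining it, by strict
convexity and primitivity. This makes the character `s ↦ s ^ (2πi / log λ)` trivial on all return
weights, hence on `G`, and `G` lies in the powers of `λ`. -/

theorem det_aeval_eq_prod_roots (M : Matrix n n ℂ) (p : Polynomial ℂ) (hp : p.Monic) :
    (Polynomial.aeval M p).det = (M.charpoly.roots.map fun μ => p.eval μ).prod := by
  have hdet : ∀ c : ℂ, (M - algebraMap ℂ _ c).det = (M.charpoly.roots.map fun μ => μ - c).prod := by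
    intro c
    have h1 : M.charpoly.eval c = (M.charpoly.roots.map fun μ => c - μ).prod := by
      conv_lhs => rw [(IsAlgClosed.splits M.charpoly).eq_prod_roots_of_monic M.charpoly_monic]
      rw [Polynomial.eval_multiset_prod, Multiset.map_map]
      simp
    rw [Matrix.eval_charpoly] at h1
    have h2 : M - algebraMap ℂ _ c = -(Matrix.scalar n c - M) := by
      simp [Algebra.algebraMap_eq_smul_one, Matrix.smul_one_eq_diagonal]
    rw [h2, Matrix.det_neg, h1]
    have h3 : Fintype.card n = Multiset.card M.charpoly.roots := by
      rw [← (IsAlgClosed.splits M.charpoly).natDegree_eq_card_roots, Matrix.charpoly_natDegree_eq_dim]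
    have h4 : (fun μ => μ - c) = fun μ => (-1) * (c - μ) := by ext; ring
    rw [h3, h4, Multiset.prod_map_mul]
    simp
  -- Both sides are multiplicative in `p`, which leaves the linear factors, treated in `hdet`.
  conv_lhs => rw [(IsAlgClosed.splits p).eq_prod_roots_of_monic hp]
  conv_rhs => rw [(IsAlgClosed.splits p).eq_prod_roots_of_monic hp]
  generalize p.roots = s
  induction s using Multiset.induction_on with
  | empty => simp
  | cons a s ih =>
    rw [Multiset.map_cons, Multiset.prod_cons, map_mul, Matrix.det_mul, ih]
    simp only [Polynomial.eval_mul, Multiset.prod_map_mul]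
    congr 1
    simp [hdet]

/-- The characteristic polynomial of the power is computed value by value: `z - M ^ (k + 1)` is
minus the polynomial `X ^ (k + 1) - z` at `M`. No triangular form is needed. The exponent is
positive so that this polynomial is monic. -/
theorem trace_pow_eq_sum_roots (M : Matrix n n ℂ) (k : ℕ) :
    (M ^ (k + 1)).trace = (M.charpoly.roots.map fun μ => μ ^ (k + 1)).sum := by
  have hchar : (M ^ (k + 1)).charpoly =
      ((M.charpoly.roots.map fun μ => μ ^ (k + 1)).map fun a => Polynomial.X - Polynomial.C a).prod := by
    refine Polynomial.funext fun z => ?_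
    rw [Matrix.eval_charpoly, Polynomial.eval_multiset_prod, Multiset.map_map, Multiset.map_map]
    have hm : (Polynomial.X ^ (k + 1) - Polynomial.C z : Polynomial ℂ).Monic :=
      Polynomial.monic_X_pow_sub_C z (by omega)
    have h1 := det_aeval_eq_prod_roots M _ hm
    have h2 : Matrix.scalar n z - M ^ (k + 1) =
        -(Polynomial.aeval M (Polynomial.X ^ (k + 1) - Polynomial.C z)) := by
      simp [Algebra.algebraMap_eq_smul_one, Matrix.smul_one_eq_diagonal]
    have h3 : Fintype.card n = Multiset.card M.charpoly.roots := by
      rw [← (IsAlgClosed.splits M.charpoly).natDegree_eq_card_roots, Matrix.charpoly_natDegree_eq_dim]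
    rw [h2, Matrix.det_neg, h1, h3]
    have h4 : ((Polynomial.eval z ∘ fun a => Polynomial.X - Polynomial.C a) ∘
        fun μ : ℂ => μ ^ (k + 1)) =
        fun μ => (-1) * Polynomial.eval μ (Polynomial.X ^ (k + 1) - Polynomial.C z) := by
      ext; simp
    rw [h4, Multiset.prod_map_mul]
    simp
  rw [Matrix.trace_eq_sum_roots_charpoly, hchar, Polynomial.roots_multiset_prod_X_sub_C]

/-- Each eigenvalue contributes the Taylor series of `-log (1 - μ)`. The branch of the logarithm is
harmless, as only the exponential of the sum enters. -/
theorem exists_hasSum_trace_pow (M : Matrix n n ℂ) (hM : ∀ μ ∈ M.charpoly.roots, ‖μ‖ < 1) :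
    ∃ s : ℂ, HasSum (fun k : ℕ => (M ^ (k + 1)).trace / (k + 1)) s ∧
      Complex.exp s = (Matrix.det (1 - M))⁻¹ := by
  refine ⟨(M.charpoly.roots.map fun μ => -Complex.log (1 - μ)).sum, ?_, ?_⟩
  · simp_rw [trace_pow_eq_sum_roots]
    generalize M.charpoly.roots = s at hM
    induction s using Multiset.induction_on with
    | empty => simp [hasSum_zero]
    | cons a s ih =>
      simp only [Multiset.map_cons, Multiset.sum_cons, add_div]
      exact (Complex.hasSum_taylorSeries_neg_log' (hM a (by simp))).add
        (ih fun μ hμ => hM μ (by simp [hμ]))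
  · have h1 : (1 - M).det = (M.charpoly.roots.map fun μ => 1 - μ).prod := by
      have h := Matrix.eval_charpoly M 1
      rw [map_one] at h
      rw [← h]
      conv_lhs => rw [(IsAlgClosed.splits M.charpoly).eq_prod_roots_of_monic M.charpoly_monic]
      rw [Polynomial.eval_multiset_prod, Multiset.map_map]
      simp
    rw [h1]
    generalize M.charpoly.roots = s at hM
    induction s using Multiset.induction_on with
    | empty => simp
    | cons a s ih =>
      simp only [Multiset.map_cons, Multiset.sum_cons, Multiset.prod_cons, Complex.exp_add,
        mul_inv]
      rw [ih fun μ hμ => hM μ (by simp [hμ]), Complex.exp_neg, Complex.exp_log]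
      intro h
      have := hM a (by simp)
      rw [← sub_eq_zero.1 h] at this
      simp at this

theorem exists_mulVec_eq_of_mem_roots (M : Matrix n n ℂ) {μ : ℂ} (h : μ ∈ M.charpoly.roots) :
    ∃ v : n → ℂ, v ≠ 0 ∧ M.mulVec v = μ • v := by
  have h1 : (Matrix.scalar n μ - M).det = 0 := by
    rw [← Matrix.eval_charpoly]
    exact (Polynomial.mem_roots'.1 h).2
  obtain ⟨v, hv, hv'⟩ := Matrix.exists_mulVec_eq_zero_iff.2 h1
  refine ⟨v, hv, ?_⟩
  rw [Matrix.sub_mulVec, sub_eq_zero] at hv'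
  rw [← hv']
  simp [← Matrix.smul_one_eq_diagonal, Matrix.smul_mulVec]

/-- Read the eigenvector equation at a coordinate of largest modulus. -/
theorem norm_lt_one_of_mem_roots (M : Matrix n n ℂ) (hM : ∀ i, ∑ j, ‖M i j‖ < 1) {μ : ℂ}
    (h : μ ∈ M.charpoly.roots) : ‖μ‖ < 1 := by
  obtain ⟨v, hv, hv'⟩ := exists_mulVec_eq_of_mem_roots M h
  obtain ⟨i₁, hi₁⟩ : ∃ i, v i ≠ 0 := by
    by_contra! h; exact hv (funext h)
  have : Nonempty n := ⟨i₁⟩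
  obtain ⟨i, hi⟩ := Finite.exists_max fun i => ‖v i‖
  have hpos : 0 < ‖v i‖ := (norm_pos_iff.2 hi₁).trans_le (hi i₁)
  have h1 : ‖μ‖ * ‖v i‖ ≤ (∑ j, ‖M i j‖) * ‖v i‖ := by
    have := congrFun hv' i
    rw [Pi.smul_apply, smul_eq_mul] at this
    rw [← norm_mul, ← this, Matrix.mulVec, dotProduct, Finset.sum_mul]
    refine (norm_sum_le _ _).trans (Finset.sum_le_sum fun j _ => ?_)
    rw [norm_mul]
    gcongr
    exact hi j
  exact (le_of_mul_le_mul_right h1 hpos).trans_lt (hM i)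

/-- A sum over walks: `p` lists the intermediate vertices, `Fin.cons e p` the sources of the steps
and `Fin.snoc p f` their targets. -/
theorem pow_succ_apply_eq_sum (M : Matrix n n ℂ) (k : ℕ) (e f : n) :
    (M ^ (k + 1)) e f = ∑ p : Fin k → n, ∏ j : Fin (k + 1),
      M ((Fin.cons e p : Fin (k + 1) → n) j) ((Fin.snoc p f : Fin (k + 1) → n) j) := by
  induction k generalizing e with
  | zero => simp [Fin.snoc]
  | succ k ih =>
    rw [pow_succ', Matrix.mul_apply]
    rw [← (Fin.consEquiv fun _ : Fin (k + 1) => n).sum_comp, Fintype.sum_prod_type]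
    refine Finset.sum_congr rfl fun g _ => ?_
    rw [ih, Finset.mul_sum]
    refine Finset.sum_congr rfl fun p _ => ?_
    rw [Fin.prod_univ_succ (n := k + 1)]
    simp only [Fin.consEquiv_apply, Fin.cons_zero, Fin.cons_succ]
    have : (Fin.snoc ((Fin.consEquiv fun _ : Fin (k + 1) => n) (g, p)) f : Fin (k + 2) → n) =
        Fin.cons g (Fin.snoc p f : Fin (k + 1) → n) := (Fin.cons_snoc_eq_snoc_cons g p f).symm
    rw [this]
    rfl

/-- Closed walks as cyclic words: addition in `Fin (k + 1)` wraps around, so `j + 1` closes the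
walk. -/
theorem trace_pow_succ_eq_sum (M : Matrix n n ℂ) (k : ℕ) :
    (M ^ (k + 1)).trace = ∑ q : Fin (k + 1) → n, ∏ j, M (q j) (q (j + 1)) := by
  rw [← (Fin.consEquiv fun _ : Fin (k + 1) => n).sum_comp, Fintype.sum_prod_type, Matrix.trace]
  refine Finset.sum_congr rfl fun e _ => ?_
  rw [Matrix.diag_apply, pow_succ_apply_eq_sum]
  refine Finset.sum_congr rfl fun p _ => Finset.prod_congr rfl fun j _ => ?_
  congr 1
  induction j using Fin.lastCases with
  | last => simp [Fin.consEquiv]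
  | cast i => simp [Fin.consEquiv]

end Matrices

end NumerationSystem
end

noncomputable section

namespace NumerationSystem

/-! ### Periodic orbits of a one-sided shift of finite type -/

/-- The one-sided infinite paths of a relation. -/
structure Path {E : Type*} (adj : E → E → Prop) where
  val : ℕ → E
  property : ∀ k, adj (val k) (val (k + 1))

namespace Path

variable {E : Type*} {adj : E → E → Prop}

instance : CoeFun (Path adj) fun _ => ℕ → E := ⟨Path.val⟩

@[ext] theorem ext {x y : Path adj} (h : ∀ k, x k = y k) : x = y := by
  cases x; cases y
  congr
  exact funext h

theorem adj_succ (x : Path adj) (k : ℕ) : adj (x k) (x (k + 1)) := x.property k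

/-- The shift map. -/
def shift (x : Path adj) : Path adj := ⟨fun k => x (k + 1), fun k => x.property (k + 1)⟩

@[simp] theorem shift_apply (x : Path adj) (k : ℕ) : x.shift k = x (k + 1) := rfl

@[simp] theorem iterate_shift_apply (x : Path adj) (n k : ℕ) : (shift^[n] x) k = x (k + n) := by
  induction n generalizing x with
  | zero => rfl
  | succ n ih => rw [Function.iterate_succ_apply, ih, shift_apply, add_assoc]

/-- The product of the weights of the first `n` edges of a path. -/
def weight {M : Type*} [CommMonoid M] (w : E → M) (n : ℕ) (x : Path adj) : M :=
  ∏ k ∈ Finset.range n, w (x k)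

section weight

variable {M : Type*} [CommMonoid M] (w : E → M)

@[simp] theorem weight_zero (x : Path adj) : x.weight w 0 = 1 := rfl

theorem weight_add (m n : ℕ) (x : Path adj) :
    x.weight w (m + n) = x.weight w m * (shift^[m] x).weight w n := by
  simp only [weight, Finset.prod_range_add, iterate_shift_apply, add_comm]

theorem weight_succ (n : ℕ) (x : Path adj) :
    x.weight w (n + 1) = w (x 0) * x.shift.weight w n := by
  rw [add_comm, weight_add]; simp [weight]

theorem weight_succ' (n : ℕ) (x : Path adj) :
    x.weight w (n + 1) = x.weight w n * w (x n) := Finset.prod_range_succ _ _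

theorem weight_mul_of_isPeriodicPt {x : Path adj} {n : ℕ} (h : Function.IsPeriodicPt shift n x)
    (k : ℕ) : x.weight w (n * k) = x.weight w n ^ k := by
  induction k with
  | zero => simp
  | succ k ih =>
    rw [Nat.mul_succ, weight_add, ih, pow_succ, (h.mul_const k).eq]

theorem weight_shift_of_isPeriodicPt {x : Path adj} {n : ℕ} (h : Function.IsPeriodicPt shift n x) :
    x.shift.weight w n = x.weight w n := by
  rcases n with _ | n
  · rfl
  · rw [weight_succ' w n x.shift, weight_succ w n x, mul_comm]
    congr 2
    have := congrArg (fun y : Path adj => y 0) h.eq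
    simp only [iterate_shift_apply, zero_add] at this
    exact this

theorem weight_map {N : Type*} [CommMonoid N] (φ : M →* N) (n : ℕ) (x : Path adj) :
    x.weight (fun e => φ (w e)) n = φ (x.weight w n) := by
  simp [weight]

end weight

/-- The weight of the primitive cycle of a periodic path. -/
def cycleWeight {M : Type*} [CommMonoid M] (w : E → M) (x : Path adj) : M :=
  x.weight w (Function.minimalPeriod shift x)

theorem cycleWeight_shift {M : Type*} [CommMonoid M] (w : E → M) {x : Path adj}
    (hx : x ∈ Function.periodicPts shift) : x.shift.cycleWeight w = x.cycleWeight w := by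
  rw [cycleWeight, Function.minimalPeriod_apply hx,
    weight_shift_of_isPeriodicPt w (Function.isPeriodicPt_minimalPeriod _ _), cycleWeight]

theorem mem_periodicPts_iterate {x : Path adj} (hx : x ∈ Function.periodicPts shift) (k : ℕ) :
    shift^[k] x ∈ Function.periodicPts shift := by
  obtain ⟨n, hn, h⟩ := hx
  exact ⟨n, hn, h.apply_iterate k⟩

theorem cycleWeight_iterate {M : Type*} [CommMonoid M] (w : E → M) {x : Path adj}
    (hx : x ∈ Function.periodicPts shift) (k : ℕ) :
    (shift^[k] x).cycleWeight w = x.cycleWeight w := by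
  induction k with
  | zero => rfl
  | succ k ih =>
    rw [Function.iterate_succ_apply', cycleWeight_shift w (mem_periodicPts_iterate hx k), ih]

/-- The periodic paths. -/
abbrev Periodic (adj : E → E → Prop) : Type _ :=
  {x : Path adj // x ∈ Function.periodicPts (shift (adj := adj))}

/-- Two periodic paths are equivalent if they lie on the same orbit of the shift. -/
def orbitSetoid (adj : E → E → Prop) : Setoid (Periodic adj) where
  r x y := ∃ k, shift^[k] x.1 = y.1
  iseqv := by
    refine ⟨fun x => ⟨0, rfl⟩, ?_, ?_⟩
    · rintro ⟨x, n, hn, h⟩ y ⟨k, hk⟩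
      -- Since `k * n` is a period, the remaining `k * n - k` steps lead from `y` back to `x`.
      refine ⟨k * n - k, ?_⟩
      rw [← hk, ← Function.iterate_add_apply, Nat.sub_add_cancel (Nat.le_mul_of_pos_right k hn)]
      exact (h.const_mul k).eq
    · rintro x y z ⟨k, hk⟩ ⟨l, hl⟩
      exact ⟨l + k, by rw [Function.iterate_add_apply, hk, hl]⟩

/-- The space of periodic orbits of the shift. -/
def Orbit (adj : E → E → Prop) : Type _ := Quotient (orbitSetoid adj)

/-- The orbit of a periodic path. -/
def Periodic.orbit (x : Periodic adj) : Orbit adj := Quotient.mk (orbitSetoid adj) x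

theorem Periodic.orbit_eq_iff {x y : Periodic adj} :
    x.orbit = y.orbit ↔ ∃ k, shift^[k] x.1 = y.1 := Quotient.eq (r := orbitSetoid adj)

/-- The weight of a periodic orbit. -/
def Orbit.weight {M : Type*} [CommMonoid M] (w : E → M) (q : Orbit adj) : M :=
  Quotient.lift (s := orbitSetoid adj) (fun x : Periodic adj => x.1.cycleWeight w)
    (by
      rintro x y ⟨k, hk⟩
      rw [← hk, cycleWeight_iterate w x.2]) q

@[simp] theorem Orbit.weight_orbit {M : Type*} [CommMonoid M] (w : E → M) (x : Periodic adj) :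
    x.orbit.weight w = x.1.cycleWeight w := rfl

/-- The points of an orbit are the iterates below the minimal period. -/
def orbitFiberEquiv (x : Periodic adj) :
    Fin (Function.minimalPeriod shift x.1) ≃ {y : Periodic adj // y.orbit = x.orbit} :=
  Equiv.ofBijective
    (fun j => ⟨⟨shift^[j] x.1, mem_periodicPts_iterate x.2 j⟩, (Periodic.orbit_eq_iff.2 ⟨j, rfl⟩).symm⟩)
    (by
      constructor
      · intro i j h
        have h1 : shift^[(i : ℕ)] x.1 = shift^[(j : ℕ)] x.1 := congrArg (fun y => y.1.1) h
        exact Fin.ext ((Function.iterate_eq_iterate_iff_of_lt_minimalPeriod i.2 j.2).1 h1)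
      · rintro ⟨y, hy⟩
        obtain ⟨k, hk⟩ := Periodic.orbit_eq_iff.1 hy.symm
        have hm := Function.minimalPeriod_pos_of_mem_periodicPts x.2
        refine ⟨⟨k % Function.minimalPeriod shift x.1, Nat.mod_lt _ hm⟩, ?_⟩
        apply Subtype.ext; apply Subtype.ext
        change shift^[k % _] x.1 = _
        rw [Function.iterate_mod_minimalPeriod_eq, hk])

/-- Summing over periodic points, with each point weighted by the inverse of its period, amounts to
summing over periodic orbits. -/
theorem hasSum_orbit {L : Orbit adj → ℂ} {s : ℂ}
    (h : HasSum (fun x : Periodic adj => L x.orbit / Function.minimalPeriod shift x.1) s) :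
    HasSum L s := by
  -- Group by orbit: a fibre has as many points as the minimal period, all with the same term, and
  -- this cancels the denominator.
  have h1 := (Equiv.sigmaFiberEquiv (Periodic.orbit (adj := adj))).hasSum_iff.2 h
  refine h1.sigma fun q => ?_
  obtain ⟨x, rfl⟩ : ∃ x : Periodic adj, x.orbit = q := Quotient.exists_rep q
  rw [← (orbitFiberEquiv x).hasSum_iff]
  have hm := Function.minimalPeriod_pos_of_mem_periodicPts x.2
  have h2 : ∀ j : Fin (Function.minimalPeriod shift x.1),
      L ((orbitFiberEquiv x j).1.orbit) / Function.minimalPeriod shift (orbitFiberEquiv x j).1.1 =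
        L x.orbit / Function.minimalPeriod shift x.1 := by
    intro j
    have h3 : Function.minimalPeriod shift (orbitFiberEquiv x j).1.1 =
        Function.minimalPeriod shift x.1 := Function.minimalPeriod_apply_iterate x.2 j
    rw [h3, (orbitFiberEquiv x j).2]
  have h4 := hasSum_fintype fun j : Fin (Function.minimalPeriod shift x.1) =>
      L ((orbitFiberEquiv x j).1.orbit) / Function.minimalPeriod shift (orbitFiberEquiv x j).1.1
  have h5 : ∑ j : Fin (Function.minimalPeriod shift x.1),
      L ((orbitFiberEquiv x j).1.orbit) / Function.minimalPeriod shift (orbitFiberEquiv x j).1.1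
        = L x.orbit := by
    rw [Finset.sum_congr rfl fun j _ => h2 j, Finset.sum_const, Finset.card_univ, Fintype.card_fin,
      nsmul_eq_mul]
    exact mul_div_cancel₀ _ (by exact_mod_cast hm.ne')
  rw [h5] at h4
  exact h4

theorem _root_.Nat.eq_mul_div_sub_one_add_one {m n : ℕ} (h : m ∣ n) (hn : 0 < n) :
    n = m * (n / m - 1 + 1) := by
  obtain ⟨k, rfl⟩ := h
  have hk : 0 < k := Nat.pos_of_mul_pos_left hn
  have hm : 0 < m := Nat.pos_of_mul_pos_right hn
  rw [Nat.mul_div_cancel_left _ hm, Nat.sub_add_cancel hk]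

/-- A pair of a periodic point and a multiple of its period, seen in two ways. -/
def periodEquiv (adj : E → E → Prop) :
    (Σ n : ℕ, {x : Path adj // Function.IsPeriodicPt shift (n + 1) x}) ≃ Periodic adj × ℕ :=
  Equiv.ofBijective
    -- The period `n + 1` equals the minimal period times `k + 1`, and `k` is recorded; the
    -- truncated subtraction is exact because the quotient is positive.
    (fun p => (⟨p.2.1, p.1 + 1, p.1.succ_pos, p.2.2⟩,
      (p.1 + 1) / Function.minimalPeriod shift p.2.1 - 1))
    (by
      constructor
      · rintro ⟨n, x, hx⟩ ⟨n', x', hx'⟩ h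
        simp only [Prod.mk.injEq] at h
        obtain ⟨hxx, h⟩ := h
        obtain rfl : x = x' := congrArg Subtype.val hxx
        have h1 := Nat.eq_mul_div_sub_one_add_one hx.minimalPeriod_dvd n.succ_pos
        rw [h, ← Nat.eq_mul_div_sub_one_add_one hx'.minimalPeriod_dvd n'.succ_pos] at h1
        obtain rfl : n = n' := by omega
        rfl
      · rintro ⟨⟨x, hx⟩, k⟩
        have hm := Function.minimalPeriod_pos_of_mem_periodicPts hx
        have h1 : Function.minimalPeriod shift x * (k + 1) - 1 + 1 =
            Function.minimalPeriod shift x * (k + 1) := Nat.sub_add_cancel (Nat.mul_pos hm k.succ_pos)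
        refine ⟨⟨Function.minimalPeriod shift x * (k + 1) - 1, x, ?_⟩, ?_⟩
        · rw [h1]
          exact (Function.isPeriodicPt_minimalPeriod _ _).mul_const _
        · simp only [h1, Nat.mul_div_cancel_left _ hm, Nat.add_sub_cancel])

theorem periodEquiv_spec (p : Σ n : ℕ, {x : Path adj // Function.IsPeriodicPt shift (n + 1) x}) :
    (periodEquiv adj p).1.1 = p.2.1 ∧
      p.1 + 1 = Function.minimalPeriod shift p.2.1 * ((periodEquiv adj p).2 + 1) := by
  refine ⟨rfl, ?_⟩
  exact (Nat.eq_mul_div_sub_one_add_one p.2.2.minimalPeriod_dvd p.1.succ_pos)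

theorem norm_cycleWeight_lt_one {w : E → ℂ} (hw : ∀ e, ‖w e‖ < 1) (x : Periodic adj) :
    ‖x.1.cycleWeight w‖ < 1 := by
  have hm := Function.minimalPeriod_pos_of_mem_periodicPts x.2
  rw [cycleWeight, ← Nat.sub_add_cancel hm, weight_succ', norm_mul]
  refine mul_lt_one_of_nonneg_of_lt_one_right ?_ (norm_nonneg _) (hw _)
  rw [weight, norm_prod]
  exact Finset.prod_le_one (fun _ _ => norm_nonneg _) fun k _ => (hw _).le

/-- With `n + 1 = m (k + 1)` and `c` the weight of the primitive cycle, the term is `c ^ (k + 1) /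
(k + 1)` divided by `m`. Summing over `k` yields the logarithm of one Euler factor, counted `1 / m`
times for each point of the orbit. -/
theorem weight_div_eq (w : E → ℂ)
    (p : Σ n : ℕ, {x : Path adj // Function.IsPeriodicPt shift (n + 1) x}) :
    p.2.1.weight w (p.1 + 1) / ((p.1 : ℂ) + 1) =
      ((periodEquiv adj p).1.1.cycleWeight w ^ ((periodEquiv adj p).2 + 1) /
        ((periodEquiv adj p).2 + 1)) / Function.minimalPeriod shift (periodEquiv adj p).1.1 := by
  obtain ⟨h1, h2⟩ := periodEquiv_spec p
  rw [h1, cycleWeight,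
    ← weight_mul_of_isPeriodicPt w (Function.isPeriodicPt_minimalPeriod _ _), ← h2, div_div]
  congr 1
  have := congrArg (Nat.cast : ℕ → ℂ) h2
  push_cast at this
  rw [this, mul_comm]

/-! ### Transfer matrices and the Euler product over periodic orbits. -/

variable [Fintype E] [DecidableEq E]

open Classical in
/-- The transfer matrix of a weight. -/
def transferMatrix (adj : E → E → Prop) (w : E → ℂ) : Matrix E E ℂ :=
  fun e f => if adj e f then w f else 0

/-- A periodic path is the same as a cyclic word. -/
def cyclicEquiv (adj : E → E → Prop) (n : ℕ) :
    {q : Fin (n + 1) → E // ∀ j, adj (q j) (q (j + 1))} ≃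
      {x : Path adj // Function.IsPeriodicPt shift (n + 1) x} where
  toFun q := ⟨⟨fun k => q.1 (Fin.ofNat (n + 1) k), fun k => by
      have := q.2 (Fin.ofNat (n + 1) k)
      have h : Fin.ofNat (n + 1) (k + 1) = Fin.ofNat (n + 1) k + 1 := by
        apply Fin.ext; simp [Fin.val_add]
      change adj (q.1 _) (q.1 _)
      rw [h]
      exact this⟩, by
    ext k
    rw [iterate_shift_apply]
    change q.1 _ = q.1 _
    exact congrArg q.1 (Fin.ext (by simp))⟩
  invFun x := ⟨fun j => x.1 j, fun j => by
    have h := x.1.property j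
    convert h using 1
    induction j using Fin.lastCases with
    | last =>
      have := congrArg (fun y : Path adj => y 0) x.2.eq
      simpa using this.symm
    | cast i => simp⟩
  left_inv q := by ext j; simp
  right_inv x := by
    apply Subtype.ext; ext k
    change x.1 (k % (n + 1)) = x.1 k
    have h := (x.2.const_mul (k / (n + 1))).eq
    have := congrArg (fun y : Path adj => y (k % (n + 1))) h
    simp only [iterate_shift_apply] at this
    rw [← this, mul_comm, Nat.mod_add_div]

theorem hasSum_trace_transferMatrix (w : E → ℂ) (n : ℕ) :
    HasSum (fun x : {x : Path adj // Function.IsPeriodicPt shift (n + 1) x} =>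
      x.1.weight w (n + 1)) ((transferMatrix adj w ^ (n + 1)).trace) := by
  classical
  rw [← (cyclicEquiv adj n).hasSum_iff, trace_pow_succ_eq_sum]
  have h := hasSum_fintype fun q : {q : Fin (n + 1) → E // ∀ j, adj (q j) (q (j + 1))} =>
    ∏ j, w (q.1 j)
  have h1 : ∑ q : Fin (n + 1) → E, ∏ j, transferMatrix adj w (q j) (q (j + 1)) =
      ∑ q : {q : Fin (n + 1) → E // ∀ j, adj (q j) (q (j + 1))}, ∏ j, w (q.1 j) := by
    have h2 : ∀ q : Fin (n + 1) → E, ∏ j, transferMatrix adj w (q j) (q (j + 1)) =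
        if ∀ j, adj (q j) (q (j + 1)) then ∏ j, w (q j) else 0 := by
      intro q
      split_ifs with hq
      -- Matrix entries carry the weight of the target, so the product is rotated by one place.
      · rw [← Equiv.prod_comp (Equiv.addRight (1 : Fin (n + 1))) fun j => w (q j)]
        exact Finset.prod_congr rfl fun j _ => if_pos (hq j)
      · push Not at hq
        obtain ⟨j, hj⟩ := hq
        exact Finset.prod_eq_zero (Finset.mem_univ j) (if_neg hj)
    rw [Finset.sum_congr rfl fun q _ => h2 q, ← Finset.sum_filter]
    exact Finset.sum_subtype _ (by simp) _
  rw [h1]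
  have h3 : ((fun x : {x : Path adj // Function.IsPeriodicPt shift (n + 1) x} =>
      x.1.weight w (n + 1)) ∘ cyclicEquiv adj n) = fun q => ∏ j, w (q.1 j) := by
    ext q
    simp only [Function.comp, weight, Finset.prod_range]
    refine Finset.prod_congr rfl fun j _ => ?_
    change w (q.1 (Fin.ofNat (n + 1) j)) = _
    rw [Fin.ofNat_val_eq_self]
  rw [h3]
  exact h

/-- Absolute convergence, needed to exchange the sums over lengths and over points, follows from the
trace formula for the weights `‖w e‖`, which satisfy the same row bound. -/
theorem summable_weight_sigma (w : E → ℂ) (hrow : ∀ e, ∑ f, ‖transferMatrix adj w e f‖ < 1) :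
    Summable fun p : Σ n : ℕ, {x : Path adj // Function.IsPeriodicPt shift (n + 1) x} =>
      p.2.1.weight w (p.1 + 1) / ((p.1 : ℂ) + 1) := by
  have habs : ∀ n : ℕ, ∀ x : Path adj,
      ‖x.weight w (n + 1) / ((n : ℂ) + 1)‖ = (x.weight (fun e => ‖w e‖) (n + 1)) / (n + 1) := by
    intro n x
    rw [norm_div, weight, norm_prod]
    congr 1
    norm_cast
  apply Summable.of_norm
  set w' : E → ℂ := fun e => (‖w e‖ : ℂ) with hw'
  have hrow' : ∀ e, ∑ f, ‖transferMatrix adj w' e f‖ < 1 := by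
    intro e
    convert hrow e using 2 with f
    simp only [transferMatrix]
    split_ifs <;> simp [hw']
  obtain ⟨s', hs', -⟩ := exists_hasSum_trace_pow (transferMatrix adj w')
    fun μ hμ => norm_lt_one_of_mem_roots _ hrow' hμ
  have hcast : ∀ (n : ℕ) (x : Path adj), x.weight w' (n + 1) / ((n : ℂ) + 1) =
      (((x.weight (fun e => ‖w e‖) (n + 1)) / (n + 1) : ℝ) : ℂ) := by
    intro n x
    simp [weight, hw']
  have hreal : ∀ n : ℕ, HasSum
      (fun x : {x : Path adj // Function.IsPeriodicPt shift (n + 1) x} =>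
        (x.1.weight (fun e => ‖w e‖) (n + 1)) / ((n : ℝ) + 1))
      ((transferMatrix adj w' ^ (n + 1)).trace / (n + 1)).re := by
    intro n
    have := Complex.hasSum_re ((hasSum_trace_transferMatrix (adj := adj) w' n).div_const ((n : ℂ) + 1))
    simp only [hcast, Complex.ofReal_re] at this
    exact this
  simp only [habs]
  rw [summable_sigma_of_nonneg]
  · refine ⟨fun n => (hreal n).summable, ?_⟩
    simp only [(hreal _).tsum_eq]
    exact (Complex.hasSum_re hs').summable
  · intro p
    exact div_nonneg (Finset.prod_nonneg fun _ _ => norm_nonneg _) (by positivity)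

/-- The Euler product of a shift of finite type, in logarithmic form. -/
theorem hasSum_orbit_of_hasSum_trace (w : E → ℂ) (hw : ∀ e, ‖w e‖ < 1)
    (hrow : ∀ e, ∑ f, ‖transferMatrix adj w e f‖ < 1) {s : ℂ}
    (hs : HasSum (fun k : ℕ => (transferMatrix adj w ^ (k + 1)).trace / (k + 1)) s) :
    HasSum (fun q : Orbit adj => -Complex.log (1 - q.weight w)) s := by
  have hfib : ∀ n : ℕ, HasSum (fun x : {x : Path adj // Function.IsPeriodicPt shift (n + 1) x} =>
      x.1.weight w (n + 1) / ((n : ℂ) + 1)) ((transferMatrix adj w ^ (n + 1)).trace / (n + 1)) :=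
    fun n => (hasSum_trace_transferMatrix w n).div_const _
  have hall : HasSum (fun p : Σ n : ℕ, {x : Path adj // Function.IsPeriodicPt shift (n + 1) x} =>
      p.2.1.weight w (p.1 + 1) / ((p.1 : ℂ) + 1)) s :=
    HasSum.sigma_of_hasSum hs hfib (summable_weight_sigma w hrow)
  have hG : HasSum (fun p : Periodic adj × ℕ =>
      (p.1.1.cycleWeight w ^ (p.2 + 1) / ((p.2 : ℂ) + 1)) / Function.minimalPeriod shift p.1.1) s := by
    rw [← Equiv.hasSum_iff (periodEquiv adj)]
    have hfun := funext fun p => weight_div_eq (adj := adj) w p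
    rw [hfun] at hall
    exact hall
  have hF : ∀ x : Periodic adj, HasSum (fun k : ℕ =>
      (x.1.cycleWeight w ^ (k + 1) / ((k : ℂ) + 1)) / Function.minimalPeriod shift x.1)
      (-Complex.log (1 - x.1.cycleWeight w) / Function.minimalPeriod shift x.1) := fun x =>
    (Complex.hasSum_taylorSeries_neg_log' (norm_cycleWeight_lt_one hw x)).div_const _
  have hP : HasSum (fun x : Periodic adj =>
      -Complex.log (1 - x.1.cycleWeight w) / Function.minimalPeriod shift x.1) s :=
    hG.prod_fiberwise hF
  exact hasSum_orbit (L := fun q => -Complex.log (1 - q.weight w)) hP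

theorem exists_hasSum_orbit (w : E → ℂ) (hw : ∀ e, ‖w e‖ < 1)
    (hrow : ∀ e, ∑ f, ‖transferMatrix adj w e f‖ < 1) :
    ∃ s : ℂ, HasSum (fun q : Orbit adj => -Complex.log (1 - q.weight w)) s ∧
      Complex.exp s = (Matrix.det (1 - transferMatrix adj w))⁻¹ := by
  obtain ⟨s, hs, hexp⟩ := exists_hasSum_trace_pow (transferMatrix adj w)
    fun μ hμ => norm_lt_one_of_mem_roots _ hrow hμ
  exact ⟨s, hasSum_orbit_of_hasSum_trace w hw hrow hs, hexp⟩

end Path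

end NumerationSystem
end

noncomputable section

namespace NumerationSystem

/-! ### Geometry of tiles -/

namespace Tile

theorem x₁_lt_x₂ (R : Tile) : R.x₁ < R.x₂ := by
  have := R.width; have := R.y₁_pos; linarith

theorem y₂_pos (R : Tile) : 0 < R.y₂ := R.y₁_pos.trans R.y₁_lt_y₂

/-- The open rectangles of two tiles intersect. -/
def Meets (R Q : Tile) : Prop := R.x₁ < Q.x₂ ∧ Q.x₁ < R.x₂ ∧ R.y₁ < Q.y₂ ∧ Q.y₁ < R.y₂

theorem exists_between_max_min {a b c d : ℝ} (h1 : a < b) (h2 : c < d) (h3 : a < d) (h4 : c < b) :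
    ∃ t, a < t ∧ t < b ∧ c < t ∧ t < d := by
  obtain ⟨t, ht, ht'⟩ := exists_between (max_lt (lt_min h1 h3) (lt_min h4 h2))
  exact ⟨t, (max_lt_iff.1 ht).1, (lt_min_iff.1 ht').1, (max_lt_iff.1 ht).2, (lt_min_iff.1 ht').2⟩

theorem disjoint_toSet_iff {R Q : Tile} : Disjoint R.toSet Q.toSet ↔ ¬ R.Meets Q := by
  rw [Set.disjoint_iff_inter_eq_empty, ← Set.not_nonempty_iff_eq_empty, not_iff_not]
  constructor
  · rintro ⟨z, ⟨h1, h2, h3, h4⟩, ⟨h5, h6, h7, h8⟩⟩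
    exact ⟨h1.trans h6, h5.trans h2, h3.trans h8, h7.trans h4⟩
  · rintro ⟨h1, h2, h3, h4⟩
    obtain ⟨x, hx⟩ := exists_between_max_min R.x₁_lt_x₂ Q.x₁_lt_x₂ h1 h2
    obtain ⟨y, hy⟩ := exists_between_max_min R.y₁_lt_y₂ Q.y₁_lt_y₂ h3 h4
    exact ⟨⟨x, y⟩, ⟨hx.1, hx.2.1, hy.1, hy.2.1⟩, ⟨hx.2.2.1, hx.2.2.2, hy.2.2.1, hy.2.2.2⟩⟩

theorem closure_toSet (R : Tile) :
    closure R.toSet = {z | R.x₁ ≤ z.re ∧ z.re ≤ R.x₂ ∧ R.y₁ ≤ z.im ∧ z.im ≤ R.y₂} := by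
  have h : R.toSet = Set.Ioo R.x₁ R.x₂ ×ℂ Set.Ioo R.y₁ R.y₂ := by
    ext z; simp [toSet, Complex.mem_reProdIm, and_assoc]
  rw [h, Complex.closure_reProdIm, closure_Ioo R.x₁_lt_x₂.ne, closure_Ioo R.y₁_lt_y₂.ne]
  ext z; simp [Complex.mem_reProdIm, and_assoc]

theorem meets_of_mem {R Q : Tile} {z : ℂ} (hR : z ∈ closure R.toSet) (hQ : z ∈ Q.toSet) :
    R.Meets Q := by
  rw [closure_toSet] at hR
  obtain ⟨h1, h2, h3, h4⟩ := hR
  obtain ⟨h5, h6, h7, h8⟩ := hQ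
  exact ⟨h1.trans_lt h6, h5.trans_le h2, h3.trans_lt h8, h7.trans_le h4⟩

theorem isBounded_toSet (R : Tile) : Bornology.IsBounded R.toSet := by
  have h : R.toSet ⊆ Set.Icc R.x₁ R.x₂ ×ℂ Set.Icc R.y₁ R.y₂ := by
    intro z hz
    simp only [Complex.mem_reProdIm, Set.mem_Icc]
    exact ⟨⟨hz.1.le, hz.2.1.le⟩, hz.2.2.1.le, hz.2.2.2.le⟩
  exact (Metric.isBounded_Icc _ _).reProdIm (Metric.isBounded_Icc _ _) |>.subset h

theorem nonempty_toSet (R : Tile) : R.toSet.Nonempty :=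
  ⟨⟨(R.x₁ + R.x₂) / 2, (R.y₁ + R.y₂) / 2⟩, by
    have h1 := R.x₁_lt_x₂
    have h2 := R.y₁_lt_y₂
    refine ⟨?_, ?_, ?_, ?_⟩ <;> dsimp only <;> linarith⟩

theorem hausdorffDist_comm_ne_top (R Q : Tile) :
    Metric.hausdorffEDist R.toSet Q.toSet ≠ ⊤ :=
  Metric.hausdorffEDist_ne_top_of_nonempty_of_bounded R.nonempty_toSet Q.nonempty_toSet
    R.isBounded_toSet Q.isBounded_toSet

/-- One-sided comparison of the coordinates of two tiles at small Hausdorff distance. -/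
theorem coord_le_of_forall_exists_dist_lt {R Q : Tile} {ε : ℝ}
    (h : ∀ z ∈ R.toSet, ∃ w ∈ Q.toSet, dist z w < ε) :
    Q.x₁ ≤ R.x₁ + ε ∧ R.x₂ ≤ Q.x₂ + ε ∧ Q.y₁ ≤ R.y₁ + ε ∧ R.y₂ ≤ Q.y₂ + ε := by
  have hx := R.x₁_lt_x₂
  have hy := R.y₁_lt_y₂
  have key : ∀ x y : ℝ, R.x₁ < x → x < R.x₂ → R.y₁ < y → y < R.y₂ →
      Q.x₁ ≤ x + ε ∧ x ≤ Q.x₂ + ε ∧ Q.y₁ ≤ y + ε ∧ y ≤ Q.y₂ + ε := by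
    intro x y h1 h2 h3 h4
    obtain ⟨w, ⟨h5, h6, h7, h8⟩, hd⟩ := h ⟨x, y⟩ ⟨h1, h2, h3, h4⟩
    rw [Complex.dist_eq] at hd
    have hre := (Complex.abs_re_le_norm (⟨x, y⟩ - w)).trans_lt hd
    have him := (Complex.abs_im_le_norm (⟨x, y⟩ - w)).trans_lt hd
    simp only [Complex.sub_re, Complex.sub_im, abs_lt] at hre him
    refine ⟨?_, ?_, ?_, ?_⟩ <;> linarith [hre.1, hre.2, him.1, him.2]
  have hxm : R.x₁ < (R.x₁ + R.x₂) / 2 ∧ (R.x₁ + R.x₂) / 2 < R.x₂ := by constructor <;> linarith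
  have hym : R.y₁ < (R.y₁ + R.y₂) / 2 ∧ (R.y₁ + R.y₂) / 2 < R.y₂ := by constructor <;> linarith
  -- The bounds of `key` hold at interior points only; each side of `R` is approached by such
  -- points.
  refine ⟨?_, ?_, ?_, ?_⟩
  · refine le_of_forall_gt_imp_ge_of_dense fun t ht => ?_
    obtain ⟨x, h1, h2⟩ := exists_between (lt_min (show R.x₁ < t - ε by linarith) hx)
    have := (key x _ h1 (h2.trans_le (min_le_right _ _)) hym.1 hym.2).1
    have h3 := h2.trans_le (min_le_left _ _)
    linarith
  · refine le_of_forall_lt_imp_le_of_dense fun t ht => ?_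
    obtain ⟨x, h1, h2⟩ := exists_between (max_lt ht hx)
    have := (key x _ ((le_max_right _ _).trans_lt h1) h2 hym.1 hym.2).2.1
    have h3 := (le_max_left _ _).trans_lt h1
    linarith
  · refine le_of_forall_gt_imp_ge_of_dense fun t ht => ?_
    obtain ⟨x, h1, h2⟩ := exists_between (lt_min (show R.y₁ < t - ε by linarith) hy)
    have := (key _ x hxm.1 hxm.2 h1 (h2.trans_le (min_le_right _ _))).2.2.1
    have h3 := h2.trans_le (min_le_left _ _)
    linarith
  · refine le_of_forall_lt_imp_le_of_dense fun t ht => ?_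
    obtain ⟨x, h1, h2⟩ := exists_between (max_lt ht hy)
    have := (key _ x hxm.1 hxm.2 ((le_max_right _ _).trans_lt h1) h2).2.2.2
    have h3 := (le_max_left _ _).trans_lt h1
    linarith

/-- The coordinates of two tiles differ by at most `ε`. -/
def Close (ε : ℝ) (R Q : Tile) : Prop :=
  |Q.x₁ - R.x₁| ≤ ε ∧ |Q.x₂ - R.x₂| ≤ ε ∧ |Q.y₁ - R.y₁| ≤ ε ∧ |Q.y₂ - R.y₂| ≤ ε

theorem close_of_hausdorffDist_lt {R Q : Tile} {ε : ℝ}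
    (h : Metric.hausdorffDist R.toSet Q.toSet < ε) : R.Close ε Q := by
  obtain ⟨h1, h2, h3, h4⟩ := coord_le_of_forall_exists_dist_lt (R := R) (Q := Q) (ε := ε)
    fun z hz => Metric.exists_dist_lt_of_hausdorffDist_lt hz h (hausdorffDist_comm_ne_top R Q)
  rw [Metric.hausdorffDist_comm] at h
  obtain ⟨h5, h6, h7, h8⟩ := coord_le_of_forall_exists_dist_lt (R := Q) (Q := R) (ε := ε)
    fun z hz => Metric.exists_dist_lt_of_hausdorffDist_lt hz h (hausdorffDist_comm_ne_top Q R)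
  refine ⟨?_, ?_, ?_, ?_⟩ <;> rw [abs_le] <;> constructor <;> linarith

@[simp] theorem scale_one (R : Tile) : R.scale 1 = R := by ext <;> simp [scale]

theorem scale_scale (l m : PosReal) (R : Tile) : (R.scale m).scale l = R.scale (l * m) := by
  ext <;> simp [scale, mul_assoc]

end Tile

/-! ### Rigidity, scaling and approximation of colored tilings. -/

namespace ColoredTiling

variable {A : Type*} {ω ω' : ColoredTiling A}

theorem eq_of_meets {p q : Tile × A} (hp : p ∈ ω.tiles) (hq : q ∈ ω.tiles)
    (h : p.1.Meets q.1) : p = q := by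
  by_contra hne
  exact Tile.disjoint_toSet_iff.1 (ω.disjoint p hp q hq hne) h

theorem exists_mem_closure (ω : ColoredTiling A) {z : ℂ} (hz : 0 < z.im) :
    ∃ p ∈ ω.tiles, z ∈ closure p.1.toSet := by
  have : z ∈ {z : ℂ | 0 < z.im} := hz
  rw [← ω.cover] at this
  simpa using this

/-- A tiling leaves no room for a further tile: an interior point of a tile of `ω'` is covered by
`ω`, and the covering tile meets that tile, so it is the same. Equality of tilings is always proved
through one inclusion. -/
theorem eq_of_subset (h : ω.tiles ⊆ ω'.tiles) : ω = ω' := by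
  refine ColoredTiling.ext (h.antisymm fun q hq => ?_)
  obtain ⟨z, hz⟩ := q.1.nonempty_toSet
  obtain ⟨p, hp, hzp⟩ := ω.exists_mem_closure (q.1.y₁_pos.trans hz.2.2.1)
  rwa [← eq_of_meets (h hp) hq (Tile.meets_of_mem hzp hz)]

theorem scale_mem_scale {l : PosReal} {p : Tile × A} (hp : p ∈ ω.tiles) :
    (p.1.scale l, p.2) ∈ (ω.scale l).tiles := ⟨p, hp, rfl⟩

theorem scale_scale (l m : PosReal) (ω : ColoredTiling A) :
    (ω.scale m).scale l = ω.scale (l * m) := by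
  refine eq_of_subset ?_
  rintro _ ⟨_, ⟨p, hp, rfl⟩, rfl⟩
  simp only [Tile.scale_scale]
  exact scale_mem_scale hp

@[simp] theorem scale_one (ω : ColoredTiling A) : ω.scale 1 = ω := by
  refine eq_of_subset ?_
  rintro _ ⟨p, hp, rfl⟩
  simpa using hp

theorem scale_inv_eq_self {l : PosReal} (h : ω.scale l = ω) : ω.scale l⁻¹ = ω := by
  conv_lhs => rw [← h]
  rw [scale_scale, inv_mul_cancel, scale_one]

theorem scale_zpow_eq_self {l : PosReal} (h : ω.scale l = ω) (n : ℤ) : ω.scale (l ^ n) = ω := by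
  have hnat : ∀ (m : PosReal), ω.scale m = ω → ∀ k : ℕ, ω.scale (m ^ k) = ω := by
    intro m hm k
    induction k with
    | zero => simp
    | succ k ih => rw [pow_succ, ← scale_scale, hm, ih]
  obtain ⟨k, rfl | rfl⟩ := n.eq_nat_or_neg
  · simpa using hnat l h k
  · rw [zpow_neg, zpow_natCast, ← inv_pow]
    exact hnat _ (scale_inv_eq_self h) k

theorem scale_mem_of_eq {l : PosReal} (h : ω.scale l = ω) {p : Tile × A} (hp : p ∈ ω.tiles) :
    (p.1.scale l, p.2) ∈ ω.tiles := by
  have := scale_mem_scale (l := l) hp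
  rwa [h] at this

/-- Tilings near `ω` have tiles near any two given tiles of `ω`. -/
theorem exists_close_of_mem_closure {S : Set (ColoredTiling A)} (h : ω ∈ closure S)
    {p q : Tile × A} (hp : p ∈ ω.tiles) (hq : q ∈ ω.tiles) {ε : ℝ} (hε : 0 < ε) :
    ∃ ω' ∈ S, (∃ R, (R, p.2) ∈ ω'.tiles ∧ p.1.Close ε R) ∧
      ∃ R, (R, q.2) ∈ ω'.tiles ∧ q.1.Close ε R := by
  have hopen : ∀ p : Tile × A, IsOpen {ω : ColoredTiling A | ∃ R' : Tile, (R', p.2) ∈ ω.tiles ∧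
      Metric.hausdorffDist p.1.toSet R'.toSet < ε} :=
    fun p => TopologicalSpace.isOpen_generateFrom_of_mem ⟨p.1, p.2, ε, hε, rfl⟩
  have hmem : ∀ p ∈ ω.tiles, ω ∈ {ω : ColoredTiling A | ∃ R' : Tile, (R', p.2) ∈ ω.tiles ∧
      Metric.hausdorffDist p.1.toSet R'.toSet < ε} := by
    intro p hp
    exact ⟨p.1, hp, by simpa [Metric.hausdorffDist_self_zero] using hε⟩
  obtain ⟨ω', ⟨⟨R, hR, hRd⟩, ⟨Q, hQ, hQd⟩⟩, hS⟩ := mem_closure_iff.1 h _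
    ((hopen p).inter (hopen q)) ⟨hmem p hp, hmem q hq⟩
  exact ⟨ω', hS, ⟨R, hR, Tile.close_of_hausdorffDist_lt hRd⟩,
    ⟨Q, hQ, Tile.close_of_hausdorffDist_lt hQd⟩⟩

end ColoredTiling

end NumerationSystem
end

noncomputable section

namespace NumerationSystem

namespace WeightedSubst

variable {A : Type*} (W : WeightedSubst A)

/-! ### Offsets of letters in a word -/

/-- The total weight of the letters to the left of the `i`-th one. -/
def off (a : A) (i : Fin (W.len a)) : ℝ := ∑ j ∈ Finset.Iio i, (W.τ a j : ℝ)

theorem off_nonneg (a : A) (i : Fin (W.len a)) : 0 ≤ W.off a i :=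
  Finset.sum_nonneg fun j _ => (W.τ a j).2.le

theorem off_add_τ (a : A) (i : Fin (W.len a)) :
    W.off a i + W.τ a i = ∑ j ∈ Finset.Iic i, (W.τ a j : ℝ) := by
  rw [← Finset.Iio_insert, Finset.sum_insert (by simp), off, add_comm]

theorem off_add_τ_le_off (a : A) {i j : Fin (W.len a)} (h : i < j) :
    W.off a i + W.τ a i ≤ W.off a j := by
  rw [off_add_τ]
  refine Finset.sum_le_sum_of_subset_of_nonneg ?_ fun k _ _ => (W.τ a k).2.le
  intro k hk
  simp only [Finset.mem_Iic, Finset.mem_Iio] at *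
  exact hk.trans_lt h

theorem off_add_τ_le_one (a : A) (i : Fin (W.len a)) : W.off a i + W.τ a i ≤ 1 := by
  rw [off_add_τ, ← W.sum_τ a]
  exact Finset.sum_le_sum_of_subset_of_nonneg (Finset.subset_univ _) fun k _ _ => (W.τ a k).2.le

theorem len_pos (a : A) : 0 < W.len a := by
  by_contra h
  have h0 : W.len a = 0 := by omega
  have h1 := W.sum_τ a
  have : IsEmpty (Fin (W.len a)) := by rw [h0]; infer_instance
  simp at h1

/-- The first index of the word of a letter. -/
def first (a : A) : Fin (W.len a) := ⟨0, W.len_pos a⟩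

/-- The last index of the word of a letter. -/
def last (a : A) : Fin (W.len a) := ⟨W.len a - 1, Nat.sub_lt (W.len_pos a) one_pos⟩

theorem first_le (a : A) (i : Fin (W.len a)) : W.first a ≤ i := Nat.zero_le _

theorem le_last (a : A) (i : Fin (W.len a)) : i ≤ W.last a := Nat.le_sub_one_of_lt i.2

theorem off_first (a : A) : W.off a (W.first a) = 0 := by
  rw [off, Finset.sum_eq_zero]
  intro j hj
  exact absurd (Finset.mem_Iio.1 hj) (W.first_le a j).not_gt

theorem off_last (a : A) : W.off a (W.last a) + W.τ a (W.last a) = 1 := by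
  rw [off_add_τ, ← W.sum_τ a]
  congr 1
  ext i
  simpa using W.le_last a i

theorem eq_first_of_off_le {a : A} {i : Fin (W.len a)} (h : W.off a i ≤ 0) : i = W.first a := by
  rcases (W.first_le a i).eq_or_lt with h1 | h1
  · exact h1.symm
  · have h2 := W.off_add_τ_le_off a h1
    have := (W.τ a (W.first a)).2
    have := W.off_nonneg a (W.first a)
    linarith

theorem eq_last_of_one_le {a : A} {i : Fin (W.len a)} (h : 1 ≤ W.off a i + W.τ a i) :
    i = W.last a := by
  rcases (W.le_last a i).eq_or_lt with h1 | h1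
  · exact h1
  · have h2 := W.off_add_τ_le_off a h1
    have := (W.τ a (W.last a)).2
    have := W.off_add_τ_le_one a (W.last a)
    linarith

theorem exists_off_le (a : A) {u : ℝ} (h0 : 0 ≤ u) (h1 : u ≤ 1) :
    ∃ i, W.off a i ≤ u ∧ u ≤ W.off a i + W.τ a i := by
  by_contra! hcon
  have key : ∀ k (hk : k < W.len a), W.off a ⟨k, hk⟩ ≤ u := by
    intro k
    induction k with
    | zero => intro hk; exact (W.off_first a).le.trans h0
    | succ k ih =>
      intro hk
      have h2 := (hcon ⟨k, by omega⟩ (ih (by omega))).le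
      rw [off_add_τ] at h2
      have h3 : Finset.Iio (⟨k + 1, hk⟩ : Fin (W.len a)) = Finset.Iic ⟨k, by omega⟩ := by
        ext j; simp [Fin.lt_def, Fin.le_def]
      rwa [off, h3]
  have h4 := hcon (W.last a) (key _ _)
  rw [off_last] at h4
  linarith

/-- `κ` makes heights decay geometrically along descents, and `η` prevents a child from being
arbitrarily flat compared with its parent. -/
theorem exists_τ_bounds [Finite A] [Nonempty A] :
    ∃ κ η : ℝ, 0 < κ ∧ κ < 1 ∧ 0 < η ∧ ∀ a i, (W.τ a i : ℝ) ≤ κ ∧ η ≤ W.τ a i := by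
  have : Nonempty (Σ a, Fin (W.len a)) := ⟨⟨Classical.arbitrary A, W.first _⟩⟩
  obtain ⟨e, he⟩ := Finite.exists_max fun e : Σ a, Fin (W.len a) => (W.τ e.1 e.2 : ℝ)
  obtain ⟨f, hf⟩ := Finite.exists_min fun e : Σ a, Fin (W.len a) => (W.τ e.1 e.2 : ℝ)
  exact ⟨_, _, (W.τ e.1 e.2).2, W.τ_lt_one e.1 e.2, (W.τ f.1 f.2).2,
    fun a i => ⟨he ⟨a, i⟩, hf ⟨a, i⟩⟩⟩

/-! ### Descendants -/

/-- The `i`-th child of a colored tile, with its color. -/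
def child (p : Tile × A) (i : Fin (W.len p.2)) : Tile × A := (p.1.child W p.2 i, W.σ p.2 i)

variable (p : Tile × A) (i : Fin (W.len p.2))

theorem child_x₁ : (W.child p i).1.x₁ = p.1.x₁ + p.1.y₁ * W.off p.2 i := by
  rw [← p.1.width]; rfl

theorem child_x₂ : (W.child p i).1.x₂ = p.1.x₁ + p.1.y₁ * (W.off p.2 i + W.τ p.2 i) := by
  rw [← p.1.width, off_add_τ]; rfl

@[simp] theorem child_y₁ : (W.child p i).1.y₁ = W.τ p.2 i * p.1.y₁ := rfl

@[simp] theorem child_y₂ : (W.child p i).1.y₂ = p.1.y₁ := rfl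

@[simp] theorem child_snd : (W.child p i).2 = W.σ p.2 i := rfl

theorem x₁_le_child_x₁ : p.1.x₁ ≤ (W.child p i).1.x₁ := by
  rw [child_x₁]
  have := mul_nonneg p.1.y₁_pos.le (W.off_nonneg p.2 i)
  linarith

theorem child_x₂_le_x₂ : (W.child p i).1.x₂ ≤ p.1.x₂ := by
  rw [child_x₂]
  have := mul_le_mul_of_nonneg_left (W.off_add_τ_le_one p.2 i) p.1.y₁_pos.le
  have := p.1.width
  linarith

theorem child_x₂_le_child_x₁ {i j : Fin (W.len p.2)} (h : i < j) :
    (W.child p i).1.x₂ ≤ (W.child p j).1.x₁ := by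
  rw [child_x₁, child_x₂]
  have := mul_le_mul_of_nonneg_left (W.off_add_τ_le_off p.2 h) p.1.y₁_pos.le
  linarith

theorem not_meets_child {i j : Fin (W.len p.2)} (h : i ≠ j) {R Q : Tile}
    (hR₁ : (W.child p i).1.x₁ ≤ R.x₁) (hR₂ : R.x₂ ≤ (W.child p i).1.x₂)
    (hQ₁ : (W.child p j).1.x₁ ≤ Q.x₁) (hQ₂ : Q.x₂ ≤ (W.child p j).1.x₂) : ¬ R.Meets Q := by
  rintro ⟨h1, h2, -, -⟩
  rcases lt_or_gt_of_ne h with h | h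
  · have := W.child_x₂_le_child_x₁ p h; linarith
  · have := W.child_x₂_le_child_x₁ p h; linarith

theorem child_scale (l : PosReal) :
    ((W.child p i).1.scale l, (W.child p i).2) = W.child (p.1.scale l, p.2) i := by
  refine Prod.ext (Tile.ext ?_ ?_ ?_ rfl) rfl
  · change l * (W.child p i).1.x₁ = (W.child (p.1.scale l, p.2) i).1.x₁
    rw [child_x₁, child_x₁]; simp only [Tile.scale]; ring
  · change l * (W.child p i).1.x₂ = (W.child (p.1.scale l, p.2) i).1.x₂
    rw [child_x₂, child_x₂]; simp only [Tile.scale]; ring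
  · change l * (W.child p i).1.y₁ = (W.child (p.1.scale l, p.2) i).1.y₁
    rw [child_y₁, child_y₁]; simp only [Tile.scale]; ring

/-- `q` is a descendant of `p`, possibly `p` itself. -/
def Desc : Tile × A → Tile × A → Prop := Relation.ReflTransGen fun p q => ∃ i, q = W.child p i

variable {W p}

theorem Desc.refl (p : Tile × A) : W.Desc p p := Relation.ReflTransGen.refl

theorem Desc.trans {p q r : Tile × A} (h : W.Desc p q) (h' : W.Desc q r) : W.Desc p r :=
  Relation.ReflTransGen.trans h h'

theorem desc_child (p : Tile × A) (i : Fin (W.len p.2)) : W.Desc p (W.child p i) :=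
  Relation.ReflTransGen.single ⟨i, rfl⟩

theorem Desc.cases {p q : Tile × A} (h : W.Desc p q) : q = p ∨ ∃ i, W.Desc (W.child p i) q := by
  rcases Relation.ReflTransGen.cases_head h with h | ⟨r, ⟨i, rfl⟩, h⟩
  · exact Or.inl h.symm
  · exact Or.inr ⟨i, h⟩

theorem Desc.cases_last {p q : Tile × A} (h : W.Desc p q) :
    q = p ∨ ∃ r i, W.Desc p r ∧ q = W.child r i := by
  rcases Relation.ReflTransGen.cases_tail h with h | ⟨r, h, ⟨i, hi⟩⟩
  · exact Or.inl h
  · exact Or.inr ⟨r, i, h, hi⟩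

theorem Desc.induction {q : Tile × A} {P : Tile × A → Prop} (refl : P q)
    (step : ∀ p i, W.Desc (W.child p i) q → P (W.child p i) → P p) {p : Tile × A}
    (h : W.Desc p q) : P p := by
  induction h using Relation.ReflTransGen.head_induction_on with
  | refl => exact refl
  | head h' h ih =>
    obtain ⟨i, rfl⟩ := h'
    exact step _ i h ih

theorem Desc.x₁_le {p q : Tile × A} (h : W.Desc p q) : p.1.x₁ ≤ q.1.x₁ :=
  h.induction (P := fun p => p.1.x₁ ≤ q.1.x₁) le_rfl fun p i _ ih => (W.x₁_le_child_x₁ p i).trans ih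

theorem Desc.x₂_le {p q : Tile × A} (h : W.Desc p q) : q.1.x₂ ≤ p.1.x₂ :=
  h.induction (P := fun p => q.1.x₂ ≤ p.1.x₂) le_rfl fun p i _ ih => ih.trans (W.child_x₂_le_x₂ p i)

theorem Desc.y₂_le {p q : Tile × A} (h : W.Desc p q) : q.1.y₂ ≤ p.1.y₂ :=
  h.induction (P := fun p => q.1.y₂ ≤ p.1.y₂) le_rfl fun p _ _ ih => ih.trans p.1.y₁_lt_y₂.le

theorem Desc.eq_or_y₂_le {p q : Tile × A} (h : W.Desc p q) : q = p ∨ q.1.y₂ ≤ p.1.y₁ := by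
  rcases h.cases with h | ⟨i, h⟩
  · exact Or.inl h
  · exact Or.inr h.y₂_le

theorem Desc.scale {p q : Tile × A} (h : W.Desc p q) (l : PosReal) :
    W.Desc (p.1.scale l, p.2) (q.1.scale l, q.2) :=
  h.induction (P := fun p => W.Desc (p.1.scale l, p.2) (q.1.scale l, q.2)) (Desc.refl _)
    fun p i _ ih => (desc_child (p.1.scale l, p.2) i).trans (by rwa [← child_scale])

/-- Two descendants of the same tile are equal or disjoint. -/
theorem Desc.eq_of_meets {r p q : Tile × A} (hp : W.Desc r p) (hq : W.Desc r q)
    (h : p.1.Meets q.1) : p = q := by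
  refine hp.induction (P := fun r => W.Desc r q → p = q) ?_ ?_ hq
  · intro hq
    rcases hq.eq_or_y₂_le with h1 | h1
    · exact h1.symm
    · exact absurd h.2.2.1 (not_lt.2 h1)
  · intro r i hp ih hq
    rcases hq.cases with rfl | ⟨j, hj⟩
    · exact absurd h.2.2.2 (not_lt.2 hp.y₂_le)
    · by_cases hij : i = j
      · subst hij; exact ih hj
      · exact absurd h (W.not_meets_child r hij hp.x₁_le hp.x₂_le hj.x₁_le hj.x₂_le)

/-- The descendants of a tile cover everything below it. -/
theorem exists_desc_mem_closure [Finite A] [Nonempty A] (p : Tile × A) {z : ℂ}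
    (h1 : p.1.x₁ ≤ z.re) (h2 : z.re ≤ p.1.x₂) (h3 : 0 < z.im) (h4 : z.im ≤ p.1.y₂) :
    ∃ q, W.Desc p q ∧ z ∈ closure q.1.toSet := by
  obtain ⟨κ, η, hκ0, hκ, hη, hb⟩ := W.exists_τ_bounds
  -- Heights shrink at least by `κ` per generation, so the level of `z` is reached after at most `n`
  -- generations once `κ ^ n * p.1.y₁ ≤ z.im`.
  have key : ∀ n : ℕ, ∀ p : Tile × A, p.1.x₁ ≤ z.re → z.re ≤ p.1.x₂ → z.im ≤ p.1.y₂ →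
      κ ^ n * p.1.y₁ ≤ z.im → ∃ q, W.Desc p q ∧ z ∈ closure q.1.toSet := by
    intro n
    induction n with
    | zero =>
      intro p h1 h2 h4 h5
      refine ⟨p, Desc.refl p, ?_⟩
      rw [Tile.closure_toSet]
      exact ⟨h1, h2, by simpa using h5, h4⟩
    | succ n ih =>
      intro p h1 h2 h4 h5
      by_cases h6 : p.1.y₁ ≤ z.im
      · refine ⟨p, Desc.refl p, ?_⟩
        rw [Tile.closure_toSet]
        exact ⟨h1, h2, h6, h4⟩
      · have hy := p.1.y₁_pos
        obtain ⟨i, hi, hi'⟩ := W.exists_off_le p.2 (u := (z.re - p.1.x₁) / p.1.y₁)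
          (div_nonneg (by linarith) hy.le)
          (by rw [div_le_one hy, ← p.1.width]; linarith)
        rw [le_div_iff₀ hy] at hi
        rw [div_le_iff₀ hy] at hi'
        obtain ⟨q, hq, hzq⟩ := ih (W.child p i) (by rw [child_x₁]; linarith)
          (by rw [child_x₂]; linarith) (not_le.1 h6).le (by
            rw [child_y₁]
            refine le_trans ?_ h5
            rw [pow_succ, mul_assoc]
            gcongr
            exact (hb _ _).1)
        exact ⟨q, (desc_child p i).trans hq, hzq⟩
  obtain ⟨n, hn⟩ := exists_pow_lt_of_lt_one (div_pos h3 p.1.y₁_pos) hκ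
  exact key n p h1 h2 h4 ((lt_div_iff₀ p.1.y₁_pos).1 hn).le

/-! ### Tilings that are closed under taking children -/

variable {g : A → PosReal} {ω : ColoredTiling A}

theorem mem_of_desc (hω : ω ∈ W.preSpace g) {p q : Tile × A} (hp : p ∈ ω.tiles)
    (h : W.Desc p q) : q ∈ ω.tiles := by
  induction h with
  | refl => exact hp
  | tail _ h ih =>
    obtain ⟨i, rfl⟩ := h
    exact (hω _ _ ih).2 i

theorem isClosed_baseSet (W : WeightedSubst A) : IsClosed (W.baseSet : Set PosReal) := by
  rw [baseSet, Subgroup.coe_sInf]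
  exact isClosed_biInter fun H hH => hH.1

theorem isClosed_smul_baseSet (W : WeightedSubst A) (t : PosReal) :
    IsClosed (t • (W.baseSet : Set PosReal)) := by
  have h : t • (W.baseSet : Set PosReal) = (fun y => t⁻¹ * y) ⁻¹' (W.baseSet : Set PosReal) := by
    ext y
    rw [Set.mem_smul_set_iff_inv_smul_mem]
    rfl
  rw [h]
  refine (isClosed_baseSet W).preimage ?_
  exact Continuous.subtype_mk (continuous_const.mul continuous_subtype_val) _

theorem scale_mem_preSpace (hω : ω ∈ W.preSpace g) {l : PosReal} (hl : l ∈ W.baseSet) :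
    ω.scale l ∈ W.preSpace g := by
  rintro R a ⟨p, hp, h⟩
  obtain ⟨rfl, rfl⟩ := Prod.mk.inj h
  obtain ⟨⟨y, hy, hy'⟩, h2⟩ := hω _ _ hp
  refine ⟨⟨l * y, ?_, ?_⟩, fun i => ?_⟩
  · rw [Set.mem_smul_set_iff_inv_smul_mem] at hy ⊢
    simp only [smul_eq_mul, SetLike.mem_coe] at hy ⊢
    rw [mul_left_comm]
    exact W.baseSet.mul_mem hl hy
  · simp [hy', Tile.scale]
  · have h3 := ColoredTiling.scale_mem_scale (l := l) (h2 i)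
    have h4 := W.child_scale p i (l := l)
    change (_, _) = (Tile.child W (p.1.scale l) p.2 i, W.σ p.2 i) at h4
    rw [← h4]
    exact h3

section

variable [Finite A] [Nonempty A]

/-- A tile that meets the column of `p`, somewhere below the top of `p`, descends from `p`. -/
theorem desc_of_below (hω : ω ∈ W.preSpace g) {p q : Tile × A} (hp : p ∈ ω.tiles)
    (hq : q ∈ ω.tiles) (h1 : q.1.x₁ < p.1.x₂) (h2 : p.1.x₁ < q.1.x₂) (h3 : q.1.y₁ < p.1.y₂) :
    W.Desc p q := by
  obtain ⟨x, hx⟩ := Tile.exists_between_max_min q.1.x₁_lt_x₂ p.1.x₁_lt_x₂ h1 h2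
  obtain ⟨y, hy⟩ := exists_between (lt_min q.1.y₁_lt_y₂ h3)
  obtain ⟨r, hr, hzr⟩ := exists_desc_mem_closure (W := W) p (z := ⟨x, y⟩) hx.2.2.1.le hx.2.2.2.le
    (q.1.y₁_pos.trans hy.1) (hy.2.le.trans (min_le_right _ _))
  have hzq : (⟨x, y⟩ : ℂ) ∈ q.1.toSet := ⟨hx.1, hx.2.1, hy.1, hy.2.trans_le (min_le_left _ _)⟩
  rwa [← ColoredTiling.eq_of_meets (mem_of_desc hω hp hr) hq (Tile.meets_of_mem hzr hzq)]

/-- A tile through a point one unit above the middle of the top side of `p` has `p` as a proper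
descendant; the last step of the descent gives the parent. -/
theorem exists_parent (hω : ω ∈ W.preSpace g) {p : Tile × A} (hp : p ∈ ω.tiles) :
    ∃ q ∈ ω.tiles, ∃ i, p = W.child q i := by
  have hx := p.1.x₁_lt_x₂
  set x := (p.1.x₁ + p.1.x₂) / 2 with hxdef
  obtain ⟨q, hq, hz⟩ := ω.exists_mem_closure (z := ⟨x, p.1.y₂ + 1⟩)
    (by have := p.1.y₂_pos; change 0 < p.1.y₂ + 1; linarith)
  rw [Tile.closure_toSet] at hz
  obtain ⟨h1, h2, h3, h4⟩ := hz
  dsimp only at h1 h2 h3 h4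
  have hd : W.Desc q p := desc_of_below hω hq hp (by linarith) (by linarith)
    (by have := p.1.y₁_lt_y₂; linarith)
  rcases hd.cases_last with h | ⟨r, i, hr, hi⟩
  · rw [h] at h4; linarith
  · exact ⟨r, mem_of_desc hω hq hr, i, hi⟩

/-- Passing to parents multiplies the height by at least `κ⁻¹` each time. -/
theorem exists_large_ancestor (hω : ω ∈ W.preSpace g) {p : Tile × A} (hp : p ∈ ω.tiles) (M : ℝ) :
    ∃ q ∈ ω.tiles, W.Desc q p ∧ M ≤ q.1.y₁ := by
  obtain ⟨κ, η, hκ0, hκ, hη, hb⟩ := W.exists_τ_bounds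
  have key : ∀ n : ℕ, ∃ q ∈ ω.tiles, W.Desc q p ∧ p.1.y₁ ≤ κ ^ n * q.1.y₁ := by
    intro n
    induction n with
    | zero => exact ⟨p, hp, Desc.refl p, by simp⟩
    | succ n ih =>
      obtain ⟨q, hq, hd, hle⟩ := ih
      obtain ⟨r, hr, i, rfl⟩ := exists_parent hω hq
      refine ⟨r, hr, (desc_child r i).trans hd, hle.trans ?_⟩
      rw [child_y₁, pow_succ, mul_assoc]
      have := (hb r.2 i).1
      have := r.1.y₁_pos
      gcongr
  have hM : 0 < |M| + 1 := by positivity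
  obtain ⟨n, hn⟩ := exists_pow_lt_of_lt_one (div_pos p.1.y₁_pos hM) hκ
  rw [lt_div_iff₀ hM] at hn
  obtain ⟨q, hq, hd, hle⟩ := key n
  refine ⟨q, hq, hd, ?_⟩
  have := lt_of_mul_lt_mul_left (hn.trans_le hle) (by positivity)
  linarith [le_abs_self M]

end

/-- The defining conditions of the tiling space pass to limits. -/
theorem space_subset_preSpace (g : A → PosReal) : W.space g ⊆ W.preSpace g := by
  intro ω hω R a hR
  have happrox : ∀ {p q : Tile × A}, p ∈ ω.tiles → q ∈ ω.tiles → ∀ {ε : ℝ}, 0 < ε →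
    ∃ ω' ∈ W.preSpace g, (∃ R, (R, p.2) ∈ ω'.tiles ∧ p.1.Close ε R) ∧
      ∃ R, (R, q.2) ∈ ω'.tiles ∧ q.1.Close ε R := by
    intro p q hp hq ε hε
    obtain ⟨ω', hω', h⟩ := ColoredTiling.exists_close_of_mem_closure hω hp hq hε
    exact ⟨ω', hω'.1, h⟩
  constructor
  · have hcl := isClosed_smul_baseSet W (g a)
    refine ⟨⟨R.y₁, R.y₁_pos⟩, ?_, rfl⟩
    rw [← hcl.closure_eq, Metric.mem_closure_iff]
    intro ε hε
    obtain ⟨ω', hω', ⟨R', hR', hc⟩, -⟩ := happrox hR hR (half_pos hε)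
    obtain ⟨y, hy, hy'⟩ := (hω' _ _ hR').1
    refine ⟨y, hy, ?_⟩
    rw [Subtype.dist_eq, dist_comm, Real.dist_eq, hy']
    exact hc.2.2.1.trans_lt (half_lt_self hε)
  · intro i
    set C := W.child (R, a) i with hC
    change C ∈ ω.tiles
    have hCx := C.1.x₁_lt_x₂
    have hCy := C.1.y₁_lt_y₂
    -- Let `q` be a tile of `ω` over the centre of the expected child `C`; the rest shows `C = q`.
    obtain ⟨q, hq, hz⟩ := ω.exists_mem_closure
      (z := ⟨(C.1.x₁ + C.1.x₂) / 2, (C.1.y₁ + C.1.y₂) / 2⟩)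
      (by have := C.1.y₁_pos; have := C.1.y₂_pos; change 0 < (C.1.y₁ + C.1.y₂) / 2; linarith)
    have hmeets : q.1.Meets C.1 := Tile.meets_of_mem hz
      ⟨by dsimp only; linarith, by dsimp only; linarith, by dsimp only; linarith,
        by dsimp only; linarith⟩
    obtain ⟨m1, m2, m3, m4⟩ := hmeets
    -- `δ` measures the overlap of `C` and `q`. In an `ε`-close tiling the true child `C'` is within
    -- `2 ε` of `C` and `Q'` within `ε` of `q`. As `3 ε < δ`, these two still overlap, hence
    -- coincide, and so `C` and `q` differ by at most `3 ε`.
    obtain ⟨δ, hδ, hδ'⟩ : ∃ δ > 0, δ ≤ C.1.x₂ - q.1.x₁ ∧ δ ≤ q.1.x₂ - C.1.x₁ ∧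
        δ ≤ C.1.y₂ - q.1.y₁ ∧ δ ≤ q.1.y₂ - C.1.y₁ :=
      ⟨min (min (C.1.x₂ - q.1.x₁) (q.1.x₂ - C.1.x₁)) (min (C.1.y₂ - q.1.y₁) (q.1.y₂ - C.1.y₁)),
        by simp only [gt_iff_lt, lt_min_iff, sub_pos]; exact ⟨⟨m1, m2⟩, m3, m4⟩,
        by simp, by simp, by simp, by simp⟩
    have hτ := W.τ_lt_one a i
    have hτ0 := (W.τ a i).2
    have ho := W.off_nonneg a i
    have ho1 := W.off_add_τ_le_one a i
    have hmain : ∀ ε, 0 < ε → ε ≤ δ / 4 → C.2 = q.2 ∧ |q.1.x₁ - C.1.x₁| ≤ 3 * ε ∧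
        |q.1.x₂ - C.1.x₂| ≤ 3 * ε ∧ |q.1.y₁ - C.1.y₁| ≤ 3 * ε ∧ |q.1.y₂ - C.1.y₂| ≤ 3 * ε := by
      intro ε hε hεδ
      obtain ⟨ω', hω', ⟨R', hR', c1, c2, c3, c4⟩, ⟨Q', hQ', d1, d2, d3, d4⟩⟩ := happrox hR hq hε
      have hC' := (hω' _ _ hR').2 i
      change W.child (R', a) i ∈ ω'.tiles at hC'
      set C' := W.child (R', a) i with hC'def
      have e1 : |C'.1.x₁ - C.1.x₁| ≤ 2 * ε := by
        rw [hC, hC'def, child_x₁, child_x₁]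
        dsimp only at c1 c3 ⊢
        rw [show R'.x₁ + R'.y₁ * W.off a i - (R.x₁ + R.y₁ * W.off a i) =
          (R'.x₁ - R.x₁) + (R'.y₁ - R.y₁) * W.off a i by ring]
        refine (abs_add_le _ _).trans ?_
        rw [abs_mul, abs_of_nonneg ho]
        have := mul_le_mul c3 (show W.off a i ≤ 1 by linarith) ho (by positivity)
        linarith
      have e2 : |C'.1.x₂ - C.1.x₂| ≤ 2 * ε := by
        rw [hC, hC'def, child_x₂, child_x₂]
        dsimp only at c1 c3 ⊢
        rw [show R'.x₁ + R'.y₁ * (W.off a i + W.τ a i) - (R.x₁ + R.y₁ * (W.off a i + W.τ a i)) =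
          (R'.x₁ - R.x₁) + (R'.y₁ - R.y₁) * (W.off a i + W.τ a i) by ring]
        refine (abs_add_le _ _).trans ?_
        have h0 : 0 ≤ W.off a i + W.τ a i := by linarith
        rw [abs_mul, abs_of_nonneg h0]
        have := mul_le_mul c3 ho1 h0 (by positivity)
        linarith
      have e3 : |C'.1.y₁ - C.1.y₁| ≤ ε := by
        rw [hC, hC'def, child_y₁, child_y₁]
        dsimp only at c3 ⊢
        rw [← mul_sub, abs_mul, abs_of_pos hτ0]
        have := mul_le_mul hτ.le c3 (abs_nonneg _) zero_le_one
        linarith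
      have e4 : |C'.1.y₂ - C.1.y₂| ≤ ε := by
        rw [hC, hC'def, child_y₂, child_y₂]
        exact c3
      simp only [abs_le] at e1 e2 e3 e4 d1 d2 d3 d4
      have hmeet : C'.1.Meets Q' := by
        refine ⟨?_, ?_, ?_, ?_⟩ <;> linarith
      have heq : C' = (Q', q.2) := ColoredTiling.eq_of_meets hC' hQ' hmeet
      have hcol : C'.2 = q.2 := by rw [heq]
      refine ⟨hcol, ?_⟩
      rw [heq] at e1 e2 e3 e4
      dsimp only at e1 e2 e3 e4
      refine ⟨?_, ?_, ?_, ?_⟩ <;> rw [abs_le] <;> constructor <;> linarith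
    have hlim : ∀ u v : ℝ, (∀ ε, 0 < ε → ε ≤ δ / 4 → |u - v| ≤ 3 * ε) → v = u := by
      intro u v h
      by_contra hne
      have hpos : 0 < |u - v| := abs_pos.2 (sub_ne_zero.2 (Ne.symm hne))
      have h1 := h (min (δ / 4) (|u - v| / 4)) (lt_min (by linarith) (by linarith)) (min_le_left _ _)
      have h2 := min_le_right (δ / 4) (|u - v| / 4)
      linarith
    have hCq : C = q := by
      refine Prod.ext (Tile.ext ?_ ?_ ?_ ?_) (hmain (δ / 4) (by linarith) le_rfl).1
      · exact hlim _ _ fun ε h h' => (hmain ε h h').2.1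
      · exact hlim _ _ fun ε h h' => (hmain ε h h').2.2.1
      · exact hlim _ _ fun ε h h' => (hmain ε h h').2.2.2.1
      · exact hlim _ _ fun ε h h' => (hmain ε h h').2.2.2.2
    rw [hCq]
    exact hq

end WeightedSubst

end NumerationSystem
end

noncomputable section

namespace NumerationSystem

namespace WeightedSubst

variable {A : Type*} (W : WeightedSubst A)

/-! ### Edge paths of a weighted substitution -/

/-- The edges of the graph of a substitution: a letter together with a position in its word. -/
abbrev Edge : Type _ := Σ a, Fin (W.len a)

/-- An edge can be followed by the edges at the letter it points to. -/
def adj (e f : W.Edge) : Prop := f.1 = W.σ e.1 e.2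

/-- The weight of an edge. -/
def wt (e : W.Edge) : PosReal := W.τ e.1 e.2

/-- The offset of an edge. -/
def eoff (e : W.Edge) : ℝ := W.off e.1 e.2

variable {W}

theorem wt_pos (e : W.Edge) : 0 < (W.wt e : ℝ) := (W.wt e).2

theorem wt_lt_one (e : W.Edge) : (W.wt e : ℝ) < 1 := W.τ_lt_one _ _

theorem eoff_nonneg (e : W.Edge) : 0 ≤ W.eoff e := W.off_nonneg _ _

theorem eoff_add_wt_le_one (e : W.Edge) : W.eoff e + W.wt e ≤ 1 := W.off_add_τ_le_one _ _

/-- The weight of an initial segment of a path, as a real number. -/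
theorem coe_weight (x : Path W.adj) (n : ℕ) :
    ((x.weight W.wt n : PosReal) : ℝ) = x.weight (fun e => (W.wt e : ℝ)) n := by
  induction n with
  | zero => rfl
  | succ n ih => rw [Path.weight_succ', Path.weight_succ', ← ih]; rfl

theorem weight_pos (x : Path W.adj) (n : ℕ) : 0 < ((x.weight W.wt n : PosReal) : ℝ) :=
  (x.weight W.wt n).2

theorem weight_le_one (x : Path W.adj) (n : ℕ) : ((x.weight W.wt n : PosReal) : ℝ) ≤ 1 := by
  rw [coe_weight]
  exact Finset.prod_le_one (fun k _ => (wt_pos _).le) fun k _ => (wt_lt_one _).le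

theorem weight_lt_one (x : Path W.adj) {n : ℕ} (hn : 0 < n) :
    ((x.weight W.wt n : PosReal) : ℝ) < 1 := by
  obtain ⟨n, rfl⟩ := Nat.exists_eq_succ_of_ne_zero hn.ne'
  rw [Path.weight_succ']
  exact mul_lt_one_of_nonneg_of_lt_one_right (weight_le_one x n) (wt_pos _).le (wt_lt_one _)

theorem mem_iter_weight (x : Path W.adj) (n : ℕ) :
    ((x n).1, x.weight W.wt n) ∈ W.iter n (x 0).1 := by
  induction n generalizing x with
  | zero => simp [iter]
  | succ n ih =>
    rw [iter, List.mem_flatten]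
    refine ⟨_, List.mem_ofFn.2 ⟨(x 0).2, rfl⟩, ?_⟩
    rw [List.mem_map]
    refine ⟨((x (n + 1)).1, x.shift.weight W.wt n), ?_, ?_⟩
    · have h := ih x.shift
      rw [Path.shift_apply, Path.shift_apply] at h
      have h1 : (x (0 + 1)).1 = W.σ (x 0).1 (x 0).2 := x.adj_succ 0
      rwa [h1] at h
    · rw [Path.weight_succ]; rfl

theorem mem_baseSet_of_mem_iter {a : A} {n : ℕ} {t : PosReal} (h : (a, t) ∈ W.iter n a) :
    t ∈ W.baseSet := by
  rw [baseSet, Subgroup.mem_sInf]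
  exact fun H hH => hH.2 ⟨a, n, h⟩

theorem weight_mem_baseSet {x : Path W.adj} {n : ℕ} (h : Function.IsPeriodicPt Path.shift n x) :
    x.weight W.wt n ∈ W.baseSet := by
  refine mem_baseSet_of_mem_iter (a := (x 0).1) (n := n) ?_
  have h1 := mem_iter_weight x n
  have h2 := congrArg (fun y : Path W.adj => y 0) h.eq
  simp only [Path.iterate_shift_apply, zero_add] at h2
  rwa [h2] at h1

/-- The relative horizontal position of the point singled out by a path. -/
def pos (x : Path W.adj) : ℝ := ∑' k, ((x.weight W.wt k : PosReal) : ℝ) * W.eoff (x k)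

/-- The partial sum and the partial sum plus the weight are the end points of the `n`-th of a nested
sequence of subintervals of `[0, 1]`. -/
theorem sum_range_add_weight_le_one (x : Path W.adj) (n : ℕ) :
    ∑ k ∈ Finset.range n, ((x.weight W.wt k : PosReal) : ℝ) * W.eoff (x k) + x.weight W.wt n ≤ 1 := by
  induction n with
  | zero => simp
  | succ n ih =>
    rw [Finset.sum_range_succ]
    refine le_trans ?_ ih
    rw [Path.weight_succ', Positive.val_mul]
    have := mul_le_mul_of_nonneg_left (eoff_add_wt_le_one (x n)) (weight_pos x n).le
    linarith

theorem sum_range_le_one (x : Path W.adj) (n : ℕ) :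
    ∑ k ∈ Finset.range n, ((x.weight W.wt k : PosReal) : ℝ) * W.eoff (x k) ≤ 1 := by
  have := sum_range_add_weight_le_one x n
  have := weight_pos x n
  linarith

theorem summable_pos (x : Path W.adj) :
    Summable fun k => ((x.weight W.wt k : PosReal) : ℝ) * W.eoff (x k) :=
  summable_of_sum_range_le (fun _ => mul_nonneg (weight_pos _ _).le (eoff_nonneg _))
    (sum_range_le_one x)

theorem pos_nonneg (x : Path W.adj) : 0 ≤ pos x :=
  tsum_nonneg fun _ => mul_nonneg (weight_pos _ _).le (eoff_nonneg _)

theorem pos_le_one (x : Path W.adj) : pos x ≤ 1 :=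
  Real.tsum_le_of_sum_range_le (fun _ => mul_nonneg (weight_pos _ _).le (eoff_nonneg _))
    (sum_range_le_one x)

theorem pos_eq (x : Path W.adj) : pos x = W.eoff (x 0) + W.wt (x 0) * pos x.shift := by
  rw [pos, (summable_pos x).tsum_eq_zero_add, pos, ← tsum_mul_left]
  congr 1
  · simp
  · refine tsum_congr fun k => ?_
    rw [Path.weight_succ, Positive.val_mul, mul_assoc]; rfl

/-- The point singled out by a path lies in the interior. -/
def Interior (x : Path W.adj) : Prop := 0 < pos x ∧ pos x < 1

theorem interior_of_shift {x : Path W.adj} (h : Interior x.shift) : Interior x := by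
  have h1 := wt_pos (x 0)
  have h2 := eoff_nonneg (x 0)
  have h3 := eoff_add_wt_le_one (x 0)
  have h4 := mul_pos h1 h.1
  have h5 := mul_lt_mul_of_pos_left h.2 h1
  constructor <;> rw [pos_eq] <;> linarith

theorem interior_of_iterate {x : Path W.adj} (n : ℕ) (h : Interior (Path.shift^[n] x)) :
    Interior x := by
  induction n with
  | zero => exact h
  | succ n ih =>
    rw [Function.iterate_succ_apply'] at h
    exact ih (interior_of_shift h)

/-- Interiority passes from the shift back to the path; on a periodic path, going back often enough
is going forward. -/
theorem interior_shift {x : Path W.adj} (hx : x ∈ Function.periodicPts Path.shift)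
    (h : Interior x) : Interior x.shift := by
  obtain ⟨n, hn, hx⟩ := hx
  refine interior_of_iterate (n - 1) ?_
  rwa [← Function.iterate_succ_apply, Nat.succ_eq_add_one, Nat.sub_add_cancel hn, hx.eq]

theorem interior_iterate {x : Path W.adj} (hx : x ∈ Function.periodicPts Path.shift)
    (h : Interior x) (k : ℕ) : Interior (Path.shift^[k] x) := by
  induction k with
  | zero => exact h
  | succ k ih =>
    rw [Function.iterate_succ_apply']
    exact interior_shift (Path.mem_periodicPts_iterate hx k) ih

theorem eq_first_of_pos_eq_zero {x : Path W.adj} (h : pos x = 0) :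
    x 0 = ⟨(x 0).1, W.first _⟩ ∧ pos x.shift = 0 := by
  rw [pos_eq] at h
  have h1 := mul_nonneg (wt_pos (x 0)).le (pos_nonneg x.shift)
  have h2 := eoff_nonneg (x 0)
  constructor
  · exact Sigma.ext rfl (heq_of_eq (W.eq_first_of_off_le (a := (x 0).1) (i := (x 0).2)
      (show W.eoff (x 0) ≤ 0 by linarith)))
  · have h3 : (W.wt (x 0) : ℝ) * pos x.shift = 0 := by linarith
    exact (mul_eq_zero.1 h3).resolve_left (wt_pos _).ne'

theorem eq_last_of_pos_eq_one {x : Path W.adj} (h : pos x = 1) :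
    x 0 = ⟨(x 0).1, W.last _⟩ ∧ pos x.shift = 1 := by
  rw [pos_eq] at h
  have h1 := mul_le_mul_of_nonneg_left (pos_le_one x.shift) (wt_pos (x 0)).le
  have h2 := eoff_add_wt_le_one (x 0)
  constructor
  · exact Sigma.ext rfl (heq_of_eq (W.eq_last_of_one_le (a := (x 0).1) (i := (x 0).2)
      (show 1 ≤ W.eoff (x 0) + W.wt (x 0) by linarith)))
  · have h3 : (W.wt (x 0) : ℝ) * pos x.shift = W.wt (x 0) * 1 := by linarith
    exact mul_left_cancel₀ (wt_pos _).ne' h3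

/-- A path all of whose edges are determined by the letter they start from is determined by its
first edge. -/
theorem path_eq_of_forall_eq {f : ∀ a, Fin (W.len a)} {x y : Path W.adj}
    (hx : ∀ k, x k = ⟨(x k).1, f _⟩) (hy : ∀ k, y k = ⟨(y k).1, f _⟩) (h : x 0 = y 0) : x = y := by
  ext1 k
  induction k with
  | zero => exact h
  | succ k ih =>
    have h1 : (x (k + 1)).1 = (y (k + 1)).1 := by
      have h2 : (x (k + 1)).1 = W.σ (x k).1 (x k).2 := x.adj_succ k
      have h3 : (y (k + 1)).1 = W.σ (y k).1 (y k).2 := y.adj_succ k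
      rw [h2, h3, ih]
    rw [hx, hy, h1]

/-- Position `0` forces the first child at every step and position `1` the last one, so such a path
is determined by its first edge. -/
theorem finite_not_interior [Finite A] : {x : Path W.adj | ¬ Interior x}.Finite := by
  have h0 : {x : Path W.adj | pos x = 0}.Finite := by
    have key : ∀ x : Path W.adj, pos x = 0 → ∀ k, x k = ⟨(x k).1, W.first _⟩ := by
      intro x hx k
      have h1 : pos (Path.shift^[k] x) = 0 := by
        induction k with
        | zero => exact hx
        | succ k ih =>
          rw [Function.iterate_succ_apply']
          exact (eq_first_of_pos_eq_zero ih).2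
      have h2 := (eq_first_of_pos_eq_zero h1).1
      rwa [show (Path.shift^[k] x) 0 = x k by simp] at h2
    refine Set.Finite.of_finite_image (f := fun x : Path W.adj => x 0) (Set.toFinite _) ?_
    intro x hx y hy h
    exact path_eq_of_forall_eq (key x hx) (key y hy) h
  have h1 : {x : Path W.adj | pos x = 1}.Finite := by
    have key : ∀ x : Path W.adj, pos x = 1 → ∀ k, x k = ⟨(x k).1, W.last _⟩ := by
      intro x hx k
      have h1 : pos (Path.shift^[k] x) = 1 := by
        induction k with
        | zero => exact hx
        | succ k ih =>
          rw [Function.iterate_succ_apply']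
          exact (eq_last_of_pos_eq_one ih).2
      have h2 := (eq_last_of_pos_eq_one h1).1
      rwa [show (Path.shift^[k] x) 0 = x k by simp] at h2
    refine Set.Finite.of_finite_image (f := fun x : Path W.adj => x 0) (Set.toFinite _) ?_
    intro x hx y hy h
    exact path_eq_of_forall_eq (key x hx) (key y hy) h
  refine (h0.union h1).subset fun x hx => ?_
  by_contra hcon
  simp only [Set.mem_union, Set.mem_ofPred_eq, not_or] at hcon
  exact hx ⟨lt_of_le_of_ne (pos_nonneg x) (Ne.symm hcon.1), lt_of_le_of_ne (pos_le_one x) hcon.2⟩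

/-! ### The tiling of a periodic path -/

/-- The point `0` lies strictly inside the column of a tile. -/
def Straddles (p : Tile × A) : Prop := p.1.x₁ < 0 ∧ 0 < p.1.x₂

theorem Desc.straddles {p q : Tile × A} (h : W.Desc p q) (hq : Straddles q) : Straddles p :=
  ⟨h.x₁_le.trans_lt hq.1, hq.2.trans_le h.x₂_le⟩

theorem straddles_scale_iff {l : PosReal} {R : Tile} {a : A} :
    Straddles (R.scale l, a) ↔ Straddles (R, a) := by
  simp only [Straddles, Tile.scale, mul_pos_iff_of_pos_left l.2]
  rw [← neg_pos, ← mul_neg, mul_pos_iff_of_pos_left l.2, neg_pos]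

theorem child_index_unique {p : Tile × A} {i j : Fin (W.len p.2)} (hi : Straddles (W.child p i))
    (hj : Straddles (W.child p j)) : i = j := by
  by_contra h
  exact W.not_meets_child p h le_rfl le_rfl le_rfl le_rfl
    ⟨hi.1.trans hj.2, hj.1.trans hi.2, (W.child p i).1.y₁_lt_y₂, (W.child p j).1.y₁_lt_y₂⟩

/-- The edge that precedes a periodic path. -/
def prev (x : Path W.adj) : W.Edge := x (Function.minimalPeriod Path.shift x - 1)

theorem prev_shift {x : Path W.adj} (hx : x ∈ Function.periodicPts Path.shift) :
    prev x.shift = x 0 := by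
  have hm := Function.minimalPeriod_pos_of_mem_periodicPts hx
  rw [prev, Function.minimalPeriod_apply hx, Path.shift_apply, Nat.sub_add_cancel hm]
  have h := congrArg (fun y : Path W.adj => y 0) (Function.iterate_minimalPeriod (f := Path.shift) (x := x))
  simp only [Path.iterate_shift_apply, zero_add] at h
  exact h

/-- The colored tile of height `y` at which a periodic path starts, placed so that the point singled
out by the path is `0`. -/
def tile (x : Path W.adj) (y : PosReal) : Tile × A :=
  ({ x₁ := -(pos x * y)
     x₂ := (1 - pos x) * y
     y₁ := y
     -- The top of a tile is the bottom of its parent, and `prev x` is the edge leading from the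
     -- parent to it.
     y₂ := y / W.wt (prev x)
     y₁_pos := y.2
     y₁_lt_y₂ := by rw [lt_div_iff₀ (wt_pos _)]; exact mul_lt_of_lt_one_right y.2 (wt_lt_one _)
     width := by ring }, (x 0).1)

theorem straddles_tile {x : Path W.adj} (h : Interior x) (y : PosReal) : Straddles (tile x y) :=
  ⟨neg_neg_of_pos (mul_pos h.1 y.2), mul_pos (sub_pos.2 h.2) y.2⟩

theorem tile_scale (x : Path W.adj) (y l : PosReal) :
    ((tile x y).1.scale l, (tile x y).2) = tile x (l * y) := by
  refine Prod.ext (Tile.ext ?_ ?_ ?_ ?_) rfl <;> simp only [Tile.scale, tile, Positive.val_mul] <;>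
    ring

theorem child_tile {x : Path W.adj} (hx : x ∈ Function.periodicPts Path.shift) (y : PosReal) :
    W.child (tile x y) (x 0).2 = tile x.shift (W.wt (x 0) * y) := by
  refine Prod.ext (Tile.ext ?_ ?_ ?_ ?_) ?_
  · refine (W.child_x₁ (tile x y) (x 0).2).trans ?_
    change -(pos x * y) + y * W.eoff (x 0) = -(pos x.shift * (W.wt (x 0) * y : PosReal))
    rw [pos_eq x, Positive.val_mul]; ring
  · refine (W.child_x₂ (tile x y) (x 0).2).trans ?_
    change -(pos x * y) + y * (W.eoff (x 0) + W.wt (x 0)) =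
      (1 - pos x.shift) * (W.wt (x 0) * y : PosReal)
    rw [pos_eq x, Positive.val_mul]; ring
  · rfl
  · simp only [child_y₂, tile, prev_shift hx, Positive.val_mul]
    rw [mul_div_cancel_left₀ _ (wt_pos _).ne']
  · exact (x.adj_succ 0).symm

/-- Stated for a variable `p` so that the index has type `Fin (W.len p.2)` and can be compared with
other child indices of `p`. -/
theorem exists_child_eq_tile {p : Tile × A} {x : Path W.adj} {y : PosReal}
    (hx : x ∈ Function.periodicPts Path.shift) (hp : p = tile x y) :
    ∃ i, x 0 = ⟨p.2, i⟩ ∧ W.child p i = tile x.shift (W.wt (x 0) * y) := by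
  subst hp
  exact ⟨(x 0).2, rfl, child_tile hx y⟩

theorem desc_tile {x : Path W.adj} (hx : x ∈ Function.periodicPts Path.shift) (y : PosReal) (k : ℕ) :
    W.Desc (tile x y) (tile (Path.shift^[k] x) (x.weight W.wt k * y)) := by
  induction k with
  | zero => simpa using Desc.refl _
  | succ k ih =>
    refine ih.trans ?_
    obtain ⟨i, -, hi⟩ := exists_child_eq_tile (Path.mem_periodicPts_iterate hx k)
      (rfl : tile (Path.shift^[k] x) (x.weight W.wt k * y) = _)
    rw [show (Path.shift^[k] x) 0 = x k by simp, mul_left_comm, ← mul_assoc, ← Path.weight_succ'] at hi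
    rw [Function.iterate_succ_apply', ← hi]
    exact desc_child _ _

/-- At most one child of a tile straddles `0`, so a descent to a straddling tile is forced to follow
the path. -/
theorem exists_eq_tile_of_desc {q : Tile × A} (hq : Straddles q) {x : Path W.adj} {y : PosReal}
    (hx : x ∈ Function.periodicPts Path.shift) (hint : Interior x) (h : W.Desc (tile x y) q) :
    ∃ k, q = tile (Path.shift^[k] x) (x.weight W.wt k * y) := by
  refine h.induction (P := fun p => ∀ (x : Path W.adj) (y : PosReal),
    x ∈ Function.periodicPts Path.shift → Interior x → p = tile x y →
      ∃ k, q = tile (Path.shift^[k] x) (x.weight W.wt k * y)) ?_ ?_ x y hx hint rfl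
  · intro x y _ _ h
    exact ⟨0, by simpa using h⟩
  · intro p i hd ih x y hx hint hp
    obtain ⟨j, -, hj⟩ := exists_child_eq_tile hx hp
    have hij : i = j := child_index_unique (hd.straddles hq)
      (by rw [hj]; exact straddles_tile (interior_shift hx hint) _)
    subst hij
    obtain ⟨k, hk⟩ := ih _ _ (Path.mem_periodicPts_iterate hx 1) (interior_shift hx hint) hj
    refine ⟨k + 1, ?_⟩
    rw [hk, Path.weight_succ, Function.iterate_succ_apply]
    congr 1
    rw [← mul_assoc, mul_comm (W.wt (x 0))]
    rfl

/-- The path is read off from the tile: its edges are the positions of the successive straddling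
children. -/
theorem tile_injective {x x' : Path W.adj} {y y' : PosReal}
    (hx : x ∈ Function.periodicPts Path.shift) (hint : Interior x)
    (hx' : x' ∈ Function.periodicPts Path.shift) (hint' : Interior x')
    (h : tile x y = tile x' y') : x = x' := by
  ext1 k
  induction k generalizing x x' y y' with
  | zero =>
    obtain ⟨i, hi, hi'⟩ := exists_child_eq_tile hx rfl
    obtain ⟨j, hj, hj'⟩ := exists_child_eq_tile hx' h
    have hij : i = j := child_index_unique
      (by rw [hi']; exact straddles_tile (interior_shift hx hint) _)
      (by rw [hj']; exact straddles_tile (interior_shift hx' hint') _)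
    rw [hi, hj, hij]
  | succ k ih =>
    obtain ⟨i, hi, hi'⟩ := exists_child_eq_tile hx rfl
    obtain ⟨j, hj, hj'⟩ := exists_child_eq_tile hx' h
    have hij : i = j := child_index_unique
      (by rw [hi']; exact straddles_tile (interior_shift hx hint) _)
      (by rw [hj']; exact straddles_tile (interior_shift hx' hint') _)
    subst hij
    rw [hi'] at hj'
    exact ih (Path.mem_periodicPts_iterate hx 1) (interior_shift hx hint)
      (Path.mem_periodicPts_iterate hx' 1) (interior_shift hx' hint') hj'

theorem cycleWeight_lt_one {x : Path W.adj} (hx : x ∈ Function.periodicPts Path.shift) :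
    ((x.cycleWeight W.wt : PosReal) : ℝ) < 1 :=
  weight_lt_one x (Function.minimalPeriod_pos_of_mem_periodicPts hx)

theorem cycleWeight_mem_baseSet (x : Path W.adj) : x.cycleWeight W.wt ∈ W.baseSet :=
  weight_mem_baseSet (Function.isPeriodicPt_minimalPeriod _ _)

/-- One turn around the cycle multiplies the height by the cycle weight and returns to the same
relative position. Hence the tiles with heights `c⁻¹ ^ k * y` form a chain of ancestors. -/
theorem desc_tile_of_le {x : Path W.adj} (hx : x ∈ Function.periodicPts Path.shift) (y : PosReal)
    {j k : ℕ} (h : j ≤ k) :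
    W.Desc (tile x ((x.cycleWeight W.wt)⁻¹ ^ k * y)) (tile x ((x.cycleWeight W.wt)⁻¹ ^ j * y)) := by
  have hp := Function.isPeriodicPt_minimalPeriod Path.shift x
  have h1 := desc_tile hx ((x.cycleWeight W.wt)⁻¹ ^ k * y)
    (Function.minimalPeriod Path.shift x * (k - j))
  rw [(hp.mul_const _).eq, Path.weight_mul_of_isPeriodicPt _ hp] at h1
  convert h1 using 2
  change _ = x.cycleWeight W.wt ^ (k - j) * _
  rw [← mul_assoc]
  congr 1
  obtain ⟨d, rfl⟩ := Nat.exists_eq_add_of_le h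
  rw [Nat.add_sub_cancel_left, pow_add, mul_left_comm, ← mul_pow, mul_inv_cancel, one_pow, mul_one]

theorem exists_large_pow {x : Path W.adj} (hx : x ∈ Function.periodicPts Path.shift) (y : PosReal)
    (M : ℝ) : ∃ j : ℕ, M < ((x.cycleWeight W.wt)⁻¹ ^ j * y : PosReal) := by
  have h1 : (1 : ℝ) < ((x.cycleWeight W.wt : PosReal) : ℝ)⁻¹ :=
    (one_lt_inv₀ (x.cycleWeight W.wt).2).2 (cycleWeight_lt_one hx)
  obtain ⟨j, hj⟩ := pow_unbounded_of_one_lt (M / y) h1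
  refine ⟨j, ?_⟩
  rw [div_lt_iff₀ y.2] at hj
  rw [Positive.val_mul]
  refine hj.trans_le (le_of_eq ?_)
  congr 1

/-- `0` divides every column in the fixed proportion `pos x : 1 - pos x`, with both parts positive,
so the columns exhaust the real line. -/
theorem exists_tile_covering {x : Path W.adj} (hx : x ∈ Function.periodicPts Path.shift)
    (hint : Interior x) (y : PosReal) (u M : ℝ) :
    ∃ j : ℕ, (tile x ((x.cycleWeight W.wt)⁻¹ ^ j * y)).1.x₁ < u ∧
      u < (tile x ((x.cycleWeight W.wt)⁻¹ ^ j * y)).1.x₂ ∧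
      M < (tile x ((x.cycleWeight W.wt)⁻¹ ^ j * y)).1.y₁ := by
  obtain ⟨j, hj⟩ := exists_large_pow hx y (max (|u| / pos x) (max (|u| / (1 - pos x)) M))
  rw [max_lt_iff, max_lt_iff, div_lt_iff₀ hint.1, div_lt_iff₀ (sub_pos.2 hint.2)] at hj
  refine ⟨j, ?_, ?_, hj.2.2⟩
  · simp only [tile]
    have := neg_abs_le u
    linarith
  · simp only [tile]
    have := le_abs_self u
    linarith

/-- The tiling of a periodic path. -/
def tiling (x : Path W.adj) (hx : x ∈ Function.periodicPts Path.shift) (hint : Interior x)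
    [Finite A] [Nonempty A] (y : PosReal) : ColoredTiling A where
  -- An increasing union, so any two of its tiles have a common ancestor, and disjointness reduces
  -- to that of descendants of one tile.
  tiles := {q | ∃ j : ℕ, W.Desc (tile x ((x.cycleWeight W.wt)⁻¹ ^ j * y)) q}
  disjoint := by
    rintro p ⟨j, hj⟩ q ⟨k, hk⟩ hne
    rw [Tile.disjoint_toSet_iff]
    intro hmeet
    exact hne (Desc.eq_of_meets ((desc_tile_of_le hx y (le_max_left j k)).trans hj)
      ((desc_tile_of_le hx y (le_max_right j k)).trans hk) hmeet)
  cover := by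
    ext z
    simp only [Set.mem_iUnion, exists_prop]
    constructor
    · rintro ⟨q, -, hz⟩
      rw [Tile.closure_toSet] at hz
      exact q.1.y₁_pos.trans_le hz.2.2.1
    · intro hz
      obtain ⟨j, h1, h2, h3⟩ := exists_tile_covering hx hint y z.re z.im
      obtain ⟨q, hq, hzq⟩ := exists_desc_mem_closure (W := W) _ h1.le h2.le hz
        (h3.trans (Tile.y₁_lt_y₂ _)).le
      exact ⟨q, ⟨j, hq⟩, hzq⟩

theorem height_mem_of_desc {g : A → PosReal} (hg : W.IsCompatible g) {p q : Tile × A}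
    (h : W.Desc p q) (hp : ∃ y ∈ g p.2 • (W.baseSet : Set PosReal), (y : ℝ) = p.1.y₁) :
    ∃ y ∈ g q.2 • (W.baseSet : Set PosReal), (y : ℝ) = q.1.y₁ := by
  refine h.induction (P := fun p => (∃ y ∈ g p.2 • (W.baseSet : Set PosReal), (y : ℝ) = p.1.y₁) →
    ∃ y ∈ g q.2 • (W.baseSet : Set PosReal), (y : ℝ) = q.1.y₁) id ?_ hp
  rintro p i - ih ⟨y, hy, hy'⟩
  refine ih ⟨W.τ p.2 i * y, ?_, ?_⟩
  · rw [Set.mem_smul_set_iff_inv_smul_mem, smul_eq_mul] at hy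
    rw [child_snd, hg p.2 i, Set.mem_smul_set_iff_inv_smul_mem, smul_eq_mul, mul_inv, mul_assoc,
      inv_mul_cancel_left]
    exact hy
  · rw [child_y₁, ← hy', Positive.val_mul]

/-! ### Membership in the space and stabilizer of the tiling of a periodic path. -/

section tiling

variable [Finite A] [Nonempty A] {x : Path W.adj} (hx : x ∈ Function.periodicPts Path.shift)
  (hint : Interior x) {y : PosReal}

theorem tile_mem_tiling (j : ℕ) :
    tile x ((x.cycleWeight W.wt)⁻¹ ^ j * y) ∈ (tiling x hx hint y).tiles := ⟨j, Desc.refl _⟩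

theorem tile_mem_tiling_self : tile x y ∈ (tiling x hx hint y).tiles := by
  simpa using tile_mem_tiling hx hint (y := y) 0

theorem tiling_mem_preSpace {g : A → PosReal} (hg : W.IsCompatible g)
    (hy : y ∈ g (x 0).1 • (W.baseSet : Set PosReal)) : tiling x hx hint y ∈ W.preSpace g := by
  rintro R a ⟨j, hj⟩
  refine ⟨height_mem_of_desc hg hj ⟨(x.cycleWeight W.wt)⁻¹ ^ j * y, ?_, rfl⟩, fun i => ⟨j, hj.trans (desc_child (R, a) i)⟩⟩
  change _ ∈ g (x 0).1 • (W.baseSet : Set PosReal)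
  rw [Set.mem_smul_set_iff_inv_smul_mem, smul_eq_mul, mul_left_comm]
  rw [Set.mem_smul_set_iff_inv_smul_mem, smul_eq_mul] at hy
  exact W.baseSet.mul_mem (W.baseSet.pow_mem (W.baseSet.inv_mem (cycleWeight_mem_baseSet x)) j) hy

theorem tiling_mem_space {g : A → PosReal} (hg : W.IsCompatible g)
    (hy : y ∈ g (x 0).1 • (W.baseSet : Set PosReal)) : tiling x hx hint y ∈ W.space g := by
  refine subset_closure ⟨tiling_mem_preSpace hx hint hg hy, ?_⟩
  rintro ⟨u, hu⟩
  obtain ⟨j, h1, h2, -⟩ := exists_tile_covering hx hint y u 0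
  have := hu _ (tile_mem_tiling hx hint j)
  rw [Set.eq_empty_iff_forall_notMem] at this
  set p := tile x ((x.cycleWeight W.wt)⁻¹ ^ j * y)
  have h3 := p.1.y₁_lt_y₂
  exact this ⟨u, (p.1.y₁ + p.1.y₂) / 2⟩ ⟨⟨h1, h2, by dsimp only; linarith, by dsimp only; linarith⟩, rfl⟩

theorem scale_tiling (l : PosReal) :
    (tiling x hx hint y).scale l = tiling x hx hint (l * y) := by
  refine ColoredTiling.eq_of_subset ?_
  rintro _ ⟨q, ⟨j, hj⟩, rfl⟩
  refine ⟨j, ?_⟩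
  have := hj.scale l
  rwa [tile_scale, mul_left_comm] at this

theorem tiling_cycleWeight_inv_mul :
    tiling x hx hint ((x.cycleWeight W.wt)⁻¹ * y) = tiling x hx hint y := by
  refine ColoredTiling.eq_of_subset ?_
  rintro q ⟨j, hj⟩
  exact ⟨j + 1, by rwa [pow_succ, mul_assoc]⟩

theorem exists_eq_tile_of_mem_tiling {q : Tile × A} (hq : Straddles q)
    (h : q ∈ (tiling x hx hint y).tiles) :
    ∃ j k, q = tile (Path.shift^[k] x) (x.weight W.wt k * ((x.cycleWeight W.wt)⁻¹ ^ j * y)) := by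
  obtain ⟨j, hj⟩ := h
  obtain ⟨k, hk⟩ := exists_eq_tile_of_desc hq hx hint hj
  exact ⟨j, k, hk⟩

/-- The scaled base tile straddles `0`, so it occurs on the chain as the tile of some `shift^[k] x`.
Injectivity makes `k` a period, and comparison of heights gives `l`. -/
theorem exists_zpow_of_scale_tiling_eq {l : PosReal}
    (h : (tiling x hx hint y).scale l = tiling x hx hint y) :
    ∃ n : ℤ, l = x.cycleWeight W.wt ^ n := by
  have h1 : tile x (l * y) ∈ (tiling x hx hint y).tiles := by
    rw [← h, scale_tiling]
    exact tile_mem_tiling_self hx hint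
  obtain ⟨j, k, hjk⟩ := exists_eq_tile_of_mem_tiling hx hint (straddles_tile hint _) h1
  have h2 := tile_injective hx hint (Path.mem_periodicPts_iterate hx k)
    (interior_iterate hx hint k) hjk
  obtain ⟨d, rfl⟩ := (show Function.IsPeriodicPt Path.shift k x from h2.symm).minimalPeriod_dvd
  have h3 : l * y = x.weight W.wt (Function.minimalPeriod Path.shift x * d) *
      ((x.cycleWeight W.wt)⁻¹ ^ j * y) :=
    Subtype.ext (congrArg (fun p : Tile × A => p.1.y₁) hjk)
  rw [Path.weight_mul_of_isPeriodicPt _ (Function.isPeriodicPt_minimalPeriod _ _), ← mul_assoc] at h3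
  refine ⟨d - j, ?_⟩
  rw [mul_right_cancel h3, zpow_sub, zpow_natCast, zpow_natCast, inv_pow]
  rfl

end tiling

end WeightedSubst

end NumerationSystem
end

noncomputable section

namespace NumerationSystem

namespace WeightedSubst

variable {A : Type*} {W : WeightedSubst A} {g : A → PosReal} {ω : ColoredTiling A}

/-! ### Periodic tilings without a separating line come from periodic paths -/

theorem tile_eq_of_position {p : Tile × A} {x : Path W.adj} (hcol : p.2 = (x 0).1)
    (hpos : -p.1.x₁ / p.1.y₁ = pos x) (hy₂ : p.1.y₂ * W.wt (prev x) = p.1.y₁) :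
    p = tile x ⟨p.1.y₁, p.1.y₁_pos⟩ := by
  have hy := p.1.y₁_pos.ne'
  rw [div_eq_iff hy] at hpos
  refine Prod.ext (Tile.ext ?_ ?_ rfl ?_) hcol
  · simp only [tile]; linarith
  · simp only [tile]; have := p.1.width; linarith
  · simp only [tile]; rw [eq_div_iff (wt_pos _).ne', hy₂]

section chain

variable (W) in
/-- The tiles of a tiling that contain `0` strictly inside their column. -/
abbrev Chain (ω : ColoredTiling A) : Type _ := {p : Tile × A // p ∈ ω.tiles ∧ Straddles p}

variable {l : PosReal}

/-- Scaling acts on the tiles over `0`. -/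
def Chain.scale (h : ω.scale l = ω) (p : Chain ω) : Chain ω :=
  ⟨(p.1.1.scale l, p.1.2), ColoredTiling.scale_mem_of_eq h p.2.1, straddles_scale_iff.2 p.2.2⟩

variable [Finite A] [Nonempty A]

theorem Chain.desc_scale_inv (hω : ω ∈ W.preSpace g) (hl : 1 < l) (h : ω.scale l = ω)
    (p : Chain ω) :
    W.Desc p.1 (Chain.scale (ColoredTiling.scale_inv_eq_self h) p).1 ∧
      (Chain.scale (ColoredTiling.scale_inv_eq_self h) p).1 ≠ p.1 := by
  have hl' : ((l⁻¹ : PosReal) : ℝ) < 1 := by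
    have : l⁻¹ < 1 := inv_lt_one_of_one_lt hl
    exact this
  set q := Chain.scale (ColoredTiling.scale_inv_eq_self h) p with hq
  have hy : q.1.1.y₁ = ((l⁻¹ : PosReal) : ℝ) * p.1.1.y₁ := rfl
  have hlt : q.1.1.y₁ < p.1.1.y₁ := by
    rw [hy]; exact mul_lt_of_lt_one_left p.1.1.y₁_pos hl'
  refine ⟨desc_of_below hω p.2.1 q.2.1 (q.2.2.1.trans p.2.2.2) (p.2.2.1.trans q.2.2.2)
    (hlt.trans p.1.1.y₁_lt_y₂), fun heq => ?_⟩
  rw [heq] at hlt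
  exact lt_irrefl _ hlt

theorem Chain.exists_child (hω : ω ∈ W.preSpace g) (hl : 1 < l) (h : ω.scale l = ω)
    (p : Chain ω) : ∃ i, W.child p.1 i ∈ ω.tiles ∧ Straddles (W.child p.1 i) := by
  obtain ⟨h1, h2⟩ := Chain.desc_scale_inv hω hl h p
  obtain ⟨i, hi⟩ := h1.cases.resolve_left h2
  exact ⟨i, mem_of_desc hω p.2.1 (desc_child _ _), hi.straddles (Chain.scale _ p).2.2⟩

/-- A periodic tiling with a tile over `0` is the tiling of a periodic path. -/
theorem exists_eq_tiling (hω : ω ∈ W.preSpace g) (hl : 1 < l) (h : ω.scale l = ω)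
    {p : Tile × A} (hp : p ∈ ω.tiles) (hps : Straddles p) :
    ∃ (x : Path W.adj) (hx : x ∈ Function.periodicPts Path.shift) (hint : Interior x) (y : PosReal),
      y ∈ g (x 0).1 • (W.baseSet : Set PosReal) ∧ ω = tiling x hx hint y := by
  choose f hf using fun p : Chain ω => Chain.exists_child hω hl h p
  let nxt : Chain ω → Chain ω := fun p => ⟨W.child p.1 (f p), hf p⟩
  let edge : Chain ω → W.Edge := fun p => ⟨p.1.2, f p⟩
  let sc : Chain ω → Chain ω := Chain.scale (ColoredTiling.scale_inv_eq_self h)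
  -- The straddling child is unique, so choosing it commutes with scaling about `0`.
  have hfsc : ∀ p, f (sc p) = f p := by
    intro p
    refine child_index_unique (p := (sc p).1) (hf (sc p)).2 ?_
    have := W.child_scale p.1 (f p) l⁻¹
    change Straddles (W.child (p.1.1.scale l⁻¹, p.1.2) (f p))
    rw [← this]
    exact straddles_scale_iff.2 (hf p).2
  have hesc : ∀ p, edge (sc p) = edge p := by
    intro p
    change (⟨p.1.2, f (sc p)⟩ : W.Edge) = ⟨p.1.2, f p⟩
    rw [hfsc]
  have hnsc : ∀ p, nxt (sc p) = sc (nxt p) := by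
    intro p
    apply Subtype.ext
    have := W.child_scale p.1 (f p) l⁻¹
    change W.child (p.1.1.scale l⁻¹, p.1.2) (f (sc p)) = ((W.child p.1 (f p)).1.scale l⁻¹, _)
    rw [hfsc]
    exact this.symm
  have hreach : ∀ p q : Chain ω, W.Desc p.1 q.1 → ∃ n, q = nxt^[n] p := by
    intro p q hd
    obtain ⟨p, hp⟩ := p
    refine hd.induction (P := fun p => ∀ hp : p ∈ ω.tiles ∧ Straddles p,
      ∃ n, q = nxt^[n] ⟨p, hp⟩) (fun hp => ⟨0, rfl⟩) ?_ hp
    intro p i hd ih hp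
    have hs := hd.straddles q.2.2
    obtain ⟨n, hn⟩ := ih ⟨mem_of_desc hω hp.1 (desc_child _ _), hs⟩
    have hi : i = f ⟨p, hp⟩ := child_index_unique hs (hf ⟨p, hp⟩).2
    refine ⟨n + 1, ?_⟩
    rw [hn, Function.iterate_succ_apply]
    congr 1
    exact Subtype.ext (by change W.child p i = W.child p (f ⟨p, hp⟩); rw [← hi])
  let p₀ : Chain ω := ⟨p, hp, hps⟩
  let c : ℕ → Chain ω := fun k => nxt^[k] p₀
  have hcs : ∀ k, c (k + 1) = nxt (c k) := fun k => Function.iterate_succ_apply' _ _ _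
  let x : Path W.adj := ⟨fun k => edge (c k), fun k => by
    change (c (k + 1)).1.2 = _
    rw [hcs]; rfl⟩
  obtain ⟨hd, hne⟩ := Chain.desc_scale_inv hω hl h p₀
  -- The copy of the starting tile scaled by `l⁻¹` lies `n` steps down the chain; this `n` is the
  -- period.
  obtain ⟨n, hn⟩ := hreach _ _ hd
  change sc p₀ = c n at hn
  have hn0 : 0 < n := by
    rcases Nat.eq_zero_or_pos n with rfl | hn0
    · exact absurd (congrArg Subtype.val hn) hne
    · exact hn0
  have hcn : ∀ k, c (k + n) = sc (c k) := by
    intro k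
    induction k with
    | zero => rw [zero_add, ← hn]; rfl
    | succ k ih => rw [hcs k, ← hnsc, ← ih, ← hcs]; congr 1; omega
  have hper : Function.IsPeriodicPt Path.shift n x := by
    refine Path.ext fun k => ?_
    rw [Path.iterate_shift_apply]
    change edge (c (k + n)) = edge (c k)
    rw [hcn, hesc]
  have hx : x ∈ Function.periodicPts Path.shift := ⟨n, hn0, hper⟩
  have hy1 : ∀ k, (c k).1.1.y₁ = ((x.weight W.wt k : PosReal) : ℝ) * p.1.y₁ := by
    intro k
    induction k with
    | zero => simp [c, p₀]
    | succ k ih =>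
      rw [hcs, Path.weight_succ', Positive.val_mul]
      change W.wt (x k) * (c k).1.1.y₁ = _
      rw [ih]; ring
  have hscy : (c n).1.1.y₁ = ((l⁻¹ : PosReal) : ℝ) * p.1.y₁ := by rw [← hn]; rfl
  have hWn : x.weight W.wt n = l⁻¹ := by
    have := hy1 n
    rw [hscy] at this
    exact Subtype.ext (mul_right_cancel₀ p.1.y₁_pos.ne' this).symm
  -- positions
  let θ : Chain ω → ℝ := fun p => -p.1.1.x₁ / p.1.1.y₁
  have hθ : ∀ k, θ (c k) = W.eoff (x k) + W.wt (x k) * θ (c (k + 1)) := by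
    intro k
    have h1 : (c (k + 1)).1.1.x₁ = (c k).1.1.x₁ + (c k).1.1.y₁ * W.eoff (x k) := by
      rw [hcs]; exact W.child_x₁ (c k).1 (f (c k))
    have h2 : (c (k + 1)).1.1.y₁ = W.wt (x k) * (c k).1.1.y₁ := by rw [hcs]; rfl
    have h3 := (c k).1.1.y₁_pos.ne'
    have h4 := (wt_pos (x k)).ne'
    simp only [θ]
    rw [h1, h2]
    field_simp
    ring
  -- The actual position and `pos` obey the same recursion, so their difference is multiplied by the
  -- weight. After a full period both return to their initial values, and a weight below `1` forces
  -- the difference to vanish.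
  have hdiff : ∀ k, θ (c 0) - pos x =
      ((x.weight W.wt k : PosReal) : ℝ) * (θ (c k) - pos (Path.shift^[k] x)) := by
    intro k
    induction k with
    | zero => simp
    | succ k ih =>
      rw [ih, hθ, pos_eq, Path.weight_succ', Positive.val_mul, Function.iterate_succ_apply',
        show (Path.shift^[k] x) 0 = x k by simp]
      ring
  have hθn : θ (c n) = θ (c 0) := by
    rw [← hn]
    change -(((l⁻¹ : PosReal) : ℝ) * p.1.x₁) / (((l⁻¹ : PosReal) : ℝ) * p.1.y₁) = -p.1.x₁ / p.1.y₁
    rw [← mul_neg, mul_div_mul_left _ _ (l⁻¹).2.ne']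
  have hposx : -p.1.x₁ / p.1.y₁ = pos x := by
    have h1 := hdiff n
    rw [hθn, hper.eq] at h1
    have h2 := weight_lt_one x hn0
    have h3 : (1 - ((x.weight W.wt n : PosReal) : ℝ)) * (θ (c 0) - pos x) = 0 := by linarith
    exact sub_eq_zero.1 ((mul_eq_zero.1 h3).resolve_left (by linarith))
  have hprev : prev x = x (n - 1) := by
    obtain ⟨d, rfl⟩ := hper.minimalPeriod_dvd
    obtain ⟨d, rfl⟩ := Nat.exists_eq_succ_of_ne_zero (Nat.pos_of_mul_pos_left hn0).ne'
    have hm := Function.minimalPeriod_pos_of_mem_periodicPts hx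
    have h1 := ((Function.isPeriodicPt_minimalPeriod Path.shift x).mul_const d).eq
    have h2 := congrArg (fun z : Path W.adj => z (Function.minimalPeriod Path.shift x - 1)) h1
    simp only [Path.iterate_shift_apply] at h2
    rw [prev, ← h2]
    congr 1
    rw [Nat.succ_eq_add_one, Nat.mul_succ]
    omega
  have hy2 : p.1.y₂ * W.wt (prev x) = p.1.y₁ := by
    have h1 : (c n).1.1.y₂ = (c (n - 1)).1.1.y₁ := by
      conv_lhs => rw [← Nat.sub_add_cancel hn0, hcs]
      rfl
    have h2 : (c n).1.1.y₁ = W.wt (x (n - 1)) * (c (n - 1)).1.1.y₁ := by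
      conv_lhs => rw [← Nat.sub_add_cancel hn0, hcs]
      rfl
    have h3 : (c n).1.1.y₂ = ((l⁻¹ : PosReal) : ℝ) * p.1.y₂ := by rw [← hn]; rfl
    rw [h3] at h1
    rw [hscy, ← h1] at h2
    rw [hprev]
    have := (l⁻¹).2.ne'
    apply mul_left_cancel₀ this
    linarith
  have hptile : p = tile x ⟨p.1.y₁, p.1.y₁_pos⟩ := tile_eq_of_position rfl hposx hy2
  have hint : Interior x := by
    rw [Interior, ← hposx, lt_div_iff₀ p.1.y₁_pos, div_lt_iff₀ p.1.y₁_pos]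
    have h1 := hps.1
    have h2 := hps.2
    have h3 := p.1.width
    constructor <;> linarith
  refine ⟨x, hx, hint, ⟨p.1.y₁, p.1.y₁_pos⟩, ?_, (ColoredTiling.eq_of_subset ?_).symm⟩
  · obtain ⟨y, hy, hy'⟩ := (hω p.1 p.2 hp).1
    rw [show (⟨p.1.y₁, p.1.y₁_pos⟩ : PosReal) = y from Subtype.ext hy'.symm]
    exact hy
  · rintro q ⟨j, hj⟩
    refine mem_of_desc hω ?_ hj
    obtain ⟨d, rfl⟩ := hper.minimalPeriod_dvd
    have hd0 : 0 < d := Nat.pos_of_mul_pos_left hn0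
    -- `l` is the `d`-th power of the inverse cycle weight, so the tile of index `d * j` is the
    -- image of `p` under `l ^ j`, and it is an ancestor of the tile of index `j`.
    refine mem_of_desc hω ?_ (desc_tile_of_le hx _ (Nat.le_mul_of_pos_left j hd0))
    have h1 : (x.cycleWeight W.wt)⁻¹ ^ (d * j) = l ^ j := by
      rw [Path.weight_mul_of_isPeriodicPt _ (Function.isPeriodicPt_minimalPeriod _ _)] at hWn
      rw [pow_mul, inv_pow]
      change ((x.weight W.wt (Function.minimalPeriod Path.shift x) ^ d)⁻¹) ^ j = _
      rw [hWn, inv_inv]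
    rw [h1, ← tile_scale, ← hptile]
    have h2 := ColoredTiling.scale_zpow_eq_self h j
    rw [zpow_natCast] at h2
    exact ColoredTiling.scale_mem_of_eq h2 hp

end chain

/-! ### The closed orbit of a periodic path -/

variable (W) in
/-- The orbit of a tiling under the base set. -/
def orbitOf (ω : ColoredTiling A) : Set (ColoredTiling A) := {ω' | ∃ l ∈ W.baseSet, ω' = ω.scale l}

theorem orbitOf_scale {l : PosReal} (hl : l ∈ W.baseSet) (ω : ColoredTiling A) :
    W.orbitOf (ω.scale l) = W.orbitOf ω := by
  ext ω'
  constructor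
  · rintro ⟨m, hm, rfl⟩
    exact ⟨m * l, W.baseSet.mul_mem hm hl, ColoredTiling.scale_scale _ _ _⟩
  · rintro ⟨m, hm, rfl⟩
    refine ⟨m * l⁻¹, W.baseSet.mul_mem hm (W.baseSet.inv_mem hl), ?_⟩
    rw [ColoredTiling.scale_scale, inv_mul_cancel_right]

theorem mem_orbitOf_self (ω : ColoredTiling A) : ω ∈ W.orbitOf ω :=
  ⟨1, W.baseSet.one_mem, by simp⟩

theorem mem_smul_self (g : A → PosReal) (a : A) : g a ∈ g a • (W.baseSet : Set PosReal) := by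
  rw [Set.mem_smul_set_iff_inv_smul_mem, smul_eq_mul, inv_mul_cancel]
  exact W.baseSet.one_mem

theorem one_lt_cycleWeight_inv (x : Path.Periodic W.adj) : 1 < (x.1.cycleWeight W.wt)⁻¹ :=
  one_lt_inv'.2 (cycleWeight_lt_one x.2)

variable [Finite A] [Nonempty A]

variable (W) in
/-- The periodic paths whose point is in the interior. -/
abbrev InteriorPeriodic : Type _ := {x : Path.Periodic W.adj // Interior x.1}

/-- The standard tiling of a periodic path. -/
def stdTiling (g : A → PosReal) (x : InteriorPeriodic W) : ColoredTiling A :=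
  tiling x.1.1 x.1.2 x.2 (g (x.1.1 0).1)

theorem tiling_mem_orbitOf (x : InteriorPeriodic W) {y : PosReal}
    (hy : y ∈ g (x.1.1 0).1 • (W.baseSet : Set PosReal)) :
    W.orbitOf (tiling x.1.1 x.1.2 x.2 y) = W.orbitOf (stdTiling g x) := by
  obtain ⟨l, hl, rfl⟩ := hy
  rw [← orbitOf_scale hl (stdTiling g x), stdTiling, scale_tiling, mul_comm]
  rfl

/-- In one orbit, a base tile of `x'` is a straddling tile in a rescaled tiling of `x`, so it comes
from an iterate of `x`. Conversely, `x` and its iterate give the same tiling at corresponding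
heights, and by compatibility these differ from the standard heights by an element of `G`. -/
theorem orbitOf_stdTiling_eq_iff (hg : W.IsCompatible g) (x x' : InteriorPeriodic W) :
    W.orbitOf (stdTiling g x) = W.orbitOf (stdTiling g x') ↔
      ∃ k, Path.shift^[k] x.1.1 = x'.1.1 := by
  constructor
  · intro h
    have h1 : stdTiling g x' ∈ W.orbitOf (stdTiling g x) := h ▸ mem_orbitOf_self _
    obtain ⟨l, hl, hx'⟩ := h1
    have h2 : tile x'.1.1 (g (x'.1.1 0).1) ∈ (stdTiling g x').tiles :=
      tile_mem_tiling_self x'.1.2 x'.2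
    rw [hx', stdTiling, scale_tiling] at h2
    obtain ⟨j, k, hjk⟩ := exists_eq_tile_of_mem_tiling _ _ (straddles_tile x'.2 _) h2
    exact ⟨k, (tile_injective x'.1.2 x'.2 (Path.mem_periodicPts_iterate x.1.2 k)
      (interior_iterate x.1.2 x.2 k) hjk).symm⟩
  · rintro ⟨k, hk⟩
    obtain ⟨⟨x', hx'⟩, hint'⟩ := x'
    dsimp only at hk
    subst hk
    set y := x.1.1.weight W.wt k * g (x.1.1 0).1 with hy
    have hsub : tiling (Path.shift^[k] x.1.1) hx' hint' y = stdTiling g x := by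
      refine ColoredTiling.eq_of_subset ?_
      rintro q ⟨j, hj⟩
      refine ⟨j, Desc.trans ?_ hj⟩
      rw [Path.cycleWeight_iterate _ x.1.2]
      have := desc_tile x.1.2 ((x.1.1.cycleWeight W.wt)⁻¹ ^ j * g (x.1.1 0).1) k
      rwa [mul_left_comm] at this
    have hmem : y ∈ g ((Path.shift^[k] x.1.1) 0).1 • (W.baseSet : Set PosReal) := by
      obtain ⟨z, hz, hz'⟩ := height_mem_of_desc hg (desc_tile x.1.2 (g (x.1.1 0).1) k)
        ⟨_, mem_smul_self g _, rfl⟩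
      rw [show y = z from Subtype.ext hz'.symm]
      exact hz
    rw [← hsub]
    exact tiling_mem_orbitOf ⟨⟨Path.shift^[k] x.1.1, hx'⟩, hint'⟩ hmem

theorem scale_cycleWeight_inv_stdTiling (g : A → PosReal) (x : InteriorPeriodic W) :
    (stdTiling g x).scale (x.1.1.cycleWeight W.wt)⁻¹ = stdTiling g x := by
  rw [stdTiling, scale_tiling, tiling_cycleWeight_inv_mul]

theorem orbitOf_stdTiling_mem (hg : W.IsCompatible g) (x : InteriorPeriodic W) :
    W.orbitOf (stdTiling g x) ∈ W.closedOrbits g :=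
  ⟨_, tiling_mem_space x.1.2 x.2 hg (mem_smul_self g _),
    ⟨_, W.baseSet.inv_mem (cycleWeight_mem_baseSet x.1.1), one_lt_cycleWeight_inv x.1,
      scale_cycleWeight_inv_stdTiling g x⟩, rfl⟩

theorem cycle_orbitOf_stdTiling (g : A → PosReal) (x : InteriorPeriodic W) :
    W.cycle (W.orbitOf (stdTiling g x)) = ((x.1.1.cycleWeight W.wt : PosReal) : ℝ)⁻¹ := by
  refine IsLeast.csInf_eq ⟨⟨(x.1.1.cycleWeight W.wt)⁻¹,
    W.baseSet.inv_mem (cycleWeight_mem_baseSet x.1.1), rfl, one_lt_cycleWeight_inv x.1, ?_⟩, ?_⟩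
  · rintro _ ⟨l, hl, rfl⟩
    rw [ColoredTiling.scale_scale, mul_comm, ← ColoredTiling.scale_scale,
      scale_cycleWeight_inv_stdTiling]
  · rintro _ ⟨l, hl, rfl, hl1, hl2⟩
    obtain ⟨n, rfl⟩ := exists_zpow_of_scale_tiling_eq x.1.2 x.2 (hl2 _ (mem_orbitOf_self _))
    have h1 := one_lt_cycleWeight_inv x.1
    set W₀ := x.1.1.cycleWeight W.wt
    change W₀⁻¹ ≤ W₀ ^ n
    obtain ⟨k, rfl | rfl⟩ := n.eq_nat_or_neg
    · rw [zpow_natCast] at hl1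
      exact absurd hl1 (not_lt.2 (pow_le_one' (show W₀ < 1 from cycleWeight_lt_one x.1.2).le k))
    · rw [zpow_neg, zpow_natCast, ← inv_pow] at hl1 ⊢
      rcases k with _ | k
      · simp at hl1
      · rw [pow_succ]
        exact le_mul_of_one_le_left' (one_le_pow_of_one_le' h1.le k)

end WeightedSubst

end NumerationSystem
end

noncomputable section

namespace NumerationSystem

namespace WeightedSubst

variable {A : Type*} (W : WeightedSubst A)

/-! ### Extremal descendants -/

section extremal

variable (ι : ∀ a, Fin (W.len a))

/-- The letter at a prescribed position of the word of a letter. -/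
def nextLetter (a : A) : A := W.σ a (ι a)

/-- The weight of the chain of `n` successive children at prescribed positions. -/
def chainWeight : ℕ → A → PosReal
  | 0, _ => 1
  | n + 1, a => W.τ a (ι a) * chainWeight n (W.nextLetter ι a)

theorem chainWeight_add (m n : ℕ) (a : A) : W.chainWeight ι (m + n) a =
    W.chainWeight ι m a * W.chainWeight ι n ((W.nextLetter ι)^[m] a) := by
  induction m generalizing a with
  | zero => simp [chainWeight]
  | succ m ih =>
    rw [Nat.succ_add, chainWeight, ih, chainWeight, mul_assoc, Function.iterate_succ_apply]

theorem chainWeight_mul {n : ℕ} {a : A} (h : Function.IsPeriodicPt (W.nextLetter ι) n a) (k : ℕ) :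
    W.chainWeight ι (n * k) a = W.chainWeight ι n a ^ k := by
  induction k with
  | zero => rfl
  | succ k ih => rw [Nat.mul_succ, chainWeight_add, ih, (h.mul_const k).eq, pow_succ]

theorem chainWeight_lt_one {n : ℕ} (hn : 0 < n) (a : A) : W.chainWeight ι n a < 1 := by
  have hle : ∀ n a, W.chainWeight ι n a ≤ 1 := by
    intro n
    induction n with
    | zero => exact fun _ => le_rfl
    | succ n ih =>
      exact fun a => mul_le_one' (show W.τ a (ι a) ≤ 1 from (W.τ_lt_one a _).le) (ih _)
  obtain ⟨n, rfl⟩ := Nat.exists_eq_succ_of_ne_zero hn.ne'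
  exact mul_lt_one_of_lt_of_le (show W.τ a (ι a) < 1 from W.τ_lt_one a _) (hle n _)

/-- The weights of the chains that end at a periodic letter `a` take finitely many values modulo
the weight of a cycle at `a`. -/
theorem exists_finite_chainWeight [Finite A] {n : ℕ} {a : A}
    (h : Function.IsPeriodicPt (W.nextLetter ι) n a) (hn : 0 < n) :
    ∃ F : Set PosReal, F.Finite ∧ ∀ c k, (W.nextLetter ι)^[k] c = a →
      ∃ f ∈ F, ∃ j : ℕ, W.chainWeight ι k c = f * W.chainWeight ι n a ^ j := by
  have key : ∀ c, ∃ F : Set PosReal, F.Finite ∧ ∀ k, (W.nextLetter ι)^[k] c = a →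
      ∃ f ∈ F, ∃ j : ℕ, W.chainWeight ι k c = f * W.chainWeight ι n a ^ j := by
    intro c
    by_cases hex : ∃ k, (W.nextLetter ι)^[k] c = a
    · obtain ⟨k₀, hk₀⟩ := hex
      -- A longer chain passes through `a` at time `k₀`, so removing one turn of length `n` removes
      -- one factor of the cycle weight.
      refine ⟨(fun k => W.chainWeight ι k c) '' Set.Iio (k₀ + n), (Set.finite_Iio _).image _, ?_⟩
      intro k
      induction k using Nat.strong_induction_on with
      | _ k ih =>
        intro hk
        by_cases hlt : k < k₀ + n
        · exact ⟨_, ⟨k, hlt, rfl⟩, 0, by simp⟩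
        · obtain ⟨d, rfl⟩ := Nat.exists_eq_add_of_le (not_lt.1 hlt)
          have h1 : (W.nextLetter ι)^[k₀ + d] c = a := by
            rw [add_comm, Function.iterate_add_apply, hk₀]
            rw [add_comm (k₀ + n) d, ← add_assoc, add_right_comm, Function.iterate_add_apply,
              hk₀, Function.iterate_add_apply, h.eq] at hk
            exact hk
          obtain ⟨f, hf, j, hj⟩ := ih (k₀ + d) (by omega) h1
          refine ⟨f, hf, j + 1, ?_⟩
          rw [add_right_comm, chainWeight_add, h1, hj, pow_succ, mul_assoc]
    · exact ⟨∅, Set.finite_empty, fun k hk => absurd ⟨k, hk⟩ hex⟩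
  choose F hF hF' using key
  refine ⟨⋃ c, F c, Set.finite_iUnion hF, fun c k hk => ?_⟩
  obtain ⟨f, hf, j, hj⟩ := hF' c k hk
  exact ⟨f, Set.mem_iUnion.2 ⟨c, hf⟩, j, hj⟩

end extremal

/-- The extremal position on a given side: the last one for `true`, the first one for `false`. -/
def extremal (s : Bool) (a : A) : Fin (W.len a) := if s then W.last a else W.first a

/-- The coordinate of the vertical side of a tile: the right one for `true`, the left one for
`false`. -/
def sideX (s : Bool) (p : Tile × A) : ℝ := if s then p.1.x₂ else p.1.x₁

theorem sideX_child_extremal (s : Bool) (p : Tile × A) :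
    sideX s (W.child p (W.extremal s p.2)) = sideX s p := by
  cases s
  · change (W.child p (W.first p.2)).1.x₁ = p.1.x₁
    rw [child_x₁, off_first, mul_zero, add_zero]
  · change (W.child p (W.last p.2)).1.x₂ = p.1.x₂
    rw [child_x₂, off_last, mul_one, ← p.1.width, add_sub_cancel]

variable {W}

theorem eq_extremal_of_sideX_eq {s : Bool} {p : Tile × A} {i : Fin (W.len p.2)}
    (h : sideX s (W.child p i) = sideX s p) : i = W.extremal s p.2 := by
  have hy := p.1.y₁_pos
  cases s
  · change (W.child p i).1.x₁ = p.1.x₁ at h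
    rw [child_x₁] at h
    have h1 : p.1.y₁ * W.off p.2 i = 0 := by linarith
    exact W.eq_first_of_off_le ((mul_eq_zero.1 h1).resolve_left hy.ne').le
  · change (W.child p i).1.x₂ = p.1.x₂ at h
    rw [child_x₂] at h
    have h1 : p.1.y₁ * (W.off p.2 i + W.τ p.2 i) = p.1.y₁ * 1 := by
      have := p.1.width; linarith
    exact W.eq_last_of_one_le (mul_left_cancel₀ hy.ne' h1).ge

/-- Columns are nested, so a descendant that shares a vertical side with `p` is reached through the
extremal child at each step. -/
theorem Desc.exists_chain {s : Bool} {p q : Tile × A} (h : W.Desc p q)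
    (hs : sideX s p = sideX s q) :
    ∃ n, q.2 = (W.nextLetter (W.extremal s))^[n] p.2 ∧
      q.1.y₁ = W.chainWeight (W.extremal s) n p.2 * p.1.y₁ := by
  refine h.induction (P := fun p => sideX s p = sideX s q →
    ∃ n, q.2 = (W.nextLetter (W.extremal s))^[n] p.2 ∧
      q.1.y₁ = W.chainWeight (W.extremal s) n p.2 * p.1.y₁) (fun _ => ⟨0, rfl, by simp [chainWeight]⟩)
    ?_ hs
  intro p i hd ih hp
  have h1 : sideX s (W.child p i) = sideX s q := by
    have h2 := W.x₁_le_child_x₁ p i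
    have h3 := W.child_x₂_le_x₂ p i
    have h4 := hd.x₁_le
    have h5 := hd.x₂_le
    cases s <;> simp only [sideX, if_true, Bool.false_eq_true, if_false] at hp ⊢ <;> linarith
  obtain rfl := eq_extremal_of_sideX_eq (h1.trans hp.symm)
  obtain ⟨n, hn, hn'⟩ := ih h1
  refine ⟨n + 1, by rw [hn, Function.iterate_succ_apply]; rfl, ?_⟩
  rw [hn', child_y₁, chainWeight, Positive.val_mul]
  change _ = (W.τ p.2 _ : ℝ) * (W.chainWeight _ n (W.σ p.2 _) : ℝ) * _
  rw [child_snd]; ring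

/-! ### Tilings near the vertical line through `0` -/

/-- The tiling has a tile of color `a` and height `y` that abuts on the line through `0` on the
given side. -/
def Abuts (s : Bool) (ω : ColoredTiling A) (a : A) (y : PosReal) : Prop :=
  ∃ R, (R, a) ∈ ω.tiles ∧ R.y₁ = y ∧ sideX s (R, a) = 0

variable {g : A → PosReal} {ω ω' : ColoredTiling A} {s : Bool} {a b : A} {y z l : PosReal}

theorem Abuts.chain (hω : ω ∈ W.preSpace g) (h : Abuts s ω a y) (n : ℕ) :
    Abuts s ω ((W.nextLetter (W.extremal s))^[n] a) (W.chainWeight (W.extremal s) n a * y) := by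
  induction n generalizing a y with
  | zero => simpa [chainWeight] using h
  | succ n ih =>
    obtain ⟨R, hR, hy, hs⟩ := h
    have h1 : Abuts s ω (W.nextLetter (W.extremal s) a) (W.τ a (W.extremal s a) * y) := by
      refine ⟨(W.child (R, a) (W.extremal s a)).1, (hω _ _ hR).2 _, ?_,
        (W.sideX_child_extremal s (R, a)).trans hs⟩
      rw [child_y₁, Positive.val_mul, ← hy]
    have h2 := ih h1
    rw [chainWeight, mul_comm (W.τ a _), mul_assoc]
    exact h2

theorem Abuts.scale (hl : ω.scale l = ω) (h : Abuts s ω a y) : Abuts s ω a (l * y) := by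
  obtain ⟨R, hR, hy, hs⟩ := h
  refine ⟨R.scale l, ColoredTiling.scale_mem_of_eq hl hR, by rw [Positive.val_mul, ← hy]; rfl, ?_⟩
  cases s <;> simp only [sideX, if_true, Bool.false_eq_true, if_false, Tile.scale] at hs ⊢ <;>
    rw [hs, mul_zero]

theorem Abuts.of_scale (h : Abuts s ω a y) : Abuts s (ω.scale l) a (l * y) := by
  obtain ⟨R, hR, hy, hs⟩ := h
  refine ⟨R.scale l, ColoredTiling.scale_mem_scale hR, by rw [Positive.val_mul, ← hy]; rfl, ?_⟩
  cases s <;> simp only [sideX, if_true, Bool.false_eq_true, if_false, Tile.scale] at hs ⊢ <;>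
    rw [hs, mul_zero]

theorem Abuts.mem (hω : ω ∈ W.preSpace g) (h : Abuts s ω a y) :
    y ∈ g a • (W.baseSet : Set PosReal) := by
  obtain ⟨R, hR, hy, -⟩ := h
  obtain ⟨t, ht, hty⟩ := (hω _ _ hR).1
  rwa [show y = t from Subtype.ext (hy.symm.trans hty.symm)]

/-- The top of a tile has no influence on its children; this is what lets a color and a height
determine everything below. -/
theorem child_congr {R R' : Tile} (h₁ : R.x₁ = R'.x₁) (hy : R.y₁ = R'.y₁) (i : Fin (W.len a)) :
    W.child (R, a) i = W.child (R', a) i := by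
  refine Prod.ext (Tile.ext ?_ ?_ ?_ ?_) rfl
  · rw [child_x₁, child_x₁]; simp only [h₁, hy]
  · rw [child_x₂, child_x₂]; simp only [h₁, hy]
  · rw [child_y₁, child_y₁]; simp only [hy]
  · exact hy

variable [Finite A] [Nonempty A]

theorem coe_inv_lt_one (hl : 1 < l) : ((l⁻¹ : PosReal) : ℝ) < 1 := by
  have : l⁻¹ < 1 := inv_lt_one_of_one_lt hl
  exact this

/-- The copy scaled by `l⁻¹` is a descendant with the same side on the line, so the chain of
extremal children returns to the color `a` with total weight `l⁻¹`. -/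
theorem Abuts.exists_period (hω : ω ∈ W.preSpace g) (hl : 1 < l) (hlω : ω.scale l = ω)
    (h : Abuts s ω a y) : ∃ n, 0 < n ∧ Function.IsPeriodicPt (W.nextLetter (W.extremal s)) n a ∧
      W.chainWeight (W.extremal s) n a = l⁻¹ := by
  obtain ⟨R, hR, hy, hs⟩ := h
  have hR' := ColoredTiling.scale_mem_of_eq (ColoredTiling.scale_inv_eq_self hlω) hR
  have hl' := coe_inv_lt_one hl
  have hl0 := (l⁻¹).2
  have hx := R.x₁_lt_x₂
  have hs' : sideX s (R.scale l⁻¹, a) = 0 := by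
    cases s <;> simp only [sideX, if_true, Bool.false_eq_true, if_false, Tile.scale] at hs ⊢ <;>
      rw [hs, mul_zero]
  have hd : W.Desc (R, a) (R.scale l⁻¹, a) := by
    refine desc_of_below hω hR hR' ?_ ?_ ?_
    · have := (R.scale l⁻¹).x₁_lt_x₂
      cases s <;> simp only [sideX, if_true, Bool.false_eq_true, if_false] at hs hs' ⊢ <;> linarith
    · have := (R.scale l⁻¹).x₁_lt_x₂
      cases s <;> simp only [sideX, if_true, Bool.false_eq_true, if_false] at hs hs' ⊢ <;> linarith
    · exact (mul_lt_of_lt_one_left R.y₁_pos hl').trans R.y₁_lt_y₂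
  obtain ⟨n, hn, hn'⟩ := hd.exists_chain (hs.trans hs'.symm)
  have h1 : W.chainWeight (W.extremal s) n a = l⁻¹ := by
    refine Subtype.ext (mul_right_cancel₀ R.y₁_pos.ne' ?_)
    exact hn'.symm
  refine ⟨n, Nat.pos_of_ne_zero ?_, hn.symm, h1⟩
  rintro rfl
  rw [← h1] at hl'
  exact lt_irrefl _ hl'

/-- If no tile straddles the line through `0`, there are tiles abutting on it from both sides. -/
theorem exists_abuts (hω : ω ∈ W.preSpace g) (hl : 1 < l) (hlω : ω.scale l = ω)
    (hns : ∀ p ∈ ω.tiles, ¬ Straddles p) (s : Bool) : ∃ a y, Abuts s ω a y := by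
  have hl' := coe_inv_lt_one hl
  have hl0 := (l⁻¹).2
  have hl1 : (1 : ℝ) < l := hl
  have hinv : ∀ u : ℝ, ((l⁻¹ : PosReal) : ℝ) * (l * u) = u := by
    intro u
    change ((l : ℝ)⁻¹) * (l * u) = u
    rw [inv_mul_cancel_left₀ l.2.ne']
  have hsc : ∀ p ∈ ω.tiles, (p.1.scale l⁻¹, p.2) ∈ ω.tiles := fun p hp =>
    ColoredTiling.scale_mem_of_eq (ColoredTiling.scale_inv_eq_self hlω) hp
  cases s
  · obtain ⟨q, hq, hz⟩ := ω.exists_mem_closure (z := ⟨1, 1⟩) one_pos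
    rw [Tile.closure_toSet] at hz
    obtain ⟨h1, h2, -, -⟩ := hz
    dsimp only at h1 h2
    -- This width gives `l * p.1.x₁ < p.1.x₂`, so the copy of `p` scaled by `l⁻¹` meets its column
    -- and descends from `p`. If `p.1.x₁ > 0`, that copy would stick out on the left.
    obtain ⟨p, hp, hd, hM⟩ := exists_large_ancestor hω hq ((l - 1) * q.1.x₁ + 1)
    have h3 := hd.x₁_le
    have h4 := hd.x₂_le
    have h5 : 0 ≤ p.1.x₁ := by
      by_contra hneg
      exact hns p hp ⟨not_le.1 hneg, by linarith⟩
    refine ⟨p.2, ⟨p.1.y₁, p.1.y₁_pos⟩, p.1, hp, rfl, ?_⟩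
    change p.1.x₁ = 0
    by_contra hne
    have h6 : 0 < p.1.x₁ := lt_of_le_of_ne h5 (Ne.symm hne)
    have hw := p.1.width
    have h7 : l * p.1.x₁ < p.1.x₂ := by
      have : (l - 1) * p.1.x₁ ≤ (l - 1) * q.1.x₁ :=
        mul_le_mul_of_nonneg_left h3 (by linarith)
      linarith
    have hd' := desc_of_below hω hp (hsc p hp)
      (show ((l⁻¹ : PosReal) : ℝ) * p.1.x₁ < p.1.x₂ by
        have := mul_lt_of_lt_one_left h6 hl'
        have := p.1.x₁_lt_x₂
        linarith)
      (show p.1.x₁ < ((l⁻¹ : PosReal) : ℝ) * p.1.x₂ by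
        have := mul_lt_mul_of_pos_left h7 hl0
        rwa [hinv] at this)
      ((mul_lt_of_lt_one_left p.1.y₁_pos hl').trans p.1.y₁_lt_y₂)
    have h8 : p.1.x₁ ≤ ((l⁻¹ : PosReal) : ℝ) * p.1.x₁ := hd'.x₁_le
    have := mul_lt_of_lt_one_left h6 hl'
    linarith
  · obtain ⟨q, hq, hz⟩ := ω.exists_mem_closure (z := ⟨-1, 1⟩) one_pos
    rw [Tile.closure_toSet] at hz
    obtain ⟨h1, h2, -, -⟩ := hz
    dsimp only at h1 h2
    obtain ⟨p, hp, hd, hM⟩ := exists_large_ancestor hω hq ((l - 1) * (-q.1.x₂) + 1)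
    have h3 := hd.x₁_le
    have h4 := hd.x₂_le
    have h5 : p.1.x₂ ≤ 0 := by
      by_contra hneg
      exact hns p hp ⟨by linarith, not_le.1 hneg⟩
    refine ⟨p.2, ⟨p.1.y₁, p.1.y₁_pos⟩, p.1, hp, rfl, ?_⟩
    change p.1.x₂ = 0
    by_contra hne
    have h6 : 0 < -p.1.x₂ := neg_pos.2 (lt_of_le_of_ne h5 hne)
    have hw := p.1.width
    have h7 : p.1.x₁ < l * p.1.x₂ := by
      have : (l - 1) * (-p.1.x₂) ≤ (l - 1) * (-q.1.x₂) :=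
        mul_le_mul_of_nonneg_left (neg_le_neg h4) (by linarith)
      linarith
    have h9 := mul_lt_of_lt_one_left h6 hl'
    have hd' := desc_of_below hω hp (hsc p hp)
      (show ((l⁻¹ : PosReal) : ℝ) * p.1.x₁ < p.1.x₂ by
        have := mul_lt_mul_of_pos_left h7 hl0
        rwa [hinv] at this)
      (show p.1.x₁ < ((l⁻¹ : PosReal) : ℝ) * p.1.x₂ by
        have := p.1.x₁_lt_x₂
        linarith)
      ((mul_lt_of_lt_one_left p.1.y₁_pos hl').trans p.1.y₁_lt_y₂)
    have h8 : ((l⁻¹ : PosReal) : ℝ) * p.1.x₂ ≤ p.1.x₂ := hd'.x₂_le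
    linarith

/-- Two tilings that are invariant under the same scaling and have a common abutting tile agree on
the side of that tile. -/
theorem exists_common_tile (hω : ω ∈ W.preSpace g) (hω' : ω' ∈ W.preSpace g) (hl : 1 < l)
    (hlω : ω.scale l = ω) (hlω' : ω'.scale l = ω') (h : Abuts s ω a y) (h' : Abuts s ω' a y)
    {z : ℂ} (hz : 0 < z.im) (hzs : if s then z.re < 0 else 0 < z.re) :
    ∃ d ∈ ω.tiles, d ∈ ω'.tiles ∧ z ∈ closure d.1.toSet := by
  have hl1 : (1 : ℝ) < l := hl
  -- Scale the common tile until its column contains `z` and its bottom lies above `z`; below the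
  -- bottom both tilings consist of the same descendants.
  obtain ⟨n, hn⟩ := pow_unbounded_of_one_lt (max (|z.re|) z.im / y) hl1
  rw [div_lt_iff₀ y.2, max_lt_iff] at hn
  have hpow : ∀ {ω : ColoredTiling A}, ω.scale l = ω → ω.scale (l ^ n) = ω := by
    intro ω hω
    have := ColoredTiling.scale_zpow_eq_self hω n
    rwa [zpow_natCast] at this
  obtain ⟨R, hR, hRy, hRs⟩ := h.scale (hpow hlω)
  obtain ⟨R', hR', hRy', hRs'⟩ := h'.scale (hpow hlω')
  have hy : ((l ^ n * y : PosReal) : ℝ) = (l : ℝ) ^ n * y := rfl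
  rw [hy] at hRy hRy'
  have hw := R.width
  have hw' := R'.width
  have hx₁ : R.x₁ = R'.x₁ := by
    cases s <;> simp only [sideX, if_true, Bool.false_eq_true, if_false] at hRs hRs' <;> linarith
  have h1 := neg_abs_le z.re
  have h2 := le_abs_self z.re
  have hcol : R.x₁ ≤ z.re ∧ z.re ≤ R.x₂ := by
    cases s <;> simp only [sideX, if_true, Bool.false_eq_true, if_false] at hRs hzs <;>
      constructor <;> linarith
  have hR12 := R.y₁_lt_y₂
  obtain ⟨d, hd, hzd⟩ := exists_desc_mem_closure (W := W) (R, a) hcol.1 hcol.2 hz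
    (show z.im ≤ R.y₂ by linarith)
  refine ⟨d, mem_of_desc hω hR hd, ?_, hzd⟩
  rcases hd.cases with rfl | ⟨i, hi⟩
  · rw [Tile.closure_toSet] at hzd
    have : R.y₁ ≤ z.im := hzd.2.2.1
    linarith
  · rw [child_congr hx₁ (hRy.trans hRy'.symm)] at hi
    exact mem_of_desc hω' ((hω' _ _ hR').2 i) hi

/-- A periodic tiling for which the line through `0` is separating is determined by one abutting
tile on each side. -/
theorem eq_of_abuts (hω : ω ∈ W.preSpace g) (hω' : ω' ∈ W.preSpace g) {l l' : PosReal} (hl : 1 < l)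
    (hl' : 1 < l') (hlω : ω.scale l = ω) (hlω' : ω'.scale l' = ω')
    (hns : ∀ p ∈ ω.tiles, ¬ Straddles p) (h₁ : Abuts true ω a y) (h₁' : Abuts true ω' a y)
    (h₂ : Abuts false ω b z) (h₂' : Abuts false ω' b z) : ω = ω' := by
  obtain ⟨n, hn, hper, hnl⟩ := h₁.exists_period hω hl hlω
  obtain ⟨n', hn', hper', hnl'⟩ := h₁'.exists_period hω' hl' hlω'
  -- A common period: both powers are inverse to the weight of the chain of length `n * n'` at `a`.
  have hLL : l ^ n' = l' ^ n := by
    have e1 := W.chainWeight_mul _ hper n'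
    have e2 := W.chainWeight_mul _ hper' n
    rw [mul_comm, e2, hnl, hnl', inv_pow, inv_pow] at e1
    exact inv_injective e1.symm
  have hL : 1 < l ^ n' := one_lt_pow' hl hn'.ne'
  have hLω : ω.scale (l ^ n') = ω := by
    have := ColoredTiling.scale_zpow_eq_self hlω n'
    rwa [zpow_natCast] at this
  have hLω' : ω'.scale (l ^ n') = ω' := by
    have := ColoredTiling.scale_zpow_eq_self hlω' n
    rwa [zpow_natCast, ← hLL] at this
  refine ColoredTiling.eq_of_subset fun q hq => ?_
  obtain ⟨u, hu⟩ := q.1.nonempty_toSet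
  have hu0 : 0 < u.im := q.1.y₁_pos.trans hu.2.2.1
  obtain ⟨d, hd, hd', hud⟩ : ∃ d ∈ ω.tiles, d ∈ ω'.tiles ∧ u ∈ closure d.1.toSet := by
    rcases lt_trichotomy u.re 0 with h | h | h
    · exact exists_common_tile hω hω' hL hLω hLω' h₁ h₁' hu0 (by simpa using h)
    · exact absurd ⟨h ▸ hu.1, h ▸ hu.2.1⟩ (hns q hq)
    · exact exists_common_tile hω hω' hL hLω hLω' h₂ h₂' hu0 (by simpa using h)
  rwa [← ColoredTiling.eq_of_meets hd hq (Tile.meets_of_mem hud hu)]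

/-- The factor `y' / y` lies in `G` because both heights are in the coset of `g a`; equality of
ratios lets it match the two sides at once. -/
theorem orbitOf_eq_of_abuts (hω : ω ∈ W.preSpace g) (hω' : ω' ∈ W.preSpace g) {l l' : PosReal}
    (hl : 1 < l) (hl' : 1 < l') (hlω : ω.scale l = ω) (hlω' : ω'.scale l' = ω')
    (hns : ∀ p ∈ ω.tiles, ¬ Straddles p) {y' z' : PosReal}
    (h₁ : Abuts true ω a y) (h₁' : Abuts true ω' a y')
    (h₂ : Abuts false ω b z) (h₂' : Abuts false ω' b z') (hr : y / z = y' / z') :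
    W.orbitOf ω = W.orbitOf ω' := by
  set m := y' / y with hm
  have hmG : m ∈ W.baseSet := by
    have e1 := h₁.mem hω
    have e2 := h₁'.mem hω'
    rw [Set.mem_smul_set_iff_inv_smul_mem, smul_eq_mul] at e1 e2
    have := W.baseSet.mul_mem e2 (W.baseSet.inv_mem e1)
    rwa [mul_inv, inv_inv, mul_mul_mul_comm, inv_mul_cancel, one_mul, ← div_eq_mul_inv] at this
  have hmy : m * y = y' := by rw [hm, div_mul_cancel]
  have hmz : m * z = z' := by
    rw [div_eq_div_iff_mul_eq_mul] at hr
    rw [hm, div_mul_eq_mul_div, ← hr, mul_div_cancel_left]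
  have heq : ω.scale m = ω' := by
    refine eq_of_abuts (scale_mem_preSpace hω hmG) hω' hl hl' ?_ hlω' ?_
      (hmy ▸ h₁.of_scale) h₁' (hmz ▸ h₂.of_scale) h₂'
    · rw [ColoredTiling.scale_scale, mul_comm, ← ColoredTiling.scale_scale, hlω]
    · rintro _ ⟨p, hp, rfl⟩ h
      exact hns p hp (straddles_scale_iff.1 h)
  rw [← heq, orbitOf_scale hmG]

end WeightedSubst

end NumerationSystem
end

/-! ### Height ratios across a vertical line and finiteness of the exceptional closed orbits. -/

noncomputable section

namespace NumerationSystem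

namespace WeightedSubst

variable {A : Type*} {W : WeightedSubst A} {g : A → PosReal} {ω ω' : ColoredTiling A} {s : Bool}
  {a b : A} {y z l : PosReal}

/-- `r` is the ratio of the heights of tiles of colors `a` and `b` that abut on a common vertical
line, below the boundary of two children of one tile. -/
def IsJunctionRatio (W : WeightedSubst A) (a b : A) (r : ℝ) : Prop :=
  ∃ (c : A) (i j : Fin (W.len c)) (m n : ℕ),
    (W.nextLetter (W.extremal true))^[m] (W.σ c i) = a ∧
    (W.nextLetter (W.extremal false))^[n] (W.σ c j) = b ∧
    r = ((W.τ c i * W.chainWeight (W.extremal true) m (W.σ c i) /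
      (W.τ c j * W.chainWeight (W.extremal false) n (W.σ c j)) : PosReal) : ℝ)

/-- Descend from the common ancestor until `q` and `r` lie below different children. From there `q`
follows right sides only and `r` left sides only. -/
theorem isJunctionRatio_of_desc {p q r : Tile × A} (hq : W.Desc p q) (hr : W.Desc p r)
    (hqr : q.1.x₂ = r.1.x₁) (h₁ : p.1.x₁ < q.1.x₂) (h₂ : q.1.x₂ < p.1.x₂) :
    IsJunctionRatio W q.2 r.2 (q.1.y₁ / r.1.y₁) := by
  refine hq.induction (P := fun p => W.Desc p r → p.1.x₁ < q.1.x₂ → q.1.x₂ < p.1.x₂ →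
    IsJunctionRatio W q.2 r.2 (q.1.y₁ / r.1.y₁)) (fun _ _ h => absurd h (lt_irrefl _)) ?_ hr h₁ h₂
  intro p i hd ih hr h₁ h₂
  rcases hr.cases with rfl | ⟨j, hj⟩
  · exact absurd hqr h₁.ne'
  have hq12 := q.1.x₁_lt_x₂
  have hr12 := r.1.x₁_lt_x₂
  have e1 := hd.x₁_le
  have e2 := hd.x₂_le
  have e3 := hj.x₁_le
  have e4 := hj.x₂_le
  rcases lt_trichotomy i j with hij | rfl | hij
  · have e5 := W.child_x₂_le_child_x₁ p hij
    obtain ⟨m, hm, hm'⟩ := hd.exists_chain (s := true)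
      (show (W.child p i).1.x₂ = q.1.x₂ by linarith)
    obtain ⟨n, hn, hn'⟩ := hj.exists_chain (s := false)
      (show (W.child p j).1.x₁ = r.1.x₁ by linarith)
    refine ⟨p.2, i, j, m, n, hm.symm, hn.symm, ?_⟩
    rw [hm', hn', child_y₁, child_y₁, child_snd, child_snd]
    have hy := p.1.y₁_pos.ne'
    rw [show ∀ u v : PosReal, ((u / v : PosReal) : ℝ) = (u : ℝ) / v from fun u v => by
      rw [div_eq_mul_inv, div_eq_mul_inv]; rfl, Positive.val_mul, Positive.val_mul,
      ← mul_assoc, ← mul_assoc, mul_div_mul_right _ _ hy, mul_comm, mul_comm (W.τ p.2 j : ℝ)]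
  · exact ih hj (by linarith) (by linarith)
  · have e5 := W.child_x₂_le_child_x₁ p hij
    linarith

/-- The heights of the two tiles adjacent along a vertical line that is not separating. -/
theorem isJunctionRatio_of_adjacent [Finite A] [Nonempty A] (hω : ω ∈ W.preSpace g)
    (hsep : ¬ ∃ x, ω.IsSeparatingLine x) {q r : Tile × A} (hq : q ∈ ω.tiles) (hr : r ∈ ω.tiles)
    (hqr : q.1.x₂ = r.1.x₁) : IsJunctionRatio W q.2 r.2 (q.1.y₁ / r.1.y₁) := by
  push Not at hsep
  obtain ⟨p, hp, hne⟩ : ∃ p ∈ ω.tiles, (p.1.toSet ∩ {z : ℂ | z.re = q.1.x₂}).Nonempty := by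
    have := hsep q.1.x₂
    unfold ColoredTiling.IsSeparatingLine at this
    push Not at this
    exact this
  obtain ⟨z, ⟨hz1, hz2, -, -⟩, hz⟩ := hne
  have hz' : z.re = q.1.x₂ := hz
  rw [hz'] at hz1 hz2
  obtain ⟨P, hP, hd, hM⟩ := exists_large_ancestor hω hp (max q.1.y₂ r.1.y₂)
  have h1 := hd.x₁_le
  have h2 := hd.x₂_le
  rw [max_le_iff] at hM
  have hPy := P.1.y₁_lt_y₂
  have hqx := q.1.x₁_lt_x₂
  have hqy := q.1.y₁_lt_y₂
  have hrx := r.1.x₁_lt_x₂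
  have hry := r.1.y₁_lt_y₂
  exact isJunctionRatio_of_desc
    (desc_of_below hω hP hq (by linarith) (by linarith) (by linarith [hM.1]))
    (desc_of_below hω hP hr (by linarith) (by linarith) (by linarith [hM.2])) hqr
    (by linarith) (by linarith)

/-- Two tiles on opposite sides of a line which are nearly adjacent are adjacent, as there is no room
for a tile between them. -/
theorem adjacent_of_close {q r : Tile × A} (hq : q ∈ ω.tiles)
    (hr : r ∈ ω.tiles) {η h : ℝ} (hη : η * h > r.1.x₁ - q.1.x₂)
    (hbound : ∀ p ∈ ω.tiles, η * p.1.y₂ ≤ p.1.y₁) (hη0 : 0 < η)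
    (hq1 : q.1.y₁ < h) (hq2 : h < q.1.y₂) (hr1 : r.1.y₁ < h) (hr2 : h < r.1.y₂)
    (hlt : q.1.x₁ < r.1.x₁) : q.1.x₂ = r.1.x₁ := by
  have hqx := q.1.x₁_lt_x₂
  have hrx := r.1.x₁_lt_x₂
  rcases lt_trichotomy q.1.x₂ r.1.x₁ with hc | hc | hc
  · obtain ⟨p, hp, hz⟩ := ω.exists_mem_closure (z := ⟨(q.1.x₂ + r.1.x₁) / 2, h⟩)
      (q.1.y₁_pos.trans hq1)
    rw [Tile.closure_toSet] at hz
    obtain ⟨h1, h2, h3, h4⟩ := hz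
    dsimp only at h1 h2 h3 h4
    have e1 : q.1.x₂ ≤ p.1.x₁ := by
      by_contra hcon
      have := ColoredTiling.eq_of_meets hp hq
        ⟨not_le.1 hcon, by linarith, by linarith, by linarith⟩
      rw [this] at h2
      linarith
    have e2 : p.1.x₂ ≤ r.1.x₁ := by
      by_contra hcon
      have := ColoredTiling.eq_of_meets hp hr
        ⟨by linarith, not_le.1 hcon, by linarith, by linarith⟩
      rw [this] at h1
      linarith
    -- A tile at level `h` in the gap has width `y₁ ≥ η y₂ ≥ η h`, more than the gap allows.
    have e3 := p.1.width
    have e4 := hbound p hp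
    have e5 := mul_le_mul_of_nonneg_left h4 hη0.le
    linarith
  · exact hc
  · have := ColoredTiling.eq_of_meets hq hr ⟨by linarith, hc, by linarith, by linarith⟩
    rw [this] at hlt
    exact absurd hlt (lt_irrefl _)

variable [Finite A] [Nonempty A]

variable (W) in
theorem exists_height_bound (g : A → PosReal) : ∃ η > 0, ∀ ω ∈ W.preSpace g, ∀ p ∈ ω.tiles,
    η * p.1.y₂ ≤ p.1.y₁ := by
  obtain ⟨κ, η, -, -, hη, hb⟩ := W.exists_τ_bounds
  refine ⟨η, hη, fun ω hω p hp => ?_⟩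
  obtain ⟨q, hq, i, rfl⟩ := exists_parent hω hp
  rw [child_y₁, child_y₂]
  exact mul_le_mul_of_nonneg_right (hb _ _).2 q.1.y₁_pos.le

/-- In a tiling of the space that has tiles abutting on the line through `0` from both sides, the
ratio of the heights of two overlapping ones is a limit of junction ratios. -/
theorem ratio_mem_closure (hω : ω ∈ W.space g) {p q : Tile × A} (hp : p ∈ ω.tiles)
    (hq : q ∈ ω.tiles) (hp0 : p.1.x₂ = 0) (hq0 : q.1.x₁ = 0) (h₁ : p.1.y₁ < q.1.y₂)
    (h₂ : q.1.y₁ < p.1.y₂) {ε : ℝ} (hε : 0 < ε) :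
    ∃ r, IsJunctionRatio W p.2 q.2 r ∧ |r - p.1.y₁ / q.1.y₁| < ε := by
  -- A level inside both tiles. The approximating tiles still contain it, so `adjacent_of_close`
  -- makes them adjacent.
  obtain ⟨h, hh1, hh2, hh3, hh4⟩ := Tile.exists_between_max_min p.1.y₁_lt_y₂ q.1.y₁_lt_y₂ h₁ h₂
  obtain ⟨η, hη, hbound⟩ := exists_height_bound W g
  have hpy := p.1.y₁_pos
  have hqy := q.1.y₁_pos
  have hcont : ContinuousAt (fun t : ℝ × ℝ => t.1 / t.2) (p.1.y₁, q.1.y₁) :=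
    continuousAt_fst.div continuousAt_snd hqy.ne'
  obtain ⟨δ₀, hδ₀, hδ₀'⟩ := Metric.continuousAt_iff.1 hcont ε hε
  have hh : 0 < h := hpy.trans hh1
  obtain ⟨δ, hδ, d1, d2, d3, d4, d5, d6, d7⟩ : ∃ δ > 0, δ < δ₀ ∧ δ < h - p.1.y₁ ∧ δ < p.1.y₂ - h ∧
      δ < h - q.1.y₁ ∧ δ < q.1.y₂ - h ∧ 2 * δ < η * h ∧ 2 * δ < p.1.y₁ := by
    obtain ⟨δ, hδ, hδ'⟩ := exists_between (lt_min hδ₀ (lt_min (sub_pos.2 hh1) (lt_min (sub_pos.2 hh2)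
      (lt_min (sub_pos.2 hh3) (lt_min (sub_pos.2 hh4) (lt_min (half_pos (mul_pos hη hh))
        (half_pos hpy)))))))
    simp only [lt_min_iff] at hδ'
    obtain ⟨k1, k2, k3, k4, k5, k6, k7⟩ := hδ'
    exact ⟨δ, hδ, k1, k2, k3, k4, k5, by linarith, by linarith⟩
  obtain ⟨ω', ⟨hω', hsep⟩, ⟨R, hR, c1, c2, c3, c4⟩, ⟨Q, hQ, e1, e2, e3, e4⟩⟩ :=
    ColoredTiling.exists_close_of_mem_closure hω hp hq hδ
  have hd : dist ((R.y₁, Q.y₁) : ℝ × ℝ) (p.1.y₁, q.1.y₁) < δ₀ := by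
    rw [Prod.dist_eq, max_lt_iff, Real.dist_eq, Real.dist_eq]
    exact ⟨c3.trans_lt d1, e3.trans_lt d1⟩
  have hfin := hδ₀' hd
  rw [Real.dist_eq] at hfin
  refine ⟨_, ?_, hfin⟩
  have hw := p.1.width
  simp only [abs_le] at c1 c2 c3 c4 e1 e2 e3 e4
  have hadj : (R, p.2).1.x₂ = (Q, q.2).1.x₁ :=
    adjacent_of_close hR hQ (η := η) (h := h) (by dsimp only; linarith) (hbound ω' hω') hη
      (by dsimp only; linarith) (by dsimp only; linarith) (by dsimp only; linarith)
      (by dsimp only; linarith) (by dsimp only; linarith)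
  exact isJunctionRatio_of_adjacent hω' hsep hR hQ hadj

/-- Near a separating line through `0` of a periodic tiling one finds overlapping abutting tiles. -/
theorem exists_overlapping (hω : ω ∈ W.preSpace g) (hl : 1 < l) (hlω : ω.scale l = ω)
    (hns : ∀ p ∈ ω.tiles, ¬ Straddles p) :
    ∃ p ∈ ω.tiles, ∃ q ∈ ω.tiles, p.1.x₂ = 0 ∧ q.1.x₁ = 0 ∧ p.1.y₁ < q.1.y₂ ∧ q.1.y₁ < p.1.y₂ := by
  obtain ⟨a, y, R, hR, hRy, hR0⟩ := exists_abuts hω hl hlω hns true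
  obtain ⟨b, z, Q, hQ, hQz, hQ0⟩ := exists_abuts hω hl hlω hns false
  obtain ⟨h, hh, hh'⟩ := exists_between Q.y₁_lt_y₂
  have hl1 : (1 : ℝ) < l := hl
  have hRy0 := R.y₂_pos
  -- Raise the left tile above the level `h` of `Q`. A descendant of it containing the point `(0,
  -- h)` has its right side on the line.
  obtain ⟨n, hn⟩ := pow_unbounded_of_one_lt (h / R.y₂) hl1
  rw [div_lt_iff₀ hRy0] at hn
  have hln := ColoredTiling.scale_zpow_eq_self hlω n
  rw [zpow_natCast] at hln
  have hR' := ColoredTiling.scale_mem_of_eq hln hR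
  have hR0' : (R.scale (l ^ n)).x₂ = 0 := by
    change ((l ^ n : PosReal) : ℝ) * R.x₂ = 0
    rw [show R.x₂ = 0 from hR0, mul_zero]
  have hw := (R.scale (l ^ n)).width
  have hyp := (R.scale (l ^ n)).y₁_pos
  obtain ⟨d, hd, hzd⟩ := exists_desc_mem_closure (W := W) (R.scale (l ^ n), a) (z := ⟨0, h⟩)
    (show (R.scale (l ^ n)).x₁ ≤ 0 by linarith) hR0'.ge (Q.y₁_pos.trans hh)
    (show h ≤ ((l ^ n : PosReal) : ℝ) * R.y₂ from hn.le)
  rw [Tile.closure_toSet] at hzd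
  obtain ⟨-, h2, h3, h4⟩ := hzd
  dsimp only at h2 h3 h4
  have h5 := hd.x₂_le
  dsimp only at h5
  exact ⟨d, mem_of_desc hω hR' hd, (Q, b), hQ, by linarith, hQ0, h3.trans_lt hh', hh.trans_le h4⟩

/-- The set of the powers of `θ` times elements of a finite set is closed in `(0, ∞)`. -/
theorem exists_zpow_of_forall_close {Φ : Set PosReal} (hΦ : Φ.Finite) {θ : PosReal} (hθ : θ < 1)
    {ρ : PosReal} (h : ∀ ε > 0, ∃ φ ∈ Φ, ∃ k : ℤ, |((φ * θ ^ k : PosReal) : ℝ) - ρ| < ε) :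
    ∃ φ ∈ Φ, ∃ k : ℤ, ρ = φ * θ ^ k := by
  set K : Set ℝ := ⋃ φ ∈ Φ, {x | ∃ k : ℤ, x = ((φ * θ ^ k : PosReal) : ℝ) ∧ (ρ : ℝ) / 2 ≤ x ∧
    x ≤ 2 * ρ} with hK
  have hρ := ρ.2
  have hfin : K.Finite := by
    refine hΦ.biUnion fun φ _ => ?_
    set u := -Real.log θ with hu
    have hu0 : 0 < u := neg_pos.2 (Real.log_neg θ.2 hθ)
    refine ((Set.finite_Icc ⌈-((Real.log (2 * ρ) - Real.log φ) / u)⌉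
      ⌊-((Real.log (ρ / 2) - Real.log φ) / u)⌋).image
        fun k : ℤ => ((φ * θ ^ k : PosReal) : ℝ)).subset ?_
    rintro x ⟨k, rfl, h1, h2⟩
    refine ⟨k, ?_, rfl⟩
    have hlog : Real.log ((φ * θ ^ k : PosReal) : ℝ) = Real.log φ + k * Real.log θ := by
      rw [Positive.val_mul, Real.log_mul φ.2.ne' (θ ^ k).2.ne']
      congr 1
      rw [← Real.log_zpow]
      congr 1
    have h3 := Real.log_le_log (by positivity) h1
    have h4 := Real.log_le_log (φ * θ ^ k).2 h2
    rw [hlog] at h3 h4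
    rw [Set.mem_Icc, Int.ceil_le, Int.le_floor, neg_le, le_neg, le_div_iff₀ hu0, div_le_iff₀ hu0]
    constructor <;> rw [hu] <;> linarith
  by_contra hcon
  have hρK : (ρ : ℝ) ∈ Kᶜ := by
    intro hmem
    simp only [hK, Set.mem_iUnion, exists_prop] at hmem
    obtain ⟨φ, hφ, k, hk, -⟩ := hmem
    exact hcon ⟨φ, hφ, k, Subtype.ext hk⟩
  obtain ⟨δ, hδ, hball⟩ := Metric.isOpen_iff.1 hfin.isClosed.isOpen_compl _ hρK
  obtain ⟨φ, hφ, k, hk⟩ := h (min δ (ρ / 2)) (lt_min hδ (half_pos hρ))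
  rw [lt_min_iff] at hk
  refine hball (Metric.mem_ball.2 (show dist ((φ * θ ^ k : PosReal) : ℝ) ρ < δ from hk.1)) ?_
  simp only [hK, Set.mem_iUnion, exists_prop]
  have h1 := abs_lt.1 hk.2
  exact ⟨φ, hφ, k, rfl, by linarith [h1.1], by linarith [h1.2]⟩

omit [Nonempty A] in
-- Both chains contribute a factor from a finite set times a power of the same cycle weight, so the
-- quotient has this form too, with an integral exponent.
theorem exists_finite_junctionRatio {m n : ℕ}
    (ha : Function.IsPeriodicPt (W.nextLetter (W.extremal true)) m a) (hm : 0 < m)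
    (hb : Function.IsPeriodicPt (W.nextLetter (W.extremal false)) n b) (hn : 0 < n)
    (heq : W.chainWeight (W.extremal true) m a = W.chainWeight (W.extremal false) n b) :
    ∃ Φ : Set PosReal, Φ.Finite ∧ ∀ r, IsJunctionRatio W a b r →
      ∃ φ ∈ Φ, ∃ k : ℤ, r = ((φ * W.chainWeight (W.extremal true) m a ^ k : PosReal) : ℝ) := by
  obtain ⟨F, hF, hF'⟩ := W.exists_finite_chainWeight _ ha hm
  obtain ⟨F', hF'', hF'''⟩ := W.exists_finite_chainWeight _ hb hn
  have hT : (Set.range fun e : W.Edge => W.wt e).Finite := Set.finite_range _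
  refine ⟨((Set.range fun e : W.Edge => W.wt e) * F) / ((Set.range fun e : W.Edge => W.wt e) * F'),
    (hT.mul hF).div (hT.mul hF''), ?_⟩
  rintro r ⟨c, i, j, k, k', hk, hk', rfl⟩
  obtain ⟨f, hf, u, hu⟩ := hF' _ _ hk
  obtain ⟨f', hf', u', hu'⟩ := hF''' _ _ hk'
  refine ⟨_, Set.div_mem_div (Set.mul_mem_mul ⟨⟨c, i⟩, rfl⟩ hf) (Set.mul_mem_mul ⟨⟨c, j⟩, rfl⟩ hf'),
    u - u', ?_⟩
  rw [hu, hu', ← heq, zpow_sub, zpow_natCast, zpow_natCast, ← mul_assoc, ← mul_assoc,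
    ← div_eq_mul_inv, div_mul_div_comm]
  rfl

/-- The abutting tiles are invariant under the weights of the cycles at their color. -/
theorem Abuts.zpow_chainWeight (hω : ω ∈ W.preSpace g) (hl : 1 < l) (hlω : ω.scale l = ω)
    (h : Abuts s ω a y) {n : ℕ} (hper : Function.IsPeriodicPt (W.nextLetter (W.extremal s)) n a)
    (k : ℤ) : Abuts s ω a (W.chainWeight (W.extremal s) n a ^ k * y) := by
  set θ := W.chainWeight (W.extremal s) n a with hθ
  have hpow : ∀ {y : PosReal}, Abuts s ω a y → ∀ k : ℕ, Abuts s ω a (θ ^ k * y) := by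
    intro y h k
    have := h.chain hω (n * k)
    rwa [chainWeight_mul _ _ hper, (hper.mul_const k).eq] at this
  obtain ⟨p, hp0, hp, hpl⟩ := h.exists_period hω hl hlω
  have hinv : ∀ {y : PosReal}, Abuts s ω a y → Abuts s ω a (θ⁻¹ * y) := by
    intro y h
    have e1 : θ ^ p = l⁻¹ ^ n := by
      rw [hθ, ← chainWeight_mul _ _ hper, mul_comm, chainWeight_mul _ _ hp, hpl]
    -- Descending realizes only positive powers of `θ`; since `θ ^ p = l⁻¹ ^ n`, scaling up by `l ^
    -- n` supplies the inverse.
    have e2 : θ⁻¹ = θ ^ (p - 1) * l ^ n := by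
      have : θ ^ (p - 1) * θ = l⁻¹ ^ n := by rw [← pow_succ, Nat.sub_add_cancel hp0, e1]
      rw [inv_pow] at this
      rw [eq_mul_inv_of_mul_eq this, mul_assoc, mul_comm θ⁻¹, ← mul_assoc, inv_mul_cancel, one_mul]
    have hln := ColoredTiling.scale_zpow_eq_self hlω n
    rw [zpow_natCast] at hln
    have := hpow (h.scale hln) (p - 1)
    rwa [← mul_assoc, ← e2] at this
  obtain ⟨k, rfl | rfl⟩ := k.eq_nat_or_neg
  · simpa using hpow h k
  · rw [zpow_neg, zpow_natCast, ← inv_pow]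
    induction k with
    | zero => simpa using h
    | succ k ih => rw [pow_succ', mul_assoc]; exact hinv ih

/-- There are finitely many closed orbits of tilings for which the line through `0` is separating. -/
theorem finite_separating_closedOrbits (g : A → PosReal) :
    {ξ ∈ W.closedOrbits g | ∀ ω ∈ ξ, ∀ p ∈ ω.tiles, ¬ Straddles p}.Finite := by
  -- the orbits with data `(a, b, φ)`
  let S : A × A → PosReal → Set (Set (ColoredTiling A)) := fun c φ => {ξ | ∃ ω ∈ W.preSpace g,
    ξ = W.orbitOf ω ∧ (∃ l, 1 < l ∧ ω.scale l = ω) ∧ (∀ p ∈ ω.tiles, ¬ Straddles p) ∧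
    ∃ y z, Abuts true ω c.1 y ∧ Abuts false ω c.2 z ∧ y / z = φ}
  have hS : ∀ c φ, (S c φ).Finite := by
    intro c φ
    refine Set.Subsingleton.finite ?_
    rintro ξ ⟨ω, hω, rfl, ⟨l, hl, hlω⟩, hns, y, z, hy, hz, hyz⟩
      ξ' ⟨ω', hω', rfl, ⟨l', hl', hlω'⟩, -, y', z', hy', hz', hyz'⟩
    exact orbitOf_eq_of_abuts hω hω' hl hl' hlω hlω' hns hy hy' hz hz' (hyz.trans hyz'.symm)
  have hΦ : ∀ c : A × A, ∃ Φ : Set PosReal, Φ.Finite ∧ ∀ (ω : ColoredTiling A) (p q : Tile × A)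
      (l : PosReal), ω ∈ W.space g → 1 < l → ω.scale l = ω → p ∈ ω.tiles → q ∈ ω.tiles →
      p.1.x₂ = 0 → q.1.x₁ = 0 → p.1.y₁ < q.1.y₂ → q.1.y₁ < p.1.y₂ → (p.2, q.2) = c →
      ∃ φ ∈ Φ, ∃ y z, Abuts true ω c.1 y ∧ Abuts false ω c.2 z ∧ y / z = φ := by
    rintro ⟨a, b⟩
    by_cases hex : ∃ m n : ℕ, Function.IsPeriodicPt (W.nextLetter (W.extremal true)) m a ∧ 0 < m ∧
      Function.IsPeriodicPt (W.nextLetter (W.extremal false)) n b ∧ 0 < n ∧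
      W.chainWeight (W.extremal true) m a = W.chainWeight (W.extremal false) n b
    · obtain ⟨m, n, ha, hm, hb, hn, heq⟩ := hex
      obtain ⟨Φ, hΦ, hΦ'⟩ := exists_finite_junctionRatio ha hm hb hn heq
      refine ⟨Φ, hΦ, ?_⟩
      rintro ω p q l hω hl hlω hp hq hp0 hq0 h₁ h₂ hc
      obtain ⟨rfl, rfl⟩ := Prod.mk.inj hc
      have hap : Abuts true ω p.2 ⟨p.1.y₁, p.1.y₁_pos⟩ := ⟨p.1, hp, rfl, hp0⟩
      have haq : Abuts false ω q.2 ⟨q.1.y₁, q.1.y₁_pos⟩ := ⟨q.1, hq, rfl, hq0⟩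
      obtain ⟨φ, hφ, k, hk⟩ := exists_zpow_of_forall_close hΦ (W.chainWeight_lt_one _ hm p.2)
        (ρ := ⟨p.1.y₁, p.1.y₁_pos⟩ / ⟨q.1.y₁, q.1.y₁_pos⟩) (fun ε hε => by
          obtain ⟨r, hr, hr'⟩ := ratio_mem_closure hω hp hq hp0 hq0 h₁ h₂ hε
          obtain ⟨φ, hφ, k, rfl⟩ := hΦ' r hr
          refine ⟨φ, hφ, k, ?_⟩
          rw [div_eq_mul_inv] at hr' ⊢
          exact hr')
      -- Another abutting tile of the same color, at height `θ ^ (-k)` times that of `p`, brings the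
      -- ratio to `φ` exactly.
      refine ⟨φ, hφ, _, _, hap.zpow_chainWeight (space_subset_preSpace g hω) hl hlω ha (-k), haq, ?_⟩
      rw [mul_div_assoc, hk, mul_left_comm, zpow_neg, inv_mul_cancel, mul_one]
    · refine ⟨∅, Set.finite_empty, ?_⟩
      rintro ω p q l hω hl hlω hp hq hp0 hq0 h₁ h₂ hc
      obtain ⟨rfl, rfl⟩ := Prod.mk.inj hc
      have hω' := space_subset_preSpace g hω
      have hap : Abuts true ω p.2 ⟨p.1.y₁, p.1.y₁_pos⟩ := ⟨p.1, hp, rfl, hp0⟩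
      have haq : Abuts false ω q.2 ⟨q.1.y₁, q.1.y₁_pos⟩ := ⟨q.1, hq, rfl, hq0⟩
      obtain ⟨m, hm, ha, hma⟩ := hap.exists_period hω' hl hlω
      obtain ⟨n, hn, hb, hnb⟩ := haq.exists_period hω' hl hlω
      exact absurd ⟨m, n, ha, hm, hb, hn, hma.trans hnb.symm⟩ hex
  choose Φ hΦ hΦ' using hΦ
  refine (Set.finite_iUnion fun c => (hΦ c).biUnion fun φ _ => hS c φ).subset ?_
  rintro ξ ⟨⟨ω, hω, ⟨l, hlG, hl, hlω⟩, rfl⟩, hns⟩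
  have hω' := space_subset_preSpace g hω
  have hns' := hns ω (mem_orbitOf_self ω)
  obtain ⟨p, hp, q, hq, hp0, hq0, h₁, h₂⟩ := exists_overlapping hω' hl hlω hns'
  obtain ⟨φ, hφ, y, z, hy, hz, hyz⟩ := hΦ' (p.2, q.2) ω p q l hω hl hlω hp hq hp0 hq0 h₁ h₂ rfl
  simp only [Set.mem_iUnion, exists_prop]
  exact ⟨(p.2, q.2), φ, hφ, ω, hω', rfl, ⟨l, hl, hlω⟩, hns', y, z, hy, hz, hyz⟩

end WeightedSubst

end NumerationSystem
end

noncomputable section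

namespace NumerationSystem

namespace WeightedSubst

variable {A : Type*} {W : WeightedSubst A} {g : A → PosReal} {ω : ColoredTiling A}

/-! ### The minimum multiplicative cycle of a closed orbit -/

/-- The column of a tile through `i` contains `0`, so it overlaps the column of its copy scaled by
`l`. Disjointness forces `l y₁ ≥ y₂ ≥ κ⁻¹ y₁`. -/
theorem exists_lt_one_forall_le_of_scale_eq (W : WeightedSubst A) [Finite A] [Nonempty A]
    (g : A → PosReal) :
    ∃ κ : ℝ, 0 < κ ∧ κ < 1 ∧ ∀ ω ∈ W.preSpace g, ∀ l : PosReal, 1 < l → ω.scale l = ω →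
      κ⁻¹ ≤ (l : ℝ) := by
  obtain ⟨κ, η, hκ0, hκ, -, hb⟩ := W.exists_τ_bounds
  refine ⟨κ, hκ0, hκ, fun ω hω l hl h => ?_⟩
  obtain ⟨p, hp, hz⟩ := ω.exists_mem_closure (z := Complex.I) (by simp)
  rw [Tile.closure_toSet] at hz
  obtain ⟨h1, h2, -, -⟩ := hz
  simp only [Complex.I_re] at h1 h2
  have hl' : (1 : ℝ) < l := hl
  have hx := p.1.x₁_lt_x₂
  have hy := p.1.y₁_pos
  have hyy := p.1.y₁_lt_y₂
  have hle : p.1.y₂ ≤ l * p.1.y₁ := by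
    by_contra hlt
    push Not at hlt
    have hm : p.1.Meets (p.1.scale l) := by
      refine ⟨?_, ?_, ?_, hlt⟩ <;> simp only [Tile.scale] <;> nlinarith
    have h3 := congrArg (fun q : Tile × A => q.1.y₁)
      (ColoredTiling.eq_of_meets (p := p) (q := (p.1.scale l, p.2)) hp
        (ColoredTiling.scale_mem_of_eq h hp) hm)
    simp only [Tile.scale] at h3
    nlinarith
  obtain ⟨q, hq, i, hpq⟩ := exists_parent hω hp
  have h4 : p.1.y₁ ≤ κ * p.1.y₂ := by
    rw [hpq, child_y₁]
    exact mul_le_mul_of_nonneg_right (hb q.2 i).1 q.1.y₁_pos.le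
  rw [inv_le_iff_one_le_mul₀ hκ0]
  have h5 : p.1.y₂ * 1 ≤ p.1.y₂ * (l * κ) := by nlinarith
  exact le_of_mul_le_mul_left h5 (hy.trans hyy)

theorem exists_coe_eq_cycle [Finite A] [Nonempty A] {ξ : Set (ColoredTiling A)}
    (hξ : ξ ∈ W.closedOrbits g) : ∃ l ∈ W.baseSet, 1 < l ∧ (l : ℝ) = W.cycle ξ := by
  obtain ⟨ω, hω, ⟨l₀, hl₀G, hl₀, hl₀ω⟩, rfl⟩ := hξ
  obtain ⟨κ, hκ0, hκ, hb⟩ := W.exists_lt_one_forall_le_of_scale_eq g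
  have hω' := space_subset_preSpace g hω
  set S : Set ℝ := {x : ℝ | ∃ l ∈ W.baseSet, (l : ℝ) = x ∧ 1 < l ∧
    ∀ ω' ∈ {ω' | ∃ l ∈ W.baseSet, ω' = ω.scale l}, ω'.scale l = ω'} with hS
  have hmem : ∀ l ∈ W.baseSet, 1 < l → ω.scale l = ω → (l : ℝ) ∈ S := by
    intro l hl h1 h
    refine ⟨l, hl, rfl, h1, ?_⟩
    rintro _ ⟨m, hm, rfl⟩
    rw [ColoredTiling.scale_scale, mul_comm, ← ColoredTiling.scale_scale, h]
  have hof : ∀ x ∈ S, ∃ l ∈ W.baseSet, (l : ℝ) = x ∧ 1 < l ∧ ω.scale l = ω := by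
    rintro x ⟨l, hl, rfl, h1, h⟩
    exact ⟨l, hl, rfl, h1, h ω (mem_orbitOf_self ω)⟩
  have hne : S.Nonempty := ⟨_, hmem l₀ hl₀G hl₀ hl₀ω⟩
  have hκ1 := (one_lt_inv₀ hκ0).2 hκ
  have hlow : ∀ x ∈ S, κ⁻¹ ≤ x := by
    intro x hx
    obtain ⟨l, -, rfl, h1, h⟩ := hof x hx
    exact hb ω hω' l h1 h
  have hbdd : BddBelow S := ⟨_, hlow⟩
  have hm : κ⁻¹ ≤ sInf S := le_csInf hne hlow
  have hmS : sInf S ∈ S := by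
    -- Two distinct periods between the infimum and `κ⁻¹` times it would have a quotient that is a
    -- period below `κ⁻¹`. Hence the infimum is attained.
    obtain ⟨x, hx, hxlt⟩ := exists_lt_of_csInf_lt hne
      (show sInf S < sInf S * κ⁻¹ by nlinarith)
    rcases (csInf_le hbdd hx).eq_or_lt with heq | hlt
    · rwa [heq]
    exfalso
    obtain ⟨x', hx', hx'lt⟩ := exists_lt_of_csInf_lt hne hlt
    have hmx' := csInf_le hbdd hx'
    obtain ⟨l, hlG, rfl, h1, h⟩ := hof x hx
    obtain ⟨l', hl'G, rfl, h1', h'⟩ := hof x' hx'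
    have h2 : κ⁻¹ ≤ ((l * l'⁻¹ : PosReal) : ℝ) := by
      refine hb ω hω' _ ?_ ?_
      · rw [lt_mul_inv_iff_mul_lt, one_mul]; exact hx'lt
      · rw [← ColoredTiling.scale_scale, ColoredTiling.scale_inv_eq_self h', h]
    rw [Positive.val_mul, Positive.coe_inv, ← div_eq_mul_inv, le_div_iff₀ l'.2] at h2
    nlinarith
  obtain ⟨l, hlG, hl, h1, -⟩ := hof _ hmS
  exact ⟨l, hlG, h1, hl⟩

/-! ### Closed orbits and orbits of the shift -/

/-- The orbits of the periodic paths whose point is in the interior. -/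
def interiorOrbits (W : WeightedSubst A) : Set (Path.Orbit W.adj) :=
  {q | ∃ x : Path.Periodic W.adj, x.orbit = q ∧ Interior x.1}

theorem finite_compl_interiorOrbits [Finite A] : (W.interiorOrbitsᶜ).Finite := by
  have h : {x : Path.Periodic W.adj | ¬ Interior x.1}.Finite :=
    finite_not_interior.preimage Subtype.val_injective.injOn
  refine (h.image Path.Periodic.orbit).subset fun q hq => ?_
  obtain ⟨x, rfl⟩ := Quotient.exists_rep q
  exact ⟨x, fun hx => hq ⟨x, rfl, hx⟩, rfl⟩

/-- An interior periodic path on an orbit. -/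
def interiorRep (q : W.interiorOrbits) : {x : Path.Periodic W.adj // Interior x.1} :=
  ⟨q.2.choose, q.2.choose_spec.2⟩

theorem orbit_interiorRep (q : W.interiorOrbits) : (interiorRep q).1.orbit = q.1 :=
  q.2.choose_spec.1

section

variable [Finite A] [Nonempty A]

/-- The closed orbit of tilings attached to an orbit of interior periodic paths. -/
def closedOrbitOf (hg : W.IsCompatible g) (q : W.interiorOrbits) : W.closedOrbits g :=
  ⟨W.orbitOf (stdTiling g (interiorRep q)), orbitOf_stdTiling_mem hg _⟩

theorem cycle_closedOrbitOf (hg : W.IsCompatible g) (q : W.interiorOrbits) :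
    W.cycle (closedOrbitOf hg q : Set (ColoredTiling A)) =
      ((q.1.weight W.wt : PosReal) : ℝ)⁻¹ := by
  rw [closedOrbitOf, cycle_orbitOf_stdTiling]
  conv_rhs => rw [← orbit_interiorRep q]
  rfl

theorem closedOrbitOf_injective (hg : W.IsCompatible g) :
    Function.Injective (closedOrbitOf (W := W) hg) := by
  intro q q' h
  have h1 := (orbitOf_stdTiling_eq_iff hg _ _).1 (congrArg Subtype.val h)
  rw [← Path.Periodic.orbit_eq_iff, orbit_interiorRep, orbit_interiorRep] at h1
  exact Subtype.ext h1

/-- By `exists_eq_tiling` one tile over `0` puts an orbit in the range, so only orbits for which the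
line through `0` is separating are missed. -/
theorem finite_compl_range_closedOrbitOf (hg : W.IsCompatible g) :
    ((Set.range (closedOrbitOf (W := W) hg))ᶜ).Finite := by
  refine ((finite_separating_closedOrbits (W := W) g).preimage
    Subtype.val_injective.injOn).subset ?_
  rintro ⟨ξ, hξ⟩ hq
  refine ⟨hξ, ?_⟩
  by_contra hcon
  push Not at hcon
  obtain ⟨ω', hω', p, hp, hps⟩ := hcon
  apply hq
  obtain ⟨ω, hω, ⟨l, hlG, hl, h⟩, rfl⟩ := hξ
  obtain ⟨m, hm, rfl⟩ := hω'
  obtain ⟨p, hp, rfl⟩ := hp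
  rw [straddles_scale_iff] at hps
  obtain ⟨x, hx, hint, y, hy, rfl⟩ := exists_eq_tiling (space_subset_preSpace g hω) hl h hp hps
  let x' : InteriorPeriodic W := ⟨⟨x, hx⟩, hint⟩
  refine ⟨⟨x'.1.orbit, x'.1, rfl, hint⟩, Subtype.ext ?_⟩
  refine Eq.trans ?_ (tiling_mem_orbitOf x' hy).symm
  exact (orbitOf_stdTiling_eq_iff hg _ _).2 (Path.Periodic.orbit_eq_iff.1 (orbit_interiorRep _))

end

/-! ### The Euler product -/

theorem norm_coe_cpow_lt_one {u : PosReal} (hu : u < 1) {α : ℂ} (hα : 0 < α.re) :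
    ‖((u : ℝ) : ℂ) ^ α‖ < 1 := by
  rw [Complex.norm_cpow_eq_rpow_re_of_pos u.2]
  exact Real.rpow_lt_one u.2.le hu hα

/-- The map `u ↦ u ^ α` as a homomorphism. -/
def cpowHom (α : ℂ) : PosReal →* ℂ where
  toFun u := ((u : ℝ) : ℂ) ^ α
  map_one' := by simp
  map_mul' u v := by
    rw [Positive.val_mul, Complex.ofReal_mul, Complex.mul_cpow_ofReal_nonneg u.2.le v.2.le]

theorem cpowHom_apply (α : ℂ) (u : PosReal) : cpowHom α u = ((u : ℝ) : ℂ) ^ α := rfl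

theorem orbit_weight_cpow (α : ℂ) (q : Path.Orbit W.adj) :
    q.weight (fun e => cpowHom α (W.wt e)) = cpowHom α (q.weight W.wt) := by
  obtain ⟨x, rfl⟩ := Quotient.exists_rep q
  exact Path.weight_map _ _ _ _

theorem orbit_weight_lt_one (q : Path.Orbit W.adj) : q.weight W.wt < 1 := by
  obtain ⟨x, rfl⟩ := Quotient.exists_rep q
  exact cycleWeight_lt_one x.2

theorem orbit_weight_mem_baseSet (q : Path.Orbit W.adj) : q.weight W.wt ∈ W.baseSet := by
  obtain ⟨x, rfl⟩ := Quotient.exists_rep q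
  exact cycleWeight_mem_baseSet x.1

/-- The finite product of the Euler factors `1 - u ^ α`. -/
def eulerProd (U : Multiset PosReal) (α : ℂ) : ℂ := (U.map fun u => 1 - cpowHom α u).prod

theorem eulerProd_ne_zero {U : Multiset PosReal} (hU : ∀ u ∈ U, u < 1) {α : ℂ} (hα : 0 < α.re) :
    eulerProd U α ≠ 0 := by
  rw [eulerProd, Ne, Multiset.prod_eq_zero_iff, Multiset.mem_map]
  rintro ⟨u, hu, h⟩
  have h1 := norm_coe_cpow_lt_one (hU u hu) hα
  rw [← cpowHom_apply, ← sub_eq_zero.1 h, norm_one] at h1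
  exact lt_irrefl _ h1

theorem differentiable_eulerProd (U : Multiset PosReal) : Differentiable ℂ (eulerProd U) := by
  induction U using Multiset.induction with
  | empty => exact differentiable_const 1
  | cons u U ih =>
    have h : eulerProd (u ::ₘ U) = fun α => (1 - ((u : ℝ) : ℂ) ^ α) * eulerProd U α := by
      ext α; simp [eulerProd, cpowHom_apply]
    rw [h]
    have hu : ((u : ℝ) : ℂ) ≠ 0 := by exact_mod_cast u.2.ne'
    exact (((differentiable_id).const_cpow (Or.inl hu)).const_sub 1).mul ih

variable (W) in
open Classical in
/-- The determinant of `1` minus the matrix of the `α`-th powers of the weights. -/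
def edgeDet [Finite A] (α : ℂ) : ℂ :=
  letI := Fintype.ofFinite A
  (1 - Path.transferMatrix W.adj fun e => cpowHom α (W.wt e)).det

theorem differentiable_edgeDet [Finite A] : Differentiable ℂ W.edgeDet := by
  classical
  let := Fintype.ofFinite A
  have hent : ∀ e f : W.Edge, Differentiable ℂ fun α : ℂ =>
      ((1 : Matrix W.Edge W.Edge ℂ) - Path.transferMatrix W.adj fun e => cpowHom α (W.wt e)) e f := by
    intro e f
    simp only [Matrix.sub_apply, Path.transferMatrix]
    refine Differentiable.const_sub ?_ _
    have hu : ((W.wt f : ℝ) : ℂ) ≠ 0 := by exact_mod_cast (W.wt f).2.ne'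
    split_ifs
    · exact (differentiable_id).const_cpow (Or.inl hu)
    · fun_prop
  have h : W.edgeDet = fun α => ∑ s : Equiv.Perm W.Edge, Equiv.Perm.sign s •
      ∏ e, ((1 : Matrix W.Edge W.Edge ℂ) -
        Path.transferMatrix W.adj fun e => cpowHom α (W.wt e)) (s e) e := by
    ext α
    rw [edgeDet, Matrix.det_apply]
  rw [h]
  refine Differentiable.fun_sum fun s _ => ?_
  refine Differentiable.const_smul (Differentiable.fun_finsetProd fun e _ => hent _ _) _

theorem exp_sum_neg_log {U : Multiset PosReal} {α : ℂ}
    (hU : eulerProd U α ≠ 0) :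
    Complex.exp (U.map fun u => -Complex.log (1 - cpowHom α u)).sum = (eulerProd U α)⁻¹ := by
  induction U using Multiset.induction with
  | empty => simp [eulerProd]
  | cons u U ih =>
    simp only [eulerProd, Multiset.map_cons, Multiset.prod_cons, Multiset.sum_cons] at hU ih ⊢
    rw [Complex.exp_add, ih (right_ne_zero_of_mul hU), Complex.exp_neg,
      Complex.exp_log (left_ne_zero_of_mul hU), mul_inv]

/-- The weights of a word sum to `1`, and raising numbers of `(0, 1)` to an exponent above `1`
strictly decreases them. -/
theorem sum_norm_transferMatrix_lt_one [Fintype A] [DecidableEq A] {α : ℂ} (hα : 1 < α.re)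
    (e : W.Edge) :
    ∑ f, ‖Path.transferMatrix W.adj (fun e => cpowHom α (W.wt e)) e f‖ < 1 := by
  classical
  have h1 : ∀ f : W.Edge, ‖Path.transferMatrix W.adj (fun e => cpowHom α (W.wt e)) e f‖ =
      if f.1 = W.σ e.1 e.2 then (W.wt f : ℝ) ^ α.re else 0 := by
    intro f
    rw [Path.transferMatrix, apply_ite norm, norm_zero, cpowHom_apply,
      Complex.norm_cpow_eq_rpow_re_of_pos (W.wt f).2]
    exact if_congr Iff.rfl rfl rfl
  simp only [h1, Fintype.sum_sigma]
  rw [Finset.sum_eq_single (W.σ e.1 e.2) (fun b _ hb => by simp [hb]) (by simp)]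
  simp only [if_true]
  rw [← W.sum_τ (W.σ e.1 e.2)]
  refine Finset.sum_lt_sum_of_nonempty ⟨W.first _, Finset.mem_univ _⟩ fun i _ => ?_
  exact Real.rpow_lt_self_of_lt_one (wt_pos ⟨_, i⟩) (wt_lt_one ⟨_, i⟩) hα

theorem exists_hasSum_orbit_cpow [Finite A] {α : ℂ} (hα : 1 < α.re) :
    ∃ s, HasSum (fun q : Path.Orbit W.adj => -Complex.log (1 - cpowHom α (q.weight W.wt))) s ∧
      Complex.exp s = (W.edgeDet α)⁻¹ := by
  classical
  let := Fintype.ofFinite A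
  obtain ⟨s, hs, h⟩ := Path.exists_hasSum_orbit (adj := W.adj) (fun e => cpowHom α (W.wt e))
    (fun e => norm_coe_cpow_lt_one (wt_lt_one e) (by linarith))
    (sum_norm_transferMatrix_lt_one hα)
  refine ⟨s, ?_, ?_⟩
  · simpa only [orbit_weight_cpow] using hs
  · rw [h, edgeDet]

theorem edgeDet_ne_zero [Finite A] {α : ℂ} (hα : 1 < α.re) : W.edgeDet α ≠ 0 := by
  obtain ⟨s, -, hs⟩ := exists_hasSum_orbit_cpow (W := W) hα
  intro h
  rw [h, inv_zero] at hs
  exact Complex.exp_ne_zero _ hs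

/-- The Euler product over the closed orbits, up to finitely many factors the inverse of a
determinant. -/
theorem exists_hasProd_cycle [Finite A] [Nonempty A] (hg : W.IsCompatible g) :
    ∃ U V : Multiset PosReal, (∀ u ∈ U, u ∈ W.baseSet ∧ u < 1) ∧ (∀ v ∈ V, v ∈ W.baseSet ∧ v < 1) ∧
      ∀ α : ℂ, 1 < α.re → HasProd (fun ξ : W.closedOrbits g =>
        (1 - (W.cycle (ξ : Set (ColoredTiling A)) : ℂ) ^ (-α))⁻¹)
        (eulerProd U α / (eulerProd V α * W.edgeDet α)) := by
  classical
  choose c hcG hc1 hc using fun ξ : W.closedOrbits g => exists_coe_eq_cycle ξ.2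
  set I := (finite_compl_interiorOrbits (W := W)).toFinset with hI
  set T := (finite_compl_range_closedOrbitOf (W := W) hg).toFinset with hT
  -- `U` cancels the factors of the orbits of boundary paths, and `V` adds those of the closed
  -- orbits that come from no path.
  refine ⟨I.val.map fun q => q.weight W.wt, T.val.map fun ξ => (c ξ)⁻¹, ?_, ?_, fun α hα => ?_⟩
  · simp only [Multiset.mem_map]
    rintro _ ⟨q, -, rfl⟩
    exact ⟨orbit_weight_mem_baseSet q, orbit_weight_lt_one q⟩
  · simp only [Multiset.mem_map]
    rintro _ ⟨ξ, -, rfl⟩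
    exact ⟨W.baseSet.inv_mem (hcG ξ), inv_lt_one_of_one_lt (hc1 ξ)⟩
  have hα0 : 0 < α.re := by linarith
  have hcα : ∀ ξ : W.closedOrbits g,
      (W.cycle (ξ : Set (ColoredTiling A)) : ℂ) ^ (-α) = cpowHom α (c ξ)⁻¹ := by
    intro ξ
    rw [map_inv, cpowHom_apply, hc, Complex.cpow_neg]
  obtain ⟨s, hs, hsdet⟩ := exists_hasSum_orbit_cpow (W := W) hα
  set h : Path.Orbit W.adj → ℂ := fun q => -Complex.log (1 - cpowHom α (q.weight W.wt)) with hh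
  set f : W.closedOrbits g → ℂ := fun ξ => -Complex.log (1 - cpowHom α (c ξ)⁻¹) with hf
  have h1 : HasSum (fun q : W.interiorOrbits => h q) (s - ∑ q ∈ I, h q) := by
    have : HasSum (fun q : {q // q ∉ I} => h q) (s - ∑ q ∈ I, h q) := by
      rw [Finset.hasSum_compl_iff, sub_add_cancel]; exact hs
    have hiff : ∀ q, q ∈ W.interiorOrbits ↔ q ∉ I := by simp [hI]
    exact (Equiv.subtypeEquivRight hiff).hasSum_iff.2 this
  have h2 : HasSum f (s - ∑ q ∈ I, h q + ∑ ξ ∈ T, f ξ) := by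
    rw [← Finset.hasSum_compl_iff]
    have h3 : ∀ q, f (closedOrbitOf hg q) = h q := by
      intro q
      have : (c (closedOrbitOf hg q))⁻¹ = q.1.weight W.wt := by
        rw [inv_eq_iff_eq_inv]
        refine Subtype.ext ?_
        rw [hc, cycle_closedOrbitOf, Positive.coe_inv]
      simp only [hf, hh, this]
    have hiff : ∀ ξ, ξ ∈ Set.range (closedOrbitOf (W := W) hg) ↔ ξ ∉ T := by simp [hT]
    refine ((Equiv.ofInjective _ (closedOrbitOf_injective hg)).trans
      (Equiv.subtypeEquivRight hiff)).hasSum_iff.1 ?_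
    simpa only [Function.comp_def, Equiv.trans_apply, Equiv.subtypeEquivRight_apply_coe,
      Equiv.ofInjective_apply, h3] using h1
  have h4 := h2.cexp
  have hne : ∀ ξ, 1 - cpowHom α (c ξ)⁻¹ ≠ 0 := by
    intro ξ h
    have h1 := norm_coe_cpow_lt_one (inv_lt_one_of_one_lt (hc1 ξ)) hα0
    rw [← cpowHom_apply, ← sub_eq_zero.1 h, norm_one] at h1
    exact lt_irrefl _ h1
  have hU : eulerProd (I.val.map fun q => q.weight W.wt) α ≠ 0 := by
    refine eulerProd_ne_zero ?_ hα0
    simp only [Multiset.mem_map]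
    rintro _ ⟨q, -, rfl⟩
    exact orbit_weight_lt_one q
  have hV : eulerProd (T.val.map fun ξ => (c ξ)⁻¹) α ≠ 0 := by
    refine eulerProd_ne_zero ?_ hα0
    simp only [Multiset.mem_map]
    rintro _ ⟨ξ, -, rfl⟩
    exact inv_lt_one_of_one_lt (hc1 ξ)
  have hU' := exp_sum_neg_log hU
  have hV' := exp_sum_neg_log hV
  rw [Multiset.map_map] at hU' hV'
  convert h4 using 1
  · ext ξ
    simp only [Function.comp, hf, hcα, Complex.exp_neg, Complex.exp_log (hne ξ)]
  · rw [Complex.exp_add, Complex.exp_sub, hsdet]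
    change _ = _ / Complex.exp (Multiset.map _ _).sum * Complex.exp (Multiset.map _ _).sum
    simp only [Function.comp_def] at hU' hV'
    rw [hU', hV', div_inv_eq_mul, div_eq_mul_inv, mul_inv]
    ring

end WeightedSubst

end NumerationSystem
end

noncomputable section

namespace NumerationSystem

open Filter Topology

/-! ### Entire and meromorphic functions -/

theorem eventually_ne_zero_of_differentiable {f : ℂ → ℂ} (hf : Differentiable ℂ f) {a : ℂ}
    (ha : f a ≠ 0) (x : ℂ) : ∀ᶠ z in 𝓝[≠] x, f z ≠ 0 := by
  by_contra h
  have h1 : ∃ᶠ z in 𝓝[≠] x, f z = 0 := by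
    simpa only [Filter.not_eventually, not_not] using h
  have hA : AnalyticOnNhd ℂ f Set.univ := fun z _ => hf.analyticAt z
  exact ha (hA.eqOn_zero_of_preconnected_of_frequently_eq_zero isPreconnected_univ
    (Set.mem_univ x) h1 (Set.mem_univ a))

/-- The identity theorem: if the difference has infinite order at one point of the connected plane,
it has infinite order everywhere. -/
theorem eventuallyEq_nhdsNE_of_meromorphicOn {f h : ℂ → ℂ} (hf : MeromorphicOn f Set.univ)
    (hh : MeromorphicOn h Set.univ) {a : ℂ} (ha : f =ᶠ[𝓝[≠] a] h) (x : ℂ) : f =ᶠ[𝓝[≠] x] h := by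
  have hd := hf.sub hh
  have hiff : ∀ y, meromorphicOrderAt (f - h) y = ⊤ ↔ f =ᶠ[𝓝[≠] y] h := by
    intro y
    rw [meromorphicOrderAt_eq_top_iff]
    simp only [Pi.sub_apply, sub_eq_zero]
    rfl
  rw [← hiff]
  by_contra hx
  exact hd.meromorphicOrderAt_ne_top_of_isPreconnected isPreconnected_univ (Set.mem_univ x)
    (Set.mem_univ a) hx ((hiff a).2 ha)

namespace WeightedSubst

variable {A : Type*} {W : WeightedSubst A} {g : A → PosReal}

/-! ### Integral polynomials in `l ^ α` -/

theorem cpowHom_ne_zero (α : ℂ) (u : PosReal) : cpowHom α u ≠ 0 := by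
  rw [cpowHom_apply, Complex.cpow_ne_zero_iff]
  left; exact_mod_cast u.2.ne'

/-- An element `u < 1` of `G` is `L ^ (-k)`, and its factor times the `k`-th power of `L ^ α` is
that power minus `1`. -/
theorem exists_polynomial_eulerProd {L : PosReal} (hL : 1 < L)
    (hG : (W.baseSet : Set PosReal) = Set.range fun n : ℤ => L ^ n) {U : Multiset PosReal}
    (hU : ∀ u ∈ U, u ∈ W.baseSet ∧ u < 1) :
    ∃ (P : Polynomial ℤ) (N : ℕ), ∀ α : ℂ,
      Polynomial.aeval (cpowHom α L) P = cpowHom α L ^ N * eulerProd U α := by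
  induction U using Multiset.induction with
  | empty => exact ⟨1, 0, fun α => by simp [eulerProd]⟩
  | cons u U ih =>
    obtain ⟨P, N, hP⟩ := ih fun v hv => hU v (Multiset.mem_cons_of_mem hv)
    obtain ⟨huG, hu⟩ := hU u (Multiset.mem_cons_self u U)
    have hu' : u ∈ Set.range fun n : ℤ => L ^ n := hG ▸ huG
    obtain ⟨n, rfl⟩ := hu'
    have hn : n ≤ 0 := by
      by_contra hn
      push Not at hn
      exact (one_lt_zpow hL hn).not_gt hu
    obtain ⟨k, rfl⟩ := Int.exists_eq_neg_ofNat hn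
    refine ⟨(Polynomial.X ^ k - 1) * P, k + N, fun α => ?_⟩
    have hz := cpowHom_ne_zero α L
    rw [map_mul, hP]
    simp only [map_sub, map_pow, Polynomial.aeval_X, map_one, eulerProd, Multiset.map_cons,
      Multiset.prod_cons, zpow_neg, zpow_natCast, map_inv]
    have := pow_ne_zero k hz
    field_simp
    ring

/-- Only weights of returns are known to lie in `G`; a single edge weight does so after correction
by the values of `g` at its two ends. -/
theorem exists_zpow_eq_wt (hg : W.IsCompatible g) {L : PosReal}
    (hG : (W.baseSet : Set PosReal) = Set.range fun n : ℤ => L ^ n) (e : W.Edge) :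
    ∃ k : ℤ, W.wt e * g e.1 = L ^ k * g (W.σ e.1 e.2) := by
  have h : g e.1 * W.τ e.1 e.2 ∈ g (W.σ e.1 e.2) • (W.baseSet : Set PosReal) := by
    rw [hg, Set.mem_smul_set_iff_inv_smul_mem, smul_eq_mul, inv_mul_cancel]
    exact W.baseSet.one_mem
  rw [hG] at h
  obtain ⟨_, ⟨k, rfl⟩, h⟩ := h
  refine ⟨k, ?_⟩
  rw [wt, mul_comm, ← h]
  exact mul_comm _ _

variable [Finite A]

/-! ### The zeta function -/

theorem meromorphicOn_eulerQuotient (W : WeightedSubst A) (U V : Multiset PosReal) :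
    MeromorphicOn (fun α => eulerProd U α / (eulerProd V α * W.edgeDet α)) Set.univ := by
  intro x _
  have h1 := ((differentiable_eulerProd U).analyticAt x).meromorphicAt
  have h2 := ((differentiable_eulerProd V).analyticAt x).meromorphicAt
  have h3 := ((differentiable_edgeDet (W := W)).analyticAt x).meromorphicAt
  exact h1.fun_div (h2.fun_mul h3)

theorem analyticAt_eulerQuotient {U V : Multiset PosReal} {x : ℂ}
    (hx : eulerProd V x * W.edgeDet x ≠ 0) :
    AnalyticAt ℂ (fun α => eulerProd U α / (eulerProd V α * W.edgeDet α)) x :=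
  ((differentiable_eulerProd U).analyticAt x).fun_div
    (((differentiable_eulerProd V).analyticAt x).fun_mul (differentiable_edgeDet.analyticAt x)) hx

theorem zeta_spec [Nonempty A] (hg : W.IsCompatible g) :
    ∃ U V : Multiset PosReal, (∀ u ∈ U, u ∈ W.baseSet ∧ u < 1) ∧ (∀ v ∈ V, v ∈ W.baseSet ∧ v < 1) ∧
      W.IsZeta g (W.zeta g) ∧
      ∀ x, W.zeta g =ᶠ[𝓝[≠] x] fun α => eulerProd U α / (eulerProd V α * W.edgeDet α) := by
  obtain ⟨U, V, hU, hV, hprod⟩ := exists_hasProd_cycle hg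
  refine ⟨U, V, hU, hV, ?_⟩
  set R : ℂ → ℂ := fun α => eulerProd U α / (eulerProd V α * W.edgeDet α) with hR
  have hRm : MeromorphicOn R Set.univ := meromorphicOn_eulerQuotient W U V
  have hex : ∃ Z, W.IsZeta g Z := by
    -- `R` is analytic where `Re α > 1`, so passing to the normal form does not change the values
    -- given by the product.
    refine ⟨toMeromorphicNFOn R Set.univ, meromorphicNFOn_toMeromorphicNFOn _ _, fun α hα => ?_⟩
    have hne : eulerProd V α * W.edgeDet α ≠ 0 :=
      mul_ne_zero (eulerProd_ne_zero (fun v hv => (hV v hv).2) (by linarith)) (edgeDet_ne_zero hα)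
    have hNF : MeromorphicNFAt R α := (analyticAt_eulerQuotient hne).meromorphicNFAt
    rw [toMeromorphicNFOn_eq_toMeromorphicNFAt hRm (Set.mem_univ α),
      toMeromorphicNFAt_eq_self.2 hNF]
    exact hprod α hα
  have hZ : W.IsZeta g (W.zeta g) := by
    rw [zeta, dif_pos hex]
    exact hex.choose_spec
  refine ⟨hZ, eventuallyEq_nhdsNE_of_meromorphicOn (fun x hx => (hZ.1 hx).meromorphicAt) hRm
    (a := 2) ?_⟩
  have hopen : {α : ℂ | 1 < α.re} ∈ 𝓝 (2 : ℂ) :=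
    (isOpen_lt continuous_const Complex.continuous_re).mem_nhds (by simp)
  filter_upwards [mem_nhdsWithin_of_mem_nhds hopen] with α hα
  exact (hZ.2 α hα).unique (hprod α hα)

/-- Conjugation by the diagonal matrix of the `g ^ α` leaves the determinant unchanged and makes
each entry an integral power of `L ^ α`. -/
theorem exists_polynomial_edgeDet (hg : W.IsCompatible g) {L : PosReal}
    (hG : (W.baseSet : Set PosReal) = Set.range fun n : ℤ => L ^ n) :
    ∃ (P : Polynomial ℤ) (N : ℕ), ∀ α : ℂ,
      Polynomial.aeval (cpowHom α L) P = cpowHom α L ^ N * W.edgeDet α := by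
  classical
  let := Fintype.ofFinite A
  choose k hk using exists_zpow_eq_wt hg hG
  -- A uniform shift that makes all exponents `K + k e` nonnegative.
  set K : ℕ := ∑ e, (k e).natAbs with hK
  have hkK : ∀ e, 0 ≤ K + k e := by
    intro e
    have := Finset.single_le_sum (f := fun e => (k e).natAbs) (fun _ _ => Nat.zero_le _)
      (Finset.mem_univ e)
    omega
  let M : Matrix W.Edge W.Edge (Polynomial ℤ) := fun e f =>
    (if e = f then Polynomial.X ^ K else 0) -
      if W.adj e f then Polynomial.X ^ (K + k f).toNat else 0
  refine ⟨M.det, K * Fintype.card W.Edge, fun α => ?_⟩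
  set z := cpowHom α L with hz
  have hz0 : z ≠ 0 := cpowHom_ne_zero α L
  let d : W.Edge → ℂ := fun e => cpowHom α (g (W.σ e.1 e.2))
  have hd : ∀ e, d e ≠ 0 := fun e => cpowHom_ne_zero _ _
  have hM : M.map (Polynomial.aeval z) = Matrix.diagonal (fun e => z ^ K * d e) *
      (1 - Path.transferMatrix W.adj fun e => cpowHom α (W.wt e)) *
        Matrix.diagonal fun e => (d e)⁻¹ := by
    ext e f
    rw [Matrix.mul_diagonal, Matrix.diagonal_mul, Matrix.map_apply, Matrix.sub_apply,
      Matrix.one_apply, Path.transferMatrix]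
    have hadj : W.adj e f → z ^ (K + k f).toNat =
        z ^ K * d e * cpowHom α (W.wt f) * (d f)⁻¹ := by
      intro h
      have h1 : cpowHom α (W.wt f) * d e = z ^ (k f) * d f := by
        have h2 : d e = cpowHom α (g f.1) := congrArg (fun a => cpowHom α (g a)) h.symm
        rw [h2, ← map_mul, hk, map_mul, map_zpow]
      have h2 : z ^ (K + k f).toNat = z ^ K * z ^ (k f) := by
        rw [← zpow_natCast z (K + k f).toNat, Int.toNat_of_nonneg (hkK f), zpow_add₀ hz0,
          zpow_natCast]
      rw [h2, mul_assoc (z ^ K), mul_comm (d e), h1]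
      have := hd f
      field_simp
    have hdiag : e = f → z ^ K = z ^ K * d e * (d f)⁻¹ := by
      rintro rfl
      rw [mul_assoc, mul_inv_cancel₀ (hd e), mul_one]
    simp only [M, map_sub, apply_ite (Polynomial.aeval z), map_pow, Polynomial.aeval_X, map_zero]
    rw [mul_sub, sub_mul]
    congr 1
    · split_ifs with h
      · rw [mul_one]; exact hdiag h
      · ring
    · split_ifs with h
      · exact hadj h
      · ring
  have hdet : Polynomial.aeval z M.det = (M.map (Polynomial.aeval z)).det :=
    (Polynomial.aeval z).map_det M
  rw [hdet, hM, Matrix.det_mul, Matrix.det_mul, Matrix.det_diagonal, Matrix.det_diagonal,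
    Finset.prod_mul_distrib, Finset.prod_const, Finset.card_univ, ← pow_mul, edgeDet,
    Finset.prod_inv_distrib]
  have : ∏ e, d e ≠ 0 := Finset.prod_ne_zero_iff.2 fun e _ => hd e
  field_simp

theorem zeta_eq_rational [Nonempty A] (hg : W.IsCompatible g) {L : PosReal} (hL : 1 < L)
    (hG : (W.baseSet : Set PosReal) = Set.range fun n : ℤ => L ^ n) :
    ∃ p q : Polynomial ℤ, q ≠ 0 ∧ ∀ α : ℂ, Polynomial.aeval (cpowHom α L) q ≠ 0 →
      W.zeta g α = Polynomial.aeval (cpowHom α L) p / Polynomial.aeval (cpowHom α L) q := by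
  obtain ⟨U, V, hU, hV, hZ, heq⟩ := zeta_spec hg
  obtain ⟨P₁, N₁, h₁⟩ := exists_polynomial_eulerProd hL hG hU
  obtain ⟨P₂, N₂, h₂⟩ := exists_polynomial_eulerProd hL hG hV
  obtain ⟨P₃, N₃, h₃⟩ := exists_polynomial_edgeDet hg hG
  set p := P₁ * Polynomial.X ^ (N₂ + N₃) with hp
  set q := P₂ * P₃ * Polynomial.X ^ N₁ with hq
  have hpα : ∀ α, Polynomial.aeval (cpowHom α L) p =
      cpowHom α L ^ (N₁ + N₂ + N₃) * eulerProd U α := by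
    intro α
    rw [hp, map_mul, h₁, map_pow, Polynomial.aeval_X]; ring
  have hqα : ∀ α, Polynomial.aeval (cpowHom α L) q =
      cpowHom α L ^ (N₁ + N₂ + N₃) * (eulerProd V α * W.edgeDet α) := by
    intro α
    rw [hq, map_mul, map_mul, h₂, h₃, map_pow, Polynomial.aeval_X]; ring
  have hz : ∀ α, cpowHom α L ^ (N₁ + N₂ + N₃) ≠ 0 := fun α => pow_ne_zero _ (cpowHom_ne_zero α L)
  refine ⟨p, q, ?_, fun α hα => ?_⟩
  · intro h0
    have h1 := hqα 2
    rw [h0, map_zero] at h1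
    exact mul_ne_zero (hz 2) (mul_ne_zero (eulerProd_ne_zero (fun v hv => (hV v hv).2) (by simp))
      (edgeDet_ne_zero (by simp))) h1.symm
  · rw [hqα] at hα ⊢
    rw [hpα, mul_div_mul_left _ _ (hz α)]
    have hne := right_ne_zero_of_mul hα
    -- Agreement on a punctured neighbourhood becomes agreement at the point because both functions
    -- are in normal form there.
    exact (((hZ.1 (Set.mem_univ α)).eventuallyEq_nhdsNE_iff_eventuallyEq_nhds
      (analyticAt_eulerQuotient hne).meromorphicNFAt).1 (heq α)).eq_of_nhds

end WeightedSubst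

end NumerationSystem
end

noncomputable section

namespace NumerationSystem

open Filter Topology

namespace WeightedSubst

variable {A : Type*} {W : WeightedSubst A} {g : A → PosReal}

/-! ### Singularities on the line `Re α = 1` -/

theorem iter_weight_lt_one {n : ℕ} (hn : 0 < n) {a b : A} {t : PosReal}
    (h : (b, t) ∈ W.iter n a) : t < 1 := by
  induction n generalizing a b t with
  | zero => exact absurd hn (lt_irrefl 0)
  | succ n ih =>
    simp only [iter, List.mem_flatten, List.mem_ofFn] at h
    obtain ⟨_, ⟨i, rfl⟩, h⟩ := h
    obtain ⟨⟨c, s⟩, hs, heq⟩ := List.mem_map.1 h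
    obtain ⟨rfl, rfl⟩ := Prod.mk.inj heq
    have hτ : W.τ a i < 1 := W.τ_lt_one a i
    rcases n.eq_zero_or_pos with rfl | hn'
    · simp only [iter, List.mem_singleton, Prod.mk.injEq] at hs
      rw [hs.2, mul_one]
      exact hτ
    · exact mul_lt_one' hτ (ih hn' hs)

theorem edgeDet_eq_zero_iff [Fintype A] [DecidableEq A] (α : ℂ) :
    W.edgeDet α = 0 ↔ ∃ v : W.Edge → ℂ, v ≠ 0 ∧
      ∀ e, v e = ∑ i, cpowHom α (W.τ (W.σ e.1 e.2) i) * v ⟨W.σ e.1 e.2, i⟩ := by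
  classical
  have hinst : W.edgeDet α =
      (1 - Path.transferMatrix W.adj fun e => cpowHom α (W.wt e)).det := by
    rw [edgeDet]
    congr!
  rw [hinst, ← Matrix.exists_mulVec_eq_zero_iff]
  refine exists_congr fun v => and_congr_right fun _ => ?_
  rw [funext_iff]
  refine forall_congr' fun e => ?_
  have hsum : (Path.transferMatrix W.adj fun e => cpowHom α (W.wt e)).mulVec v e =
      ∑ i, cpowHom α (W.τ (W.σ e.1 e.2) i) * v ⟨W.σ e.1 e.2, i⟩ := by
    rw [Matrix.mulVec, dotProduct, Fintype.sum_sigma,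
      Finset.sum_eq_single (W.σ e.1 e.2) _ (by simp)]
    · refine Finset.sum_congr rfl fun i _ => ?_
      rw [Path.transferMatrix, if_pos (show W.adj e ⟨W.σ e.1 e.2, i⟩ from rfl)]
      rfl
    · intro b _ hb
      refine Finset.sum_eq_zero fun i _ => ?_
      rw [Path.transferMatrix, if_neg (show ¬ W.adj e ⟨b, i⟩ from hb), zero_mul]
  rw [Matrix.sub_mulVec, Matrix.one_mulVec, Pi.sub_apply, hsum, Pi.zero_apply, sub_eq_zero]

/-- The constant vector is fixed, since the weights of each word sum to `1`. This is the source of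
the pole at `1`. -/
theorem edgeDet_one [Finite A] [Nonempty A] : W.edgeDet 1 = 0 := by
  classical
  let := Fintype.ofFinite A
  rw [edgeDet_eq_zero_iff]
  have : Nonempty W.Edge := ⟨⟨Classical.arbitrary A, W.first _⟩⟩
  refine ⟨1, one_ne_zero, fun e => ?_⟩
  simp only [Pi.one_apply, mul_one, cpowHom_apply, Complex.cpow_one]
  rw [← Complex.ofReal_sum, W.sum_τ, Complex.ofReal_one]

/-- Expand `‖w - z‖ ^ 2`: it is at most `2 M ^ 2` minus twice the real part. -/
theorem eq_of_re_conj_mul_eq {z w : ℂ} {M : ℝ} (hz : ‖z‖ = M) (hw : ‖w‖ ≤ M)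
    (h : M ^ 2 ≤ (starRingEnd ℂ z * w).re) : w = z := by
  have h1 : ‖w - z‖ ^ 2 ≤ 0 := by
    have hw2 : ‖w‖ ^ 2 ≤ M ^ 2 := by gcongr
    have hz2 : ‖z‖ ^ 2 = M ^ 2 := by rw [hz]
    rw [← Complex.normSq_eq_norm_sq, Complex.normSq_apply] at hw2 hz2 ⊢
    simp only [Complex.mul_re, Complex.conj_re, Complex.conj_im, Complex.sub_re,
      Complex.sub_im] at h ⊢
    nlinarith
  have h2 : ‖w - z‖ = 0 := by
    have := norm_nonneg (w - z)
    nlinarith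
  exact sub_eq_zero.1 (norm_eq_zero.1 h2)

theorem cpowHom_add (α β : ℂ) (u : PosReal) : cpowHom (α + β) u = cpowHom α u * cpowHom β u := by
  simp only [cpowHom_apply]
  exact Complex.cpow_add _ _ (by exact_mod_cast u.2.ne')

theorem norm_cpowHom_mul_I (t : ℝ) (u : PosReal) : ‖cpowHom (t * Complex.I) u‖ = 1 := by
  rw [cpowHom_apply, Complex.norm_cpow_eq_rpow_re_of_pos u.2]
  simp

/-- A zero of the determinant on the line `Re α = 1` restricts the weights of the returns. -/
theorem cpowHom_eq_one_of_edgeDet_eq_zero [Finite A] (hW : W.IsPrimitive) {t : ℝ}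
    (ht : W.edgeDet (1 + t * Complex.I) = 0) {a : A} {n : ℕ} {s : PosReal}
    (hs : (a, s) ∈ W.iter n a) : cpowHom (t * Complex.I) s = 1 := by
  classical
  let := Fintype.ofFinite A
  obtain ⟨v, hv, hve⟩ := (edgeDet_eq_zero_iff _).1 ht
  -- The fixed vector depends only on the letter its edge points to, so it descends to a function on
  -- letters.
  let u : A → ℂ := fun a => ∑ i, cpowHom (1 + t * Complex.I) (W.τ a i) * v ⟨a, i⟩
  have hvu : ∀ e, v e = u (W.σ e.1 e.2) := hve
  have hu : ∀ a, u a = ∑ i, (W.τ a i : ℝ) * (cpowHom (t * Complex.I) (W.τ a i) * u (W.σ a i)) := by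
    intro a
    refine Finset.sum_congr rfl fun i _ => ?_
    rw [hvu, cpowHom_add, mul_assoc, cpowHom_apply 1, Complex.cpow_one]
  have : Nonempty A := ⟨a⟩
  obtain ⟨b, hb⟩ := Finite.exists_max fun a => ‖u a‖
  set M := ‖u b‖ with hM
  have hM0 : M ≠ 0 := by
    intro h
    refine hv (funext fun e => ?_)
    have := hb (W.σ e.1 e.2)
    rw [h] at this
    rw [hvu]
    exact norm_le_zero_iff.1 this
  -- Here `u a` is an average, with positive weights, of numbers of modulus at most `M`; when its
  -- own modulus is `M`, all of them equal it.
  have hstep : ∀ a, ‖u a‖ = M → ∀ i, cpowHom (t * Complex.I) (W.τ a i) * u (W.σ a i) = u a := by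
    intro a ha
    set r : Fin (W.len a) → ℝ := fun i =>
      (starRingEnd ℂ (u a) * (cpowHom (t * Complex.I) (W.τ a i) * u (W.σ a i))).re with hr
    have hle : ∀ i, ‖cpowHom (t * Complex.I) (W.τ a i) * u (W.σ a i)‖ ≤ M := by
      intro i
      rw [norm_mul, norm_cpowHom_mul_I, one_mul]
      exact hb _
    have hrle : ∀ i, r i ≤ M ^ 2 := by
      intro i
      refine (Complex.re_le_norm _).trans ?_
      rw [norm_mul, Complex.norm_conj, ha, sq]
      exact mul_le_mul_of_nonneg_left (hle i) (norm_nonneg _)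
    have hsum : ∑ i, (W.τ a i : ℝ) * (M ^ 2 - r i) = 0 := by
      have h1 : (starRingEnd ℂ (u a) * u a).re = ∑ i, (W.τ a i : ℝ) * r i := by
        rw [congrArg (starRingEnd ℂ (u a) * ·) (hu a), Finset.mul_sum, Complex.re_sum]
        refine Finset.sum_congr rfl fun i _ => ?_
        rw [mul_left_comm, Complex.re_ofReal_mul]
      have h2 : (starRingEnd ℂ (u a) * u a).re = M ^ 2 := by
        rw [← ha, mul_comm, Complex.mul_conj, Complex.ofReal_re, Complex.normSq_eq_norm_sq]
      simp only [mul_sub, Finset.sum_sub_distrib]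
      rw [← h1, h2, ← Finset.sum_mul, W.sum_τ, one_mul, sub_self]
    intro i
    have h3 := (Finset.sum_eq_zero_iff_of_nonneg fun i _ =>
      mul_nonneg (W.τ a i).2.le (sub_nonneg.2 (hrle i))).1 hsum i (Finset.mem_univ i)
    have h4 := (mul_eq_zero.1 h3).resolve_left (W.τ a i).2.ne'
    exact eq_of_re_conj_mul_eq ha (hle i) (sub_eq_zero.1 h4).le
  have hiter : ∀ n a, ‖u a‖ = M → ∀ c s, (c, s) ∈ W.iter n a →
      cpowHom (t * Complex.I) s * u c = u a := by
    intro n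
    induction n with
    | zero =>
      intro a _ c s hs
      simp only [iter, List.mem_singleton, Prod.mk.injEq] at hs
      rw [hs.1, hs.2, map_one, one_mul]
    | succ n ih =>
      intro a ha c s hs
      simp only [iter, List.mem_flatten, List.mem_ofFn] at hs
      obtain ⟨_, ⟨i, rfl⟩, hs⟩ := hs
      obtain ⟨⟨c', s'⟩, hs', heq⟩ := List.mem_map.1 hs
      obtain ⟨rfl, rfl⟩ := Prod.mk.inj heq
      have h1 := hstep a ha i
      have h2 : ‖u (W.σ a i)‖ = M := by
        rw [← ha, ← h1, norm_mul, norm_cpowHom_mul_I, one_mul]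
      rw [map_mul, mul_assoc, ih _ h2 _ _ hs', h1]
  -- Primitivity carries the maximal modulus from `b` to every letter.
  have hall : ∀ a, ‖u a‖ = M := by
    intro a
    obtain ⟨n, -, hn⟩ := hW
    obtain ⟨s, hs⟩ := hn b a
    rw [hM, ← hiter n b rfl a s hs, norm_mul, norm_cpowHom_mul_I, one_mul]
  refine mul_right_cancel₀ (b := u a) (fun h => hM0 ?_) ?_
  · rw [← hall a, h, norm_zero]
  · rw [hiter n a (hall a) a s hs, one_mul]

theorem exists_zpow_eq_of_cpowHom_eq_one {L : PosReal} (hL : 1 < L) {s : PosReal}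
    (hs : cpowHom ((2 * Real.pi / Real.log L : ℝ) * Complex.I) s = 1) : ∃ n : ℤ, s = L ^ n := by
  have hlog : 0 < Real.log L := Real.log_pos hL
  rw [cpowHom_apply, Complex.cpow_def_of_ne_zero (by exact_mod_cast s.2.ne'),
    Complex.exp_eq_one_iff] at hs
  obtain ⟨n, hn⟩ := hs
  refine ⟨n, Subtype.ext ?_⟩
  have h1 : Real.log s = n * Real.log L := by
    rw [← Complex.ofReal_log s.2.le] at hn
    have h2 := congrArg Complex.im hn
    simp only [Complex.mul_im, Complex.mul_re, Complex.ofReal_re, Complex.ofReal_im, Complex.I_re,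
      Complex.I_im, Complex.intCast_re, Complex.intCast_im, Complex.re_ofNat, Complex.im_ofNat] at h2
    have hpi := Real.pi_pos
    simp only [mul_zero, mul_one, zero_mul, add_zero, sub_zero] at h2
    field_simp at h2
    linarith
  have h3 : ((L ^ n : PosReal) : ℝ) = (L : ℝ) ^ n := by
    simp
  rw [h3, ← Real.exp_log s.2, h1, ← Real.log_zpow, Real.exp_log (zpow_pos L.2 n)]

/-- The kernel of the continuous character `s ↦ s ^ (2πi / log L)` is a closed subgroup containing
all return weights, so it contains `G`; this kernel consists of powers of `L`. -/
theorem baseSet_le_zpowers [Finite A] (hW : W.IsPrimitive) {L : PosReal} (hL : 1 < L)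
    (h0 : W.edgeDet (1 + (2 * Real.pi / Real.log L : ℝ) * Complex.I) = 0) {s : PosReal}
    (hs : s ∈ W.baseSet) : ∃ n : ℤ, s = L ^ n := by
  refine exists_zpow_eq_of_cpowHom_eq_one hL ?_
  set χ := cpowHom ((2 * Real.pi / Real.log L : ℝ) * Complex.I) with hχ
  have hle : W.baseSet ≤ χ.ker := by
    refine sInf_le ⟨?_, ?_⟩
    · have hc : Continuous χ := by
        refine continuous_iff_continuousAt.2 fun u => ?_
        have h1 : ContinuousAt (fun z : ℂ => z ^ ((2 * Real.pi / Real.log L : ℝ) * Complex.I))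
            ((u : ℝ) : ℂ) := continuousAt_cpow_const (Or.inl u.2)
        exact h1.comp (f := fun u : PosReal => ((u : ℝ) : ℂ)) (by fun_prop)
      exact isClosed_singleton.preimage hc
    · rintro t ⟨a, n, ht⟩
      exact cpowHom_eq_one_of_edgeDet_eq_zero hW h0 ht
  exact hle hs

/-- The exponents form a subgroup of `ℤ`, hence a cyclic one. It is nonzero because primitivity
provides a return of positive length, whose weight is below `1`. -/
theorem baseSet_eq_range_zpow [Finite A] [Nonempty A] (hW : W.IsPrimitive) {L : PosReal}
    (hL : 1 < L)
    (h0 : W.edgeDet (1 + (2 * Real.pi / Real.log L : ℝ) * Complex.I) = 0) :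
    ∃ k : ℕ, 0 < k ∧ (W.baseSet : Set PosReal) = Set.range fun n : ℤ => L ^ ((k : ℤ) * n) := by
  let K : AddSubgroup ℤ :=
    { carrier := {n | L ^ n ∈ W.baseSet}
      zero_mem' := by simp [W.baseSet.one_mem]
      add_mem' := fun {m n} hm hn => by
        change L ^ (m + n) ∈ W.baseSet
        rw [zpow_add]; exact W.baseSet.mul_mem hm hn
      neg_mem' := fun {n} hn => by
        change L ^ (-n) ∈ W.baseSet
        rw [zpow_neg]; exact W.baseSet.inv_mem hn }
  have hK : ∀ n, n ∈ K ↔ L ^ n ∈ W.baseSet := fun n => Iff.rfl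
  obtain ⟨m, hm⟩ := Int.subgroup_cyclic K
  have hm' : ∀ n, n ∈ K ↔ m ∣ n := by
    intro n
    rw [hm, ← AddSubgroup.zmultiples_eq_closure, Int.mem_zmultiples_iff]
  have hm0 : m ≠ 0 := by
    rintro rfl
    obtain ⟨N, hN, h⟩ := hW
    obtain ⟨s, hs⟩ := h (Classical.arbitrary A) (Classical.arbitrary A)
    obtain ⟨n, rfl⟩ := baseSet_le_zpowers ⟨N, hN, h⟩ hL h0 (mem_baseSet_of_mem_iter hs)
    have hn := (hm' n).1 ((hK n).2 (mem_baseSet_of_mem_iter hs))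
    rw [zero_dvd_iff] at hn
    have := iter_weight_lt_one hN hs
    rw [hn, zpow_zero] at this
    exact lt_irrefl _ this
  refine ⟨m.natAbs, Int.natAbs_pos.2 hm0, ?_⟩
  ext s
  constructor
  · intro hs
    obtain ⟨n, rfl⟩ := baseSet_le_zpowers hW hL h0 hs
    obtain ⟨j, rfl⟩ := Int.natAbs_dvd.2 ((hm' n).1 ((hK n).2 hs))
    exact ⟨j, rfl⟩
  · rintro ⟨j, rfl⟩
    exact (hK _).1 ((hm' _).2 (Int.natAbs_dvd.1 (dvd_mul_right _ j)))

/-- A function of `L ^ α` has period `2πi / log L`, which moves the pole at `1` up the line `Re α =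
1`. No finite Euler product vanishes there, so only `edgeDet` can produce the new pole. -/
theorem edgeDet_eq_zero_of_zeta_eq_rational [Finite A] [Nonempty A] (hg : W.IsCompatible g)
    {L : PosReal} (hL : 1 < L) {p q : Polynomial ℤ} (hq : q ≠ 0)
    (h : ∀ α : ℂ, Polynomial.aeval (cpowHom α L) q ≠ 0 →
      W.zeta g α = Polynomial.aeval (cpowHom α L) p / Polynomial.aeval (cpowHom α L) q) :
    W.edgeDet (1 + (2 * Real.pi / Real.log L : ℝ) * Complex.I) = 0 := by
  obtain ⟨U, V, hU, hV, -, heq⟩ := zeta_spec hg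
  set R : ℂ → ℂ := fun α => eulerProd U α / (eulerProd V α * W.edgeDet α) with hR
  set c : ℂ := (2 * Real.pi / Real.log L : ℝ) * Complex.I with hc
  have hlog : 0 < Real.log L := Real.log_pos hL
  have hL0 : ((L : ℝ) : ℂ) ≠ 0 := by exact_mod_cast L.2.ne'
  have hper : ∀ α, cpowHom (α + c) L = cpowHom α L := by
    intro α
    have h1 : cpowHom c L = 1 := by
      rw [cpowHom_apply, Complex.cpow_def_of_ne_zero hL0, Complex.exp_eq_one_iff]
      refine ⟨1, ?_⟩
      rw [← Complex.ofReal_log L.2.le, hc]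
      have : ((Real.log L : ℝ) : ℂ) ≠ 0 := by exact_mod_cast hlog.ne'
      push_cast
      field_simp
    rw [cpowHom_add, h1, mul_one]
  have hqd : Differentiable ℂ fun α : ℂ => Polynomial.aeval (cpowHom α L) q := by
    have h1 : Differentiable ℂ fun α : ℂ => cpowHom α L :=
      differentiable_id.const_cpow (Or.inl hL0)
    exact (q.differentiable_aeval).comp h1
  -- Otherwise `q` would vanish at the infinitely many numbers `L ^ n`.
  have hq0 : ∃ a : ℂ, Polynomial.aeval (cpowHom a L) q ≠ 0 := by
    by_contra hcon
    push Not at hcon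
    refine hq ((Polynomial.map_eq_zero_iff (f := algebraMap ℤ ℂ)
      (RingHom.injective_int (algebraMap ℤ ℂ))).1 ?_)
    refine Polynomial.eq_zero_of_infinite_isRoot _ ((Set.infinite_range_of_injective
      (f := fun n : ℕ => cpowHom (n : ℂ) L) ?_).mono ?_)
    · intro m n hmn
      simp only [cpowHom_apply, Complex.cpow_natCast] at hmn
      exact pow_right_injective₀ L.2 (show (1 : ℝ) < L from hL).ne' (by exact_mod_cast hmn)
    · rintro _ ⟨n, rfl⟩
      change Polynomial.eval _ _ = 0
      rw [Polynomial.eval_map_algebraMap]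
      exact hcon n
  obtain ⟨a, ha⟩ := hq0
  set F : ℂ → ℂ := fun α => Polynomial.aeval (cpowHom α L) p / Polynomial.aeval (cpowHom α L) q
    with hF
  have hFR : ∀ x, F =ᶠ[𝓝[≠] x] R := by
    intro x
    filter_upwards [eventually_ne_zero_of_differentiable hqd ha x, heq x] with α h1 h2
    rw [← h2, h α h1]
  have hVd : Differentiable ℂ fun α => eulerProd V α * W.edgeDet α :=
    (differentiable_eulerProd V).mul differentiable_edgeDet
  have hV2 : eulerProd V 2 * W.edgeDet 2 ≠ 0 :=
    mul_ne_zero (eulerProd_ne_zero (fun v hv => (hV v hv).2) (by simp)) (edgeDet_ne_zero (by simp))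
  -- The pole is expressed by the inverse tending to `0`, a property that moves easily between `R`
  -- and the periodic function `F`.
  have hinv : Tendsto R⁻¹ (𝓝[≠] 1) (𝓝 0) := by
    have h1 : ContinuousAt (fun α => eulerProd V α * W.edgeDet α / eulerProd U α) 1 :=
      hVd.continuous.continuousAt.div (differentiable_eulerProd U).continuous.continuousAt
        (eulerProd_ne_zero (fun u hu => (hU u hu).2) (by simp))
    have h2 : R⁻¹ = fun α => eulerProd V α * W.edgeDet α / eulerProd U α := by
      ext α
      rw [Pi.inv_apply, hR, inv_div]
    have h3 := h1.tendsto
    rw [edgeDet_one, mul_zero, zero_div] at h3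
    rw [h2]
    exact h3.mono_left nhdsWithin_le_nhds
  have hshift : Tendsto (fun α : ℂ => α - c) (𝓝[≠] (1 + c)) (𝓝[≠] 1) := by
    refine tendsto_nhdsWithin_iff.2 ⟨?_, ?_⟩
    · have : Tendsto (fun α : ℂ => α - c) (𝓝 (1 + c)) (𝓝 (1 + c - c)) :=
        (continuous_id.sub continuous_const).tendsto _
      rw [add_sub_cancel_right] at this
      exact this.mono_left nhdsWithin_le_nhds
    · filter_upwards [self_mem_nhdsWithin] with α hα
      exact fun h => hα (sub_eq_iff_eq_add.1 h)
  have hFc : Tendsto F⁻¹ (𝓝[≠] (1 + c)) (𝓝 0) := by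
    have h1 : Tendsto F⁻¹ (𝓝[≠] 1) (𝓝 0) := hinv.congr' (hFR 1).symm.inv
    refine (h1.comp hshift).congr fun α => ?_
    have := hper (α - c)
    rw [sub_add_cancel] at this
    simp only [Function.comp, Pi.inv_apply, hF, this]
  have hRc : Tendsto R⁻¹ (𝓝[≠] (1 + c)) (𝓝 0) := hFc.congr' (hFR _).inv
  -- If `edgeDet` did not vanish, `R` would be continuous and nonzero at the translated point, so
  -- its inverse could not tend to `0`.
  by_contra hne
  have hV1 : eulerProd V (1 + c) * W.edgeDet (1 + c) ≠ 0 :=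
    mul_ne_zero (eulerProd_ne_zero (fun v hv => (hV v hv).2) (by simp [hc])) hne
  have hU1 : eulerProd U (1 + c) ≠ 0 :=
    eulerProd_ne_zero (fun v hv => (hU v hv).2) (by simp [hc])
  have hRcont : ContinuousAt R (1 + c) := (analyticAt_eulerQuotient hV1).continuousAt
  have h0 : R (1 + c) ≠ 0 := div_ne_zero hU1 hV1
  have h2 := (hRcont.inv₀ h0).tendsto.mono_left (nhdsWithin_le_nhds (s := {1 + c}ᶜ))
  exact inv_ne_zero h0 (tendsto_nhds_unique h2 hRc)

end WeightedSubst

end NumerationSystem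
end

/-! ### The main theorem, with base sets read as sets of real numbers. -/

theorem theorem4p3 {A : Type*} [Finite A] [Nonempty A]
    (W : NumerationSystem.WeightedSubst A) (hW : W.IsPrimitive)
    (g : A → NumerationSystem.PosReal) (hg : W.IsCompatible g) :
    -- the zeta function is well defined
    W.IsZeta g (W.zeta g) ∧
    -- a discrete base set gives a rational function of `l ^ α` with integer coefficients
    (∀ l : ℝ, 1 < l →
      (Subtype.val '' (W.baseSet : Set NumerationSystem.PosReal) =
        Set.range fun n : ℤ => l ^ n) →
      ∃ p q : Polynomial ℤ, q ≠ 0 ∧ ∀ α : ℂ, Polynomial.aeval ((l : ℂ) ^ α) q ≠ 0 →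
        W.zeta g α = Polynomial.aeval ((l : ℂ) ^ α) p / Polynomial.aeval ((l : ℂ) ^ α) q) ∧
    -- the converse
    (∀ l : ℝ, 1 < l → ∀ p q : Polynomial ℤ, q ≠ 0 →
      (∀ α : ℂ, Polynomial.aeval ((l : ℂ) ^ α) q ≠ 0 →
        W.zeta g α = Polynomial.aeval ((l : ℂ) ^ α) p / Polynomial.aeval ((l : ℂ) ^ α) q) →
      ∃ k : ℕ, 0 < k ∧
        (Subtype.val '' (W.baseSet : Set NumerationSystem.PosReal) =
          Set.range fun n : ℤ => l ^ ((k : ℤ) * n))) := by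
  have hzpow : ∀ (L : NumerationSystem.PosReal) (n : ℤ),
      ((L ^ n : NumerationSystem.PosReal) : ℝ) = (L : ℝ) ^ n := fun L n => by simp
  refine ⟨?_, fun l hl hG => ?_, fun l hl p q hq h => ?_⟩
  · obtain ⟨-, -, -, -, hZ, -⟩ := NumerationSystem.WeightedSubst.zeta_spec hg
    exact hZ
  · let L : NumerationSystem.PosReal := ⟨l, one_pos.trans hl⟩
    refine NumerationSystem.WeightedSubst.zeta_eq_rational hg (L := L) hl
      (Subtype.val_injective.image_injective (hG.trans ?_))
    rw [← Set.range_comp]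
    exact congrArg Set.range (funext fun n => (hzpow L n).symm)
  · let L : NumerationSystem.PosReal := ⟨l, one_pos.trans hl⟩
    obtain ⟨k, hk, hG⟩ := NumerationSystem.WeightedSubst.baseSet_eq_range_zpow hW (L := L) hl
      (NumerationSystem.WeightedSubst.edgeDet_eq_zero_of_zeta_eq_rational hg hl hq h)
    refine ⟨k, hk, ?_⟩
    rw [hG, ← Set.range_comp]
    exact congrArg Set.range (funext fun n => hzpow L _)
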